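/- Let $F:\Sigma^n\to\mathbb R^{n+1}$ be a smooth immersed hypersurface with a globally defined smooth unit normal field $\nu$ (Gauss map), and let $g_{ij}=\langle\partial_iF,\partial_jF\rangle$, $h_{ij}=\langle\partial_i\partial_jF,\nu\rangle$, $H=g^{ij}h_{ij}$. Suppose that the induced metric is complete, that $\Sigma$ is a self-expander, $H=\tfrac12\langle F,\nu\rangle$, and that $\Sigma$ is mean-convex, $H>0$. For a unit vector $e$ and $0<\alpha\le\pi/2$ let $\mathcal C_{e,\alpha}=\{x\in\mathbb R^{n+1}:\langle x,e\rangle=|x|\cos\alpha\}$ be the round cone of angle $\alpha$ about $e$; its axis is $\mathbb R e$. Let $\check\nu$ be the unit normal of $\mathcal C_{e,\alpha}\setminus\{0\}$ with $\langle\check\nu,e\rangle>0$, and let $\check\nabla$, $|\cdot|_{\check g}$ be the covariant derivative and norm of its induced metric. An end of $\Sigma$ is represented by a connected open set $E\subset\Sigma$ with compact frontier and non-compact closure. It is $C^k$-asymptotic to $\mathcal C_{e,\alpha}$ if there are $\rho>0$, a function $u\in C^k(\mathcal C_{e,\alpha}\setminus \overline{B_\rho(0)})$ and a $C^k$ parametrization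 $\varphi$ of $E$ by $\mathcal C_{e,\alpha}\setminus \overline{B_\rho(0)}$ (a homeomorphism onto $E$) such that $$F(\varphi(p))=p+u(p)\,\check\nu(p),\qquad |\check\nabla^ju(x)|_{\check g}=o(|x|^{-j})\ \text{ as } |x|\to\infty,\quad j=0,1,\dots,k .$$ Let $e$ be a unit vector and consider, for a given $k$, the following two conditions. 1. $\Sigma$ has exactly one end $E$ (that is, $\Sigma\setminus E$ is compact), and $E$ is $C^k$-asymptotic to a round cone with axis $\mathbb Re$. 2. $\Sigma$ has exactly two ends $E_\alpha$, $E_\beta$ (disjoint, with $\Sigma\setminus(E_\alpha\cup E_\beta)$ compact), and each of them is $C^k$-asymptotic to a round cone with axis $\mathbb Re$. The two cone angles $\alpha,\beta\in(0,\pi/2]$ may differ, and each cone may open in the direction $e$ or $-e$. If (1) or (2) holds with $k=2$, then $\Sigma$ is rotationally symmetric about the axis $\mathbb Re$: $F(\Sigma)$ is invariant under every linear isometry of $\mathbb R^{n+1}$ that fixes $e$, and for every rotation $g$ about the axis (a linear isometry with $ge=e$ and $\det g=1$) there is a diffeomorphism $\psi$ of $\Sigma$ with $F\circ\psi=g\circ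 F$. If in addition $\Sigma$ is convex, i.e. the second fundamental form $(h_{ij})$ is nonnegative, then the same conclusion holds if (1) or (2) holds with $k=1$ only. -/

import Mathlib

open Set Filter Topology MeasureTheory Asymptotics
open scoped Manifold ContDiff ENNReal Matrix

noncomputable section

/-- Euclidean space of dimension `m`. -/
abbrev Euc (m : ℕ) : Type := EuclideanSpace ℝ (Fin m)

/-! Geometry of a patch `X : ℝⁿ → ℝⁿ⁺¹` in the coordinates of `ℝⁿ`. -/

/-- The partial derivative `∂ᵢ f`. -/
def pderiv {n : ℕ} {W : Type*} [NormedAddCommGroup W] [NormedSpace ℝ W]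
    (i : Fin n) (f : Euc n → W) (y : Euc n) : W :=
  fderiv ℝ f y (EuclideanSpace.single i 1)

/-- First fundamental form `gᵢⱼ = ⟨∂ᵢX, ∂ⱼX⟩`. -/
def firstForm {n : ℕ} (X : Euc n → Euc (n + 1)) (y : Euc n) : Matrix (Fin n) (Fin n) ℝ :=
  Matrix.of fun i j => inner ℝ (pderiv i X y) (pderiv j X y)

/-- Second fundamental form `hᵢⱼ = ⟨∂ᵢ∂ⱼX, N⟩` with respect to the normal vector `N`. -/
def secondForm {n : ℕ} (X : Euc n → Euc (n + 1)) (N : Euc (n + 1)) (y : Euc n) :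
    Matrix (Fin n) (Fin n) ℝ :=
  Matrix.of fun i j => inner ℝ (pderiv i (pderiv j X) y) N

/-- Christoffel symbols `Γˡᵢⱼ = gˡᵐ ⟨∂ᵢ∂ⱼX, ∂ₘX⟩` of the induced metric. -/
def christoffel {n : ℕ} (X : Euc n → Euc (n + 1)) (l i j : Fin n) (y : Euc n) : ℝ :=
  ∑ m, (firstForm X y)⁻¹ l m * inner ℝ (pderiv i (pderiv j X) y) (pderiv m X y)

/-- Covariant derivative of a covariant tensor field `T` of order `m`, given by its components:
`(∇T)_{i₀ i₁ … iₘ} = ∂_{i₀} T_{i₁ … iₘ} - ∑ₐ Γˡ_{i₀ iₐ} T_{i₁ … l … iₘ}`. -/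
def covDeriv {n m : ℕ} (X : Euc n → Euc (n + 1)) (T : Euc n → (Fin m → Fin n) → ℝ) :
    Euc n → (Fin (m + 1) → Fin n) → ℝ :=
  fun y I => pderiv (I 0) (fun z => T z (Fin.tail I)) y
    - ∑ a : Fin m, ∑ l : Fin n,
        christoffel X l (I 0) (Fin.tail I a) y * T y (Function.update (Fin.tail I) a l)

/-- The iterated covariant derivative `∇ʲ w` of a function `w`, in components. -/
def iterCovDeriv {n : ℕ} (X : Euc n → Euc (n + 1)) (w : Euc n → ℝ) :
    (j : ℕ) → Euc n → (Fin j → Fin n) → ℝ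
  | 0 => fun y _ => w y
  | j + 1 => covDeriv X (iterCovDeriv X w j)

/-- The norm of a covariant tensor with respect to the induced metric:
`|T|² = g^{i₁k₁} ⋯ g^{iₘkₘ} T_{i₁…iₘ} T_{k₁…kₘ}`. -/
def tensorNorm {n m : ℕ} (X : Euc n → Euc (n + 1)) (y : Euc n)
    (T : (Fin m → Fin n) → ℝ) : ℝ :=
  Real.sqrt (∑ I : Fin m → Fin n, ∑ K : Fin m → Fin n,
    (∏ a, (firstForm X y)⁻¹ (I a) (K a)) * T I * T K)

/-! Round cones with vertex at the origin. -/

/-- The round cone of angle `α` about the half-line spanned by the unit vector `e`. -/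
def roundCone {n : ℕ} (e : Euc (n + 1)) (α : ℝ) : Set (Euc (n + 1)) :=
  {x | inner ℝ x e = ‖x‖ * Real.cos α}

/-- The part of the round cone outside the ball of radius `ρ`. -/
def coneExterior {n : ℕ} (e : Euc (n + 1)) (α ρ : ℝ) : Set (Euc (n + 1)) :=
  {x | x ∈ roundCone e α ∧ ρ < ‖x‖}

/-- The unit normal of the round cone at `x ≠ 0` which has positive inner product with `e`. -/
def coneNormal {n : ℕ} (e : Euc (n + 1)) (α : ℝ) (x : Euc (n + 1)) : Euc (n + 1) :=
  (Real.sin α)⁻¹ • (e - (Real.cos α / ‖x‖) • x)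

/-- The round cone as a graph over the hyperplane orthogonal to `e`, where this hyperplane is
identified with `ℝⁿ` by the isometry `J`. Away from `0` it is a global coordinate system of the
cone (for `0 < α ≤ π / 2`). -/
def conePatch {n : ℕ} (e : Euc (n + 1)) (α : ℝ) (J : Euc n →ₗᵢ[ℝ] Euc (n + 1)) (y : Euc n) :
    Euc (n + 1) :=
  J y + (Real.cos α / Real.sin α * ‖y‖) • e

section Hypersurface

variable {n : ℕ} {M : Type*} [TopologicalSpace M] [ChartedSpace (Euc n) M]

/-- `F : M → ℝⁿ⁺¹` is a smooth immersed hypersurface with (smooth, globally defined)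
Gauss map `ν`. -/
structure IsOrientedHypersurface (F ν : M → Euc (n + 1)) : Prop where
  smooth : ContMDiff (𝓡 n) 𝓘(ℝ, Euc (n + 1)) ∞ F
  immersion : ∀ q : M, Function.Injective (mfderiv (𝓡 n) 𝓘(ℝ, Euc (n + 1)) F q)
  smooth_normal : ContMDiff (𝓡 n) 𝓘(ℝ, Euc (n + 1)) ∞ ν
  norm_normal : ∀ q : M, ‖ν q‖ = 1
  orthogonal : ∀ (q : M) (v : TangentSpace (𝓡 n) q),
    @inner ℝ (Euc (n + 1)) _ (mfderiv (𝓡 n) 𝓘(ℝ, Euc (n + 1)) F q v) (ν q) = 0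

/-- The hypersurface in the local coordinates at `q`. -/
def localPatch (F : M → Euc (n + 1)) (q : M) : Euc n → Euc (n + 1) :=
  F ∘ (extChartAt (𝓡 n) q).symm

/-- The matrix `gᵢⱼ` at `q` in the local coordinates at `q`. -/
def metricAt (F : M → Euc (n + 1)) (q : M) : Matrix (Fin n) (Fin n) ℝ :=
  firstForm (localPatch F q) (extChartAt (𝓡 n) q q)

/-- The matrix `hᵢⱼ` at `q` in the local coordinates at `q`. -/
def secondFormAt (F ν : M → Euc (n + 1)) (q : M) : Matrix (Fin n) (Fin n) ℝ :=
  secondForm (localPatch F q) (ν q) (extChartAt (𝓡 n) q q)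

/-- The mean curvature `H = gⁱʲ hᵢⱼ`. -/
def meanCurvature (F ν : M → Euc (n + 1)) (q : M) : ℝ :=
  Matrix.trace ((metricAt F q)⁻¹ * secondFormAt F ν q)

/-- The self-expander equation `H = ½⟨F, ν⟩`. -/
def IsSelfExpander (F ν : M → Euc (n + 1)) : Prop :=
  ∀ q : M, meanCurvature F ν q = 1 / 2 * inner ℝ (F q) (ν q)

/-- Mean-convexity, `H > 0`. -/
def IsMeanConvex (F ν : M → Euc (n + 1)) : Prop :=
  ∀ q : M, 0 < meanCurvature F ν q

/-- Convexity: the second fundamental form is nonnegative, that is, all principal curvatures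
are nonnegative. -/
def IsConvexHypersurface (F ν : M → Euc (n + 1)) : Prop :=
  ∀ q : M, (secondFormAt F ν q).PosSemidef

/-- The distance on `M` of the Riemannian metric induced by `F`: the infimum of the lengths of
the image curves `F ∘ γ` over all `C¹` curves `γ` in `M` joining `p` to `q`. -/
def intrinsicEDist (F : M → Euc (n + 1)) (p q : M) : ℝ≥0∞ :=
  ⨅ (γ : ℝ → M) (_ : ContMDiffOn 𝓘(ℝ, ℝ) (𝓡 n) 1 γ (Icc 0 1) ∧ γ 0 = p ∧ γ 1 = q),
    ∫⁻ t in Icc (0 : ℝ) 1, ‖derivWithin (F ∘ γ) (Icc 0 1) t‖ₑ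

/-- Completeness of the induced Riemannian metric. -/
def IsCompleteHypersurface (F : M → Euc (n + 1)) : Prop :=
  ∀ s : ℕ → M,
    (∀ ε : ℝ≥0∞, 0 < ε → ∃ N : ℕ, ∀ k ≥ N, ∀ l ≥ N, intrinsicEDist F (s k) (s l) < ε) →
    ∃ p : M, Tendsto (fun k => intrinsicEDist F (s k) p) atTop (𝓝 0)

/-- `E` is an end of `M`: a connected open set with compact frontier which is not relatively
compact. -/
structure IsEnd (E : Set M) : Prop where
  isOpen : IsOpen E
  isConnected : IsConnected E
  compact_frontier : IsCompact (frontier E)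
  not_compact : ¬ IsCompact (closure E)

/-- The end `E` is `Cᵏ`-asymptotic to the round cone of angle `α` about `e`: it has a
parametrization `φ` by the cone outside a ball which writes it as the normal graph
`F(φ(p)) = p + u(p) ν̌(p)` of a `Cᵏ` function `u` on the cone, where
`|∇̌ʲu|(x) = o(|x|⁻ʲ)` as `|x| → ∞` on the cone, for `j = 0, …, k`. The functions `u` and `φ`
matter only on the cone outside the ball. The choice of the isometry `J` of `ℝⁿ` onto the
hyperplane orthogonal to `e`, which gives the coordinates on the cone, is immaterial. -/
def IsAsymptoticToCone (k : ℕ) (F : M → Euc (n + 1)) (E : Set M) (e : Euc (n + 1)) (α : ℝ) :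
    Prop :=
  ∃ (ρ : ℝ) (u : Euc (n + 1) → ℝ) (φ : Euc (n + 1) → M) (J : Euc n →ₗᵢ[ℝ] Euc (n + 1)),
    0 < ρ ∧ (∀ y, inner ℝ (J y) e = 0) ∧
    IsOpenEmbedding ((coneExterior e α ρ).domRestrict φ) ∧
    φ '' coneExterior e α ρ = E ∧
    ContMDiffOn 𝓘(ℝ, Euc n) (𝓡 n) k (φ ∘ conePatch e α J) {y | ρ < ‖conePatch e α J y‖} ∧
    (∀ p ∈ coneExterior e α ρ, F (φ p) = p + u p • coneNormal e α p) ∧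
    ContDiffOn ℝ k (u ∘ conePatch e α J) {y | ρ < ‖conePatch e α J y‖} ∧
    ∀ j ≤ k,
      (fun y => tensorNorm (conePatch e α J) y
        (iterCovDeriv (conePatch e α J) (u ∘ conePatch e α J) j y))
        =o[Bornology.cobounded (Euc n)] fun y => ‖conePatch e α J y‖⁻¹ ^ j

/-- `M` has exactly one end, and it is `Cᵏ`-asymptotic to a round cone with axis `ℝe`. -/
def HasOneConicalEnd (k : ℕ) (F : M → Euc (n + 1)) (e : Euc (n + 1)) : Prop :=
  ∃ (E : Set M) (α : ℝ), 0 < α ∧ α ≤ Real.pi / 2 ∧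
    IsEnd E ∧ IsCompact Eᶜ ∧ IsAsymptoticToCone k F E e α

/-- `M` has exactly two ends, each of them is `Cᵏ`-asymptotic to a round cone, and both cones
have the axis `ℝe`; each of the cones may open in the direction of `e` or of `-e`. -/
def HasTwoConicalEnds (k : ℕ) (F : M → Euc (n + 1)) (e : Euc (n + 1)) : Prop :=
  ∃ (E₁ E₂ : Set M) (e₁ e₂ : Euc (n + 1)) (α β : ℝ),
    0 < α ∧ α ≤ Real.pi / 2 ∧ 0 < β ∧ β ≤ Real.pi / 2 ∧
    (e₁ = e ∨ e₁ = -e) ∧ (e₂ = e ∨ e₂ = -e) ∧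
    IsEnd E₁ ∧ IsEnd E₂ ∧ Disjoint E₁ E₂ ∧ IsCompact (E₁ ∪ E₂)ᶜ ∧
    IsAsymptoticToCone k F E₁ e₁ α ∧ IsAsymptoticToCone k F E₂ e₂ β

/-- Rotational symmetry about the axis `ℝe`: the image of `F` is invariant under the group
`O(n)` of linear isometries fixing `e`, and every rotation about the axis is induced by a
diffeomorphism of `M`. -/
def IsRotationallySymmetric (F : M → Euc (n + 1)) (e : Euc (n + 1)) : Prop :=
  (∀ g : Euc (n + 1) ≃ₗᵢ[ℝ] Euc (n + 1), g e = e → g '' range F = range F) ∧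
  ∀ g : Euc (n + 1) ≃ₗᵢ[ℝ] Euc (n + 1), g e = e →
    LinearMap.det (g.toLinearEquiv : Euc (n + 1) →ₗ[ℝ] Euc (n + 1)) = 1 →
    ∃ ψ : M ≃ₘ^∞⟮𝓡 n, 𝓡 n⟯ M, ∀ q : M, F (ψ q) = g (F q)

end Hypersurface

end

/-!
# Rotational symmetry of mean-convex self-expanders with conical ends

For an antisymmetric `R` with `R e = 0`, the function `f = ⟨R F, ν⟩` is the normal speed of an
infinitesimal rotation about the axis, hence a Jacobi function: `Δf + ½⟨F, ∇f⟩ + |A|² f = ½ f`. The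
mean curvature satisfies `ΔH + ½⟨F, ∇H⟩ + |A|² H = -½ H`. Both equations follow from the fact that
the operator `Δ + ½⟨F, ∇ ·⟩` maps `F` to `½ F` and `ν` to `-|A|² ν`
(`ExpanderPatch.exists_drift_laplacian`). If `|A|² ≤ ½` outside a compact set, then `H + ε` is, for
small `ε > 0`, a strict supersolution of the equation of `f` which is bounded below by `ε`. If `f`
tends to zero at infinity, then a positive supremum of `f / (H + ε)` would be attained, against the
maximum principle. So `f = 0` (`IsOrientedHypersurface.inner_rotation_eq_zero`): all infinitesimal
rotations are tangential along `F`. As `F` is proper, the rotations in planes orthogonal to the axis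
then lift to diffeomorphisms (`IsOrientedHypersurface.exists_diffeomorph`). They generate the
rotations about the axis (`rotation_induction`), and the reflections which fix the axis come for
free, since each point is fixed by one of them (`isRotationallySymmetric_of_planeRotation`).

At infinity, an end which is the normal graph of `w` over a round cone with axis `ℝ e` has `f → 0`,
because rotations are tangential to the cone (`IsConicalGraph.tendsto_inner_rotation_normal`). For
`k = 2` the second derivatives of `w` decay, and with them the second fundamental form
(`IsConicalGraph.eventually_norm_dmap_normal_le`). For `k = 1` the first derivatives still give
`⟨F, ν⟩ → 0` (`IsConicalGraph.tendsto_inner_apply_normal`), so `H → 0`, and under convexity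
`|A|² ≤ H²`.

It remains to see that whatever holds far out on the ends holds outside a compact set of the
hypersurface. The definition of an asymptotically conical end does not control its parametrization
over the cone outside a ball at the inner boundary, so that a priori the end could have a second
infinity there. This is excluded by `IsConicalGraph.exists_isCompact`. On the graph `⟨F, ν⟩` is a
multiple of `w - ∂w/∂log|y|`. By mean convexity this has no zeros, which makes `w / |y|` monotone
along rays (`IsConicalGraph.exists_sign`). If it is bounded along one ray, this ray has finite
length, so by completeness it converges to the compact frontier of the end, and the rest of the
inner part stays near the frontier (`IsConicalGraph.exists_annulus_of_bounded_ray`). If it is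
unbounded along every ray, then `|F| → ∞` uniformly at the inner boundary, while the component of
`F` in the direction of its foot point on the cone is positive and bounded there. A barrier in
`|F|²` together with the identity `(Δ + ½⟨F, ∇ ·⟩) F = ½ F` rules this out
(`IsConicalGraph.not_unbounded`). The connectedness of the spheres used here needs `n ≥ 2`, which
holds because a round cone without its vertex is not connected for `n ≤ 1` while the end is
(`IsConicalGraph.two_le`).
-/

/-! ### The local equations of a self-expander -/

section LocalGeometry

variable {V W : Type*} [NormedAddCommGroup V] [NormedSpace ℝ V]
  [NormedAddCommGroup W] [InnerProductSpace ℝ W]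

lemma fderiv_inner_eventuallyEq {A B C D : V → W} {x₀ : V}
    (hA : DifferentiableAt ℝ A x₀) (hB : DifferentiableAt ℝ B x₀)
    (hC : DifferentiableAt ℝ C x₀) (hD : DifferentiableAt ℝ D x₀)
    (h : ∀ᶠ x in 𝓝 x₀, inner ℝ (A x) (B x) = inner ℝ (C x) (D x)) (v : V) :
    inner ℝ (A x₀) (fderiv ℝ B x₀ v) + inner ℝ (fderiv ℝ A x₀ v) (B x₀) =
      inner ℝ (C x₀) (fderiv ℝ D x₀ v) + inner ℝ (fderiv ℝ C x₀ v) (D x₀) := by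
  have h1 : fderiv ℝ (fun x => inner ℝ (A x) (B x)) x₀
      = fderiv ℝ (fun x => inner ℝ (C x) (D x)) x₀ := Filter.EventuallyEq.fderiv_eq h
  have h2 := congrArg (fun L => L v) h1
  simpa [fderiv_inner_apply, hA, hB, hC, hD] using h2

lemma differentiableAt_fderiv_of_contDiffAt {U : Type*} [NormedAddCommGroup U] [NormedSpace ℝ U]
    {f : V → U} {x₀ : V} (h : ContDiffAt ℝ 2 f x₀) : DifferentiableAt ℝ (fderiv ℝ f) x₀ :=
  (h.fderiv_right (m := 1) (by norm_num)).differentiableAt (by norm_num)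

lemma fderiv_fderiv_apply {U : Type*} [NormedAddCommGroup U] [NormedSpace ℝ U]
    {f : V → U} {x₀ : V} (h : ContDiffAt ℝ 2 f x₀) (v w : V) :
    fderiv ℝ (fun x => fderiv ℝ f x w) x₀ v = fderiv ℝ (fderiv ℝ f) x₀ v w := by
  rw [fderiv_clm_apply (differentiableAt_fderiv_of_contDiffAt h) (by fun_prop)]
  simp

lemma fderiv_fderiv_comm {U : Type*} [NormedAddCommGroup U] [NormedSpace ℝ U]
    {f : V → U} {x₀ : V} (h : ContDiffAt ℝ 2 f x₀) (v w : V) :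
    fderiv ℝ (fderiv ℝ f) x₀ v w = fderiv ℝ (fderiv ℝ f) x₀ w v :=
  (h.isSymmSndFDerivAt (by simp)) v w

lemma eventually_contDiffAt_two {U : Type*} [NormedAddCommGroup U] [NormedSpace ℝ U]
    {f : V → U} {x₀ : V} (h : ContDiffAt ℝ 2 f x₀) : ∀ᶠ x in 𝓝 x₀, ContDiffAt ℝ 2 f x :=
  h.eventually (by simp)

/-- Local data of a hypersurface around a point of its parameter domain: a patch `X` with unit
normal `N`. -/
structure HypersurfacePatch {n : ℕ} (X N : Euc n → Euc (n + 1)) (x₀ : Euc n) : Prop where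
  smooth : ContDiffAt ℝ 2 X x₀
  smooth_normal : ContDiffAt ℝ 2 N x₀
  injective : Function.Injective (fderiv ℝ X x₀)
  norm_normal : ∀ᶠ x in 𝓝 x₀, ‖N x‖ = 1
  orthogonal : ∀ᶠ x in 𝓝 x₀, ∀ v, inner ℝ (fderiv ℝ X x v) (N x) = 0

/-- A patch which solves the self-expander equation. The mean curvature is the trace of the shape
operator, that is, of the endomorphism `S` with `DX ∘ S = -DN`. -/
structure ExpanderPatch {n : ℕ} (X N : Euc n → Euc (n + 1)) (x₀ : Euc n) : Prop
    extends HypersurfacePatch X N x₀ where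
  expander : ∀ᶠ x in 𝓝 x₀, ∀ S : Euc n →ₗ[ℝ] Euc n,
    (∀ v, fderiv ℝ X x (S v) = -fderiv ℝ N x v) →
      LinearMap.trace ℝ _ S = 1 / 2 * inner ℝ (X x) (N x)

namespace HypersurfacePatch

variable {n : ℕ} {X N : Euc n → Euc (n + 1)} {x₀ : Euc n}

lemma inner_fderiv_normal (hP : HypersurfacePatch X N x₀) (v : Euc n) :
    inner ℝ (fderiv ℝ N x₀ v) (N x₀) = 0 := by
  have hN := hP.smooth_normal.differentiableAt (by norm_num)
  have := fderiv_inner_eventuallyEq (C := fun _ => N x₀) (D := fun _ => N x₀) hN hN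
    (by fun_prop) (by fun_prop)
    (by filter_upwards [hP.norm_normal] with x hx
        simp [hx, hP.norm_normal.self_of_nhds]) v
  simp only [fderiv_fun_const, Pi.zero_apply, _root_.zero_apply, inner_zero_left,
    inner_zero_right, add_zero] at this
  rw [real_inner_comm] at this
  linarith

lemma inner_fderiv_fderiv (hP : HypersurfacePatch X N x₀) (v w : Euc n) :
    inner ℝ (fderiv ℝ N x₀ v) (fderiv ℝ X x₀ w) =
      -inner ℝ (N x₀) (fderiv ℝ (fderiv ℝ X) x₀ v w) := by
  have hN := hP.smooth_normal.differentiableAt (by norm_num)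
  have hX := differentiableAt_fderiv_of_contDiffAt hP.smooth
  have := fderiv_inner_eventuallyEq (A := fun x => fderiv ℝ X x w) (B := N) (C := fun _ => 0)
    (D := fun _ => N x₀) (x₀ := x₀) (by fun_prop) hN (by fun_prop) (by fun_prop)
    (by filter_upwards [hP.orthogonal] with x hx; simp [hx w]) v
  rw [fderiv_fderiv_apply hP.smooth] at this
  simp only [fderiv_fun_const, Pi.zero_apply, _root_.zero_apply, inner_zero_left,
    inner_zero_right, add_zero] at this
  rw [real_inner_comm, real_inner_comm (N x₀)] at this
  linarith

lemma shape_symm (hP : HypersurfacePatch X N x₀) (v w : Euc n) :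
    inner ℝ (fderiv ℝ N x₀ v) (fderiv ℝ X x₀ w) = inner ℝ (fderiv ℝ N x₀ w) (fderiv ℝ X x₀ v) := by
  rw [hP.inner_fderiv_fderiv, hP.inner_fderiv_fderiv, fderiv_fderiv_comm hP.smooth]

/-- Tangency to the patch is an open condition on the data, so they are a patch at nearby
points too. -/
lemma eventually (hP : HypersurfacePatch X N x₀) : ∀ᶠ x in 𝓝 x₀, HypersurfacePatch X N x := by
  have hinj : ∀ᶠ x in 𝓝 x₀, Function.Injective (fderiv ℝ X x) := by
    have hc : ContinuousAt (fderiv ℝ X) x₀ :=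
      (differentiableAt_fderiv_of_contDiffAt hP.smooth).continuousAt
    exact hc.eventually (ContinuousLinearMap.isOpen_injective.mem_nhds hP.injective)
  filter_upwards [eventually_contDiffAt_two hP.smooth, eventually_contDiffAt_two hP.smooth_normal,
    hinj, hP.norm_normal.eventually_nhds, hP.orthogonal.eventually_nhds]
    with x h1 h2 h3 h4 h5
  exact ⟨h1, h2, h3, h4, h5⟩

lemma exists_fderiv_eq (hP : HypersurfacePatch X N x₀) {z : Euc (n + 1)}
    (hz : inner ℝ z (N x₀) = 0) : ∃ v, fderiv ℝ X x₀ v = z := by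
  have h1 := hP.norm_normal.self_of_nhds
  have hne : N x₀ ≠ 0 := fun h => by simp [h] at h1
  have hle : (fderiv ℝ X x₀).range ≤ (ℝ ∙ N x₀)ᗮ := by
    rintro _ ⟨v, rfl⟩
    rw [Submodule.mem_orthogonal_singleton_iff_inner_left]
    exact hP.orthogonal.self_of_nhds v
  have hfr : Module.finrank ℝ (ℝ ∙ N x₀)ᗮ = n := by
    have : Fact (Module.finrank ℝ (Euc (n + 1)) = n + 1) := ⟨by simp⟩
    exact Submodule.finrank_orthogonal_span_singleton hne
  have hfr' : Module.finrank ℝ (fderiv ℝ X x₀).range = n := by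
    have := LinearMap.finrank_range_of_inj (f := (fderiv ℝ X x₀ : Euc n →ₗ[ℝ] Euc (n + 1)))
      hP.injective
    simpa using this
  have heq := Submodule.eq_of_le_of_finrank_eq hle (hfr'.trans hfr.symm)
  have : z ∈ (fderiv ℝ X x₀).range := by
    rw [heq, Submodule.mem_orthogonal_singleton_iff_inner_left]
    exact hz
  exact this

lemma exists_principal_frame (hP : HypersurfacePatch X N x₀) :
    ∃ (E : Fin n → Euc n) (κ : Fin n → ℝ),
      Orthonormal ℝ (fun i => fderiv ℝ X x₀ (E i)) ∧
      (∀ i, fderiv ℝ N x₀ (E i) = -(κ i • fderiv ℝ X x₀ (E i))) ∧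
      (∀ v, v = ∑ i, inner ℝ (fderiv ℝ X x₀ (E i)) (fderiv ℝ X x₀ v) • E i) ∧
      ∀ B : Euc n →ₗ[ℝ] Euc n,
        LinearMap.trace ℝ _ B = ∑ i, inner ℝ (fderiv ℝ X x₀ (E i)) (fderiv ℝ X x₀ (B (E i))) := by
  let T := LinearMap.range (fderiv ℝ X x₀ : Euc n →ₗ[ℝ] Euc (n + 1))
  let e : Euc n ≃ₗ[ℝ] T :=
    LinearEquiv.ofInjective (fderiv ℝ X x₀ : Euc n →ₗ[ℝ] Euc (n + 1)) hP.injective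
  have he : ∀ v, (e v : Euc (n + 1)) = fderiv ℝ X x₀ v := fun v => rfl
  have hes : ∀ z : T, fderiv ℝ X x₀ (e.symm z) = z := fun z => by rw [← he]; simp
  let A : T →ₗ[ℝ] T := LinearMap.codRestrict T
    (-(fderiv ℝ N x₀ : Euc n →ₗ[ℝ] Euc (n + 1)) ∘ₗ e.symm.toLinearMap) (fun z => by
      obtain ⟨v, hv⟩ := hP.exists_fderiv_eq (z := -(fderiv ℝ N x₀ (e.symm z)))
        (by rw [inner_neg_left, hP.inner_fderiv_normal, neg_zero])
      exact ⟨v, hv⟩)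
  have hA : ∀ z : T, (A z : Euc (n + 1)) = -fderiv ℝ N x₀ (e.symm z) := fun z => rfl
  have hsymm : A.IsSymmetric := by
    intro z z'
    rw [Submodule.coe_inner, Submodule.coe_inner, hA, hA, ← hes z', inner_neg_left,
      hP.shape_symm, hes z, inner_neg_right, real_inner_comm]
  have hfr : Module.finrank ℝ T = n := by
    rw [← LinearEquiv.finrank_eq e]; simp
  let b := hsymm.eigenvectorBasis hfr
  have hb : ∀ i, fderiv ℝ X x₀ (e.symm (b i)) = b i := fun i => hes _
  have hsum : ∀ z : T, z = ∑ i, inner ℝ (b i : Euc (n + 1)) (z : Euc (n + 1)) • b i := fun z =>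
    (b.sum_repr' z).symm
  refine ⟨fun i => e.symm (b i), hsymm.eigenvalues hfr, ?_, ?_, ?_, ?_⟩
  · simp_rw [hb]
    have := b.orthonormal
    exact this.comp_linearIsometry T.subtypeₗᵢ
  · intro i
    have h1 := congrArg Subtype.val (hsymm.apply_eigenvectorBasis hfr i)
    rw [hA] at h1
    rw [hb]
    rw [neg_eq_iff_eq_neg] at h1
    exact h1
  · intro v
    simp_rw [hb]
    apply e.injective
    rw [map_sum]
    simp only [map_smul, LinearEquiv.apply_symm_apply]
    exact hsum (e v)
  · intro B
    rw [← LinearMap.trace_conj' B e, LinearMap.trace_eq_sum_inner _ b]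
    refine Finset.sum_congr rfl fun i _ => ?_
    rw [hb]
    rfl

end HypersurfacePatch
end LocalGeometry

/-- Solving `Q S = -R` near a point where `Q = 1`, with the derivative of the solution. -/
lemma exists_differentiable_neg_inverse_mul {V A : Type*} [NormedAddCommGroup V] [NormedSpace ℝ V]
    [NormedRing A] [NormedAlgebra ℝ A] [CompleteSpace A] {Q R : V → A} {x₀ : V}
    (hQd : DifferentiableAt ℝ Q x₀) (hRd : DifferentiableAt ℝ R x₀) (hQ0 : Q x₀ = 1) :
    ∃ S : V → A, DifferentiableAt ℝ S x₀ ∧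
      (∀ᶠ x in 𝓝 x₀, IsUnit (Q x) ∧ Q x * S x = -R x) ∧
      ∀ v, fderiv ℝ Q x₀ v * S x₀ + fderiv ℝ S x₀ v = -fderiv ℝ R x₀ v := by
  have hQu : ∀ᶠ x in 𝓝 x₀, IsUnit (Q x) :=
    hQd.continuousAt.eventually (Units.isOpen.mem_nhds (by rw [hQ0]; exact isUnit_one))
  obtain ⟨S, hS⟩ : ∃ S : V → A, S = fun x => -(Ring.inverse (Q x) * R x) := ⟨_, rfl⟩
  have hSd : DifferentiableAt ℝ S x₀ := by
    rw [hS]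
    exact ((hQd.inverse (by rw [hQ0]; exact isUnit_one)).mul hRd).neg
  have hQS : ∀ᶠ x in 𝓝 x₀, Q x * S x = -R x := by
    filter_upwards [hQu] with x hx
    rw [hS, mul_neg, Ring.mul_inverse_cancel_left _ _ hx]
  refine ⟨S, hSd, hQu.and hQS, fun v => ?_⟩
  have h1 := congrArg (fun L : V →L[ℝ] A => L v) (Filter.EventuallyEq.fderiv_eq hQS)
  have h2 : fderiv ℝ (fun x => -R x) x₀ v = -fderiv ℝ R x₀ v := by simp
  rw [fderiv_fun_mul' hQd hSd] at h1
  simp only [h2] at h1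
  rw [← h1]
  simp [hQ0, add_comm]

namespace ExpanderPatch

variable {n : ℕ} {X N : Euc n → Euc (n + 1)} {x₀ : Euc n}

/-- Differentiating `tr S = ½⟨X, N⟩` along the patch, in terms of a frame in which the shape
operator is diagonal. -/
lemma inner_sum_fderiv_fderiv (hP : ExpanderPatch X N x₀) {E : Fin n → Euc n} {κ : Fin n → ℝ}
    (hE : Orthonormal ℝ (fun i => fderiv ℝ X x₀ (E i)))
    (hκ : ∀ i, fderiv ℝ N x₀ (E i) = -(κ i • fderiv ℝ X x₀ (E i)))
    (hrep : ∀ v, v = ∑ i, inner ℝ (fderiv ℝ X x₀ (E i)) (fderiv ℝ X x₀ v) • E i)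
    (htr : ∀ B : Euc n →ₗ[ℝ] Euc n,
        LinearMap.trace ℝ _ B = ∑ i, inner ℝ (fderiv ℝ X x₀ (E i)) (fderiv ℝ X x₀ (B (E i))))
    (v : Euc n) :
    ∑ i, κ i * inner ℝ (fderiv ℝ X x₀ (E i)) (fderiv ℝ (fderiv ℝ X) x₀ v (E i))
      + ∑ i, inner ℝ (fderiv ℝ X x₀ (E i)) (fderiv ℝ (fderiv ℝ N) x₀ v (E i)) =
      -(1 / 2 * inner ℝ (X x₀) (fderiv ℝ N x₀ v)) := by
  -- `P` is the left inverse of `DX x₀` which kills the normal.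
  obtain ⟨P, hPapp⟩ : ∃ P : Euc (n + 1) →L[ℝ] Euc n,
      ∀ z, P z = ∑ i, inner ℝ (fderiv ℝ X x₀ (E i)) z • E i :=
    ⟨∑ i, (innerSL ℝ (fderiv ℝ X x₀ (E i))).smulRight (E i), fun z => by simp⟩
  have hXP : ∀ i z, inner ℝ (fderiv ℝ X x₀ (E i)) (fderiv ℝ X x₀ (P z)) =
      inner ℝ (fderiv ℝ X x₀ (E i)) z := by
    intro i z
    rw [hPapp, map_sum, inner_sum]
    simp only [map_smul, inner_smul_right]
    rw [orthonormal_iff_ite] at hE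
    simp [hE]
  have hX2 := differentiableAt_fderiv_of_contDiffAt hP.smooth
  have hN2 := differentiableAt_fderiv_of_contDiffAt hP.smooth_normal
  obtain ⟨compP, hcompP⟩ : ∃ c : (Euc n →L[ℝ] Euc (n + 1)) →L[ℝ] (Euc n →L[ℝ] Euc n),
      ∀ L, c L = P.comp L :=
    ⟨ContinuousLinearMap.compL ℝ (Euc n) (Euc (n + 1)) (Euc n) P, fun L => rfl⟩
  have hQ' := compP.hasFDerivAt.comp x₀ hX2.hasFDerivAt
  have hR' := compP.hasFDerivAt.comp x₀ hN2.hasFDerivAt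
  obtain ⟨S, hSd, hQS, hdS⟩ := exists_differentiable_neg_inverse_mul hQ'.differentiableAt
    hR'.differentiableAt (by
      ext1 w
      change (compP (fderiv ℝ X x₀)) w = w
      rw [hcompP, ContinuousLinearMap.comp_apply, hPapp, ← hrep])
  have hDS : ∀ᶠ x in 𝓝 x₀, ∀ w, fderiv ℝ X x (S x w) = -fderiv ℝ N x w := by
    filter_upwards [hQS, hP.eventually] with x ⟨hx, hxS⟩ hPx w
    obtain ⟨s, hs⟩ := hPx.exists_fderiv_eq (hPx.inner_fderiv_normal w)
    have h1 : compP (fderiv ℝ X x) (S x w) = compP (fderiv ℝ X x) (-s) := by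
      refine (congrArg (fun L : Euc n →L[ℝ] Euc n => L w) hxS).trans ?_
      change -(compP (fderiv ℝ N x) w) = _
      rw [hcompP, hcompP, ContinuousLinearMap.comp_apply, ContinuousLinearMap.comp_apply,
        map_neg, hs, map_neg]
    have h3 : ∀ u, Ring.inverse (compP (fderiv ℝ X x)) (compP (fderiv ℝ X x) u) = u := fun u =>
      congrArg (fun L : Euc n →L[ℝ] Euc n => L u) (Ring.inverse_mul_cancel _ hx)
    have h2 : S x w = -s := by rw [← h3 (S x w), h1, h3]
    rw [h2, map_neg, hs]
  have hSE : ∀ i, S x₀ (E i) = κ i • E i := fun i => hP.injective <| by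
    rw [hDS.self_of_nhds, hκ, neg_neg, map_smul]
  obtain ⟨trL, htrL'⟩ : ∃ t : (Euc n →L[ℝ] Euc n) →L[ℝ] ℝ,
      ∀ B : Euc n →L[ℝ] Euc n, t B = LinearMap.trace ℝ (Euc n) (B : Euc n →ₗ[ℝ] Euc n) :=
    ⟨LinearMap.toContinuousLinearMap ((LinearMap.trace ℝ (Euc n)) ∘ₗ
      (ContinuousLinearMap.coeLM ℝ : (Euc n →L[ℝ] Euc n) →ₗ[ℝ] (Euc n →ₗ[ℝ] Euc n))),
      fun B => rfl⟩
  have htrL : ∀ B : Euc n →L[ℝ] Euc n,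
      trL B = ∑ i, inner ℝ (fderiv ℝ X x₀ (E i)) (fderiv ℝ X x₀ (B (E i))) := fun B =>
    (htrL' B).trans (htr B)
  have htrS : ∀ᶠ x in 𝓝 x₀, trL (S x) = 1 / 2 * inner ℝ (X x) (N x) := by
    filter_upwards [hDS, hP.expander] with x h1 h2
    exact (htrL' _).trans (h2 _ h1)
  have hX := hP.smooth.differentiableAt (by norm_num)
  have hN := hP.smooth_normal.differentiableAt (by norm_num)
  have hd1 : trL (fderiv ℝ S x₀ v) = 1 / 2 * inner ℝ (X x₀) (fderiv ℝ N x₀ v) := by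
    have h1 := congrArg (fun L : Euc n →L[ℝ] ℝ => L v) (Filter.EventuallyEq.fderiv_eq htrS)
    have h2 : fderiv ℝ (fun x => trL (S x)) x₀ v = trL (fderiv ℝ S x₀ v) :=
      congrArg (fun L : Euc n →L[ℝ] ℝ => L v) (trL.hasFDerivAt.comp x₀ hSd.hasFDerivAt).fderiv
    have h3 : fderiv ℝ (fun x => 1 / 2 * inner ℝ (X x) (N x)) x₀ v =
        1 / 2 * inner ℝ (X x₀) (fderiv ℝ N x₀ v) := by
      rw [fderiv_const_mul (hX.inner ℝ hN)]
      simp [fderiv_inner_apply, hX, hN, hP.orthogonal.self_of_nhds v]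
    rw [← h2, ← h3]
    exact h1
  have h4 := congrArg trL (hdS v)
  rw [hQ'.fderiv, hR'.fderiv, map_add, map_neg, hd1, htrL, htrL] at h4
  have h5 : ∀ (L : Euc n →L[ℝ] Euc n →L[ℝ] Euc (n + 1)) w,
      (compP.comp L) v w = P (L v w) := fun L w => by
    rw [ContinuousLinearMap.comp_apply, hcompP, ContinuousLinearMap.comp_apply]
  simp only [mul_apply_eq_comp, hSE, map_smul, h5, hXP, inner_smul_right] at h4
  linarith

/-- The elliptic operator `φ ↦ Δφ + ½⟨X, ∇φ⟩` at a point of a self-expander, written as a second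
order operator `φ ↦ ∑ᵢ D²φ(Eᵢ, Eᵢ) - Dφ(γ)` in a principal frame `E`: it maps `X` to `½ X` and
the normal `N` to `-|A|² N`. -/
lemma exists_drift_laplacian (hP : ExpanderPatch X N x₀) :
    ∃ (E : Fin n → Euc n) (γ : Euc n) (κ : Fin n → ℝ),
      Orthonormal ℝ (fun i => fderiv ℝ X x₀ (E i)) ∧
      (∀ i, fderiv ℝ N x₀ (E i) = -(κ i • fderiv ℝ X x₀ (E i))) ∧
      ∑ i, fderiv ℝ (fderiv ℝ X) x₀ (E i) (E i) - fderiv ℝ X x₀ γ = (1 / 2 : ℝ) • X x₀ ∧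
      ∑ i, fderiv ℝ (fderiv ℝ N) x₀ (E i) (E i) - fderiv ℝ N x₀ γ = -((∑ i, κ i ^ 2) • N x₀) ∧
      ∑ i, κ i = 1 / 2 * inner ℝ (X x₀) (N x₀) := by
  obtain ⟨E, κ, hE, hκ, hrep, htr⟩ := hP.exists_principal_frame
  have hkey := hP.inner_sum_fderiv_fderiv hE hκ hrep htr
  have hNN : inner ℝ (N x₀) (N x₀) = (1 : ℝ) := by
    rw [real_inner_self_eq_norm_sq, hP.norm_normal.self_of_nhds]; norm_num
  have hEE : ∀ i, inner ℝ (fderiv ℝ X x₀ (E i)) (fderiv ℝ X x₀ (E i)) = (1 : ℝ) := fun i => by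
    rw [real_inner_self_eq_norm_sq, hE.1 i]; norm_num
  have hsumκ : ∑ i, κ i = 1 / 2 * inner ℝ (X x₀) (N x₀) := by
    let P : Euc (n + 1) →ₗ[ℝ] Euc n :=
      ∑ i, (innerSL ℝ (fderiv ℝ X x₀ (E i)) : Euc (n+1) →ₗ[ℝ] ℝ).smulRight (E i)
    have hPapp : ∀ z, P z = ∑ i, inner ℝ (fderiv ℝ X x₀ (E i)) z • E i := fun z => by
      simp [P, LinearMap.sum_apply]
    let S : Euc n →ₗ[ℝ] Euc n := -(P ∘ₗ (fderiv ℝ N x₀ : Euc n →ₗ[ℝ] Euc (n + 1)))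
    have hS : ∀ v, fderiv ℝ X x₀ (S v) = -fderiv ℝ N x₀ v := by
      intro v
      obtain ⟨s, hs⟩ := hP.exists_fderiv_eq (hP.inner_fderiv_normal v)
      have : S v = -s := by
        change -(P (fderiv ℝ N x₀ v)) = -s
        rw [hPapp, ← hs, ← hrep]
      rw [this, map_neg, hs]
    rw [← hP.expander.self_of_nhds S hS, htr]
    refine Finset.sum_congr rfl fun i _ => ?_
    rw [hS, hκ, neg_neg, inner_smul_right, hEE, mul_one]
  -- `∑ X_ii - ½ X` has no normal component
  have hnormal : inner ℝ (∑ i, fderiv ℝ (fderiv ℝ X) x₀ (E i) (E i) - (1 / 2 : ℝ) • X x₀)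
      (N x₀) = 0 := by
    rw [inner_sub_left, sum_inner, real_inner_smul_left, ← hsumκ, sub_eq_zero]
    refine Finset.sum_congr rfl fun i _ => ?_
    have := hP.inner_fderiv_fderiv (E i) (E i)
    rw [hκ, inner_neg_left, real_inner_smul_left, hEE, real_inner_comm] at this
    linarith
  obtain ⟨γ, hγ⟩ := hP.exists_fderiv_eq hnormal
  refine ⟨E, γ, κ, hE, hκ, ?_, ?_, hsumκ⟩
  · rw [hγ]; abel
  -- both the tangential and the normal part of the second equation
  set Z := ∑ i, fderiv ℝ (fderiv ℝ N) x₀ (E i) (E i) - fderiv ℝ N x₀ γ +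
    (∑ i, κ i ^ 2) • N x₀ with hZ
  have hX2 := differentiableAt_fderiv_of_contDiffAt hP.smooth
  have hN2 := differentiableAt_fderiv_of_contDiffAt hP.smooth_normal
  have hN := hP.smooth_normal.differentiableAt (by norm_num)
  have hdd : ∀ u v w, inner ℝ (fderiv ℝ (fderiv ℝ N) x₀ u v) (fderiv ℝ X x₀ w) +
      inner ℝ (fderiv ℝ N x₀ v) (fderiv ℝ (fderiv ℝ X) x₀ u w) =
      inner ℝ (fderiv ℝ (fderiv ℝ N) x₀ u w) (fderiv ℝ X x₀ v) +
      inner ℝ (fderiv ℝ N x₀ w) (fderiv ℝ (fderiv ℝ X) x₀ u v) := by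
    intro u v w
    have := fderiv_inner_eventuallyEq (x₀ := x₀)
      (A := fun x => fderiv ℝ N x v) (B := fun x => fderiv ℝ X x w)
      (C := fun x => fderiv ℝ N x w) (D := fun x => fderiv ℝ X x v)
      (by fun_prop) (by fun_prop) (by fun_prop) (by fun_prop)
      (by filter_upwards [hP.eventually] with x hx; exact hx.shape_symm v w) u
    simp only [fderiv_fderiv_apply hP.smooth, fderiv_fderiv_apply hP.smooth_normal] at this
    linarith
  have hdn : ∀ u v, inner ℝ (fderiv ℝ (fderiv ℝ N) x₀ u v) (N x₀) =
      -inner ℝ (fderiv ℝ N x₀ v) (fderiv ℝ N x₀ u) := by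
    intro u v
    have := fderiv_inner_eventuallyEq (x₀ := x₀)
      (A := fun x => fderiv ℝ N x v) (B := N) (C := fun x => 0) (D := fun x => N x₀)
      (by fun_prop) hN (by fun_prop) (by fun_prop)
      (by filter_upwards [hP.eventually] with x hx; simp [hx.inner_fderiv_normal v]) u
    simp only [fderiv_fderiv_apply hP.smooth_normal, fderiv_fun_const, Pi.zero_apply,
      _root_.zero_apply, inner_zero_left, inner_zero_right, add_zero] at this
    linarith
  have hZT : ∀ w, inner ℝ Z (fderiv ℝ X x₀ w) = 0 := by
    intro w
    have h1 : ∑ i, inner ℝ (fderiv ℝ (fderiv ℝ N) x₀ (E i) (E i)) (fderiv ℝ X x₀ w) =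
        ∑ i, (κ i * inner ℝ (fderiv ℝ X x₀ (E i)) (fderiv ℝ (fderiv ℝ X) x₀ w (E i))
        + inner ℝ (fderiv ℝ X x₀ (E i)) (fderiv ℝ (fderiv ℝ N) x₀ w (E i))
        + inner ℝ (fderiv ℝ N x₀ w) (fderiv ℝ (fderiv ℝ X) x₀ (E i) (E i))) := by
      refine Finset.sum_congr rfl fun i _ => ?_
      have h2 := hdd (E i) (E i) w
      rw [hκ, inner_neg_left, real_inner_smul_left, fderiv_fderiv_comm hP.smooth (E i) w,
        fderiv_fderiv_comm hP.smooth_normal (E i) w,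
        real_inner_comm (fderiv ℝ X x₀ (E i)) (fderiv ℝ (fderiv ℝ N) x₀ w (E i))] at h2
      linarith
    rw [Finset.sum_add_distrib, Finset.sum_add_distrib, hkey w, ← inner_sum] at h1
    have h3 : inner ℝ (fderiv ℝ N x₀ w) (∑ i, fderiv ℝ (fderiv ℝ X) x₀ (E i) (E i)) =
        1 / 2 * inner ℝ (X x₀) (fderiv ℝ N x₀ w) + inner ℝ (fderiv ℝ N x₀ γ) (fderiv ℝ X x₀ w) := by
      rw [hP.shape_symm γ w, hγ, inner_sub_right, real_inner_smul_right,
        real_inner_comm (X x₀)]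
      ring
    have h5 := hP.orthogonal.self_of_nhds w
    rw [real_inner_comm] at h5
    rw [hZ, inner_add_left, inner_sub_left, sum_inner, h1, h3, real_inner_smul_left, h5]
    ring
  have hZN : inner ℝ Z (N x₀) = 0 := by
    rw [hZ, inner_add_left, inner_sub_left, sum_inner, hP.inner_fderiv_normal,
      real_inner_smul_left, hNN, sub_zero, mul_one, ← Finset.sum_add_distrib]
    refine Finset.sum_eq_zero fun i _ => ?_
    rw [hdn, hκ, inner_neg_left, inner_neg_right, real_inner_smul_left, real_inner_smul_right, hEE]
    ring
  obtain ⟨z, hz⟩ := hP.exists_fderiv_eq hZN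
  have hZ0 : Z = 0 := by
    have := hZT z
    rw [hz] at this
    exact inner_self_eq_zero.1 this
  exact eq_neg_of_add_eq_zero_left hZ0

end ExpanderPatch

/-! ### Differentials of maps in charts -/

section Differential

variable {n : ℕ} {M : Type*} [TopologicalSpace M] [ChartedSpace (Euc n) M]

/-- The differential at `q` of a map `f : M → ℝⁿ⁺¹`, on the model space `ℝⁿ` instead of the tangent
space. -/
noncomputable def dmap (f : M → Euc (n + 1)) (q : M) : Euc n →L[ℝ] Euc (n + 1) :=
  mfderiv (𝓡 n) 𝓘(ℝ, Euc (n + 1)) f q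

lemma fderiv_comp_eq_dmap_comp {f : M → Euc (n + 1)}
    (hf : ContMDiff (𝓡 n) 𝓘(ℝ, Euc (n + 1)) ∞ f) {Φ : Euc n → M} {y : Euc n}
    (hΦ : MDifferentiableAt 𝓘(ℝ, Euc n) (𝓡 n) Φ y) :
    fderiv ℝ (f ∘ Φ) y = (dmap f (Φ y)).comp
      (mfderiv 𝓘(ℝ, Euc n) (𝓡 n) Φ y : Euc n →L[ℝ] Euc n) := by
  rw [← mfderiv_eq_fderiv, mfderiv_comp y ((hf (Φ y)).mdifferentiableAt (by simp)) hΦ]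
  rfl

lemma contDiffOn_localPatch [IsManifold (𝓡 n) ∞ M] {f : M → Euc (n + 1)}
    (hf : ContMDiff (𝓡 n) 𝓘(ℝ, Euc (n + 1)) ∞ f) (q : M) :
    ContDiffOn ℝ ∞ (localPatch f q) (extChartAt (𝓡 n) q).target :=
  (hf.comp_contMDiffOn (contMDiffOn_extChartAt_symm q)).contDiffOn

lemma eventually_mem_target (q : M) :
    ∀ᶠ x in 𝓝 (extChartAt (𝓡 n) q q), x ∈ (extChartAt (𝓡 n) q).target :=
  extChartAt_target_mem_nhds q

lemma contDiffAt_localPatch [IsManifold (𝓡 n) ∞ M] {f : M → Euc (n + 1)}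
    (hf : ContMDiff (𝓡 n) 𝓘(ℝ, Euc (n + 1)) ∞ f) (q : M) :
    ContDiffAt ℝ ∞ (localPatch f q) (extChartAt (𝓡 n) q q) :=
  (contDiffOn_localPatch hf q).contDiffAt (extChartAt_target_mem_nhds q)

lemma dmap_eq {f : M → Euc (n + 1)}
    (hf : ContMDiff (𝓡 n) 𝓘(ℝ, Euc (n + 1)) ∞ f) (q : M) :
    dmap f q = fderiv ℝ (localPatch f q) (extChartAt (𝓡 n) q q) := by
  rw [dmap, ((hf q).mdifferentiableAt (by simp)).mfderiv]
  simp only [writtenInExtChartAt, extChartAt_model_space_eq_id, PartialEquiv.refl_coe,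
    Function.id_comp, modelWithCornersSelf_coe, range_id, fderivWithin_univ]
  rfl

lemma localPatch_apply_self (f : M → Euc (n + 1)) (q : M) :
    localPatch f q (extChartAt (𝓡 n) q q) = f q := by
  simp [localPatch]

/-- The differentials at nearby points, in the chart at `q` and in their own charts, differ by a
linear automorphism of `ℝⁿ` which is the same for all maps. -/
lemma exists_fderiv_localPatch_eq [IsManifold (𝓡 n) ∞ M] (q : M) {x : Euc n}
    (hx : x ∈ (extChartAt (𝓡 n) q).target) :
    ∃ θ : Euc n ≃L[ℝ] Euc n, ∀ f : M → Euc (n + 1),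
      ContMDiff (𝓡 n) 𝓘(ℝ, Euc (n + 1)) ∞ f → ∀ v,
      fderiv ℝ (localPatch f q) x v = dmap f ((extChartAt (𝓡 n) q).symm x) (θ v) := by
  have h1 := isInvertible_mfderivWithin_extChartAt_symm (I := 𝓡 n) hx
  have hr : range (𝓡 n) = univ := ModelWithCorners.range_eq_univ _
  rw [hr, mfderivWithin_univ] at h1
  obtain ⟨θ, hθ⟩ := h1
  refine ⟨(θ : Euc n ≃L[ℝ] Euc n), fun f hf v => ?_⟩
  have hΦ : MDifferentiableAt 𝓘(ℝ, Euc n) (𝓡 n) (extChartAt (𝓡 n) q).symm x :=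
    ((contMDiffOn_extChartAt_symm (n := ∞) q).contMDiffAt
      ((isOpen_extChartAt_target q).mem_nhds hx)).mdifferentiableAt (by simp)
  have := congrArg (fun L : Euc n →L[ℝ] Euc (n + 1) => L v) (fderiv_comp_eq_dmap_comp hf hΦ)
  simp only [localPatch]
  refine this.trans ?_
  rw [← hθ]
  rfl

end Differential

/-! ### From hypersurfaces to patches -/

section Hypersurface

variable {n : ℕ} {M : Type*} [TopologicalSpace M] [ChartedSpace (Euc n) M]
  {F ν : M → Euc (n + 1)}

namespace IsOrientedHypersurface

lemma dmap_injective (hF : IsOrientedHypersurface F ν) (q : M) :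
    Function.Injective (dmap F q) := hF.immersion q

lemma inner_dmap (hF : IsOrientedHypersurface F ν) (q : M) (v : Euc n) :
    inner ℝ (dmap F q v) (ν q) = 0 := hF.orthogonal q v

lemma metricAt_apply (hF : IsOrientedHypersurface F ν) (q : M) (i j : Fin n) :
    metricAt F q i j = inner ℝ (dmap F q (EuclideanSpace.single i 1))
      (dmap F q (EuclideanSpace.single j 1)) := by
  simp [metricAt, firstForm, pderiv, dmap_eq hF.smooth]

variable [IsManifold (𝓡 n) ∞ M]

lemma hypersurfacePatch (hF : IsOrientedHypersurface F ν) (q : M) :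
    HypersurfacePatch (localPatch F q) (localPatch ν q) (extChartAt (𝓡 n) q q) where
  smooth := (contDiffAt_localPatch hF.smooth q).of_le (by norm_cast)
  smooth_normal := (contDiffAt_localPatch hF.smooth_normal q).of_le (by norm_cast)
  injective := by rw [← dmap_eq hF.smooth q]; exact hF.dmap_injective q
  norm_normal := Eventually.of_forall fun x => hF.norm_normal _
  orthogonal := by
    filter_upwards [eventually_mem_target q] with x hx v
    obtain ⟨θ, hθ⟩ := exists_fderiv_localPatch_eq q hx
    rw [hθ F hF.smooth]
    exact hF.inner_dmap _ _

lemma inner_dmap_normal (hF : IsOrientedHypersurface F ν) (q : M) (v : Euc n) :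
    inner ℝ (dmap ν q v) (ν q) = 0 := by
  have := (hF.hypersurfacePatch q).inner_fderiv_normal v
  rwa [← dmap_eq hF.smooth_normal, localPatch_apply_self] at this

lemma shape_symm (hF : IsOrientedHypersurface F ν) (q : M) (v w : Euc n) :
    inner ℝ (dmap ν q v) (dmap F q w) = inner ℝ (dmap ν q w) (dmap F q v) := by
  have := (hF.hypersurfacePatch q).shape_symm v w
  rwa [← dmap_eq hF.smooth_normal, ← dmap_eq hF.smooth] at this

lemma secondFormAt_apply (hF : IsOrientedHypersurface F ν) (q : M) (i j : Fin n) :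
    secondFormAt F ν q i j = -inner ℝ (dmap ν q (EuclideanSpace.single i 1))
      (dmap F q (EuclideanSpace.single j 1)) := by
  have hP := hF.hypersurfacePatch q
  have := hP.inner_fderiv_fderiv (EuclideanSpace.single i 1) (EuclideanSpace.single j 1)
  rw [dmap_eq hF.smooth_normal, dmap_eq hF.smooth, this]
  have h2 := fderiv_fderiv_apply hP.smooth (EuclideanSpace.single i 1) (EuclideanSpace.single j 1)
  simp only [secondFormAt, secondForm, Matrix.of_apply]
  rw [neg_neg, real_inner_comm, ← h2, localPatch_apply_self]
  rfl

lemma _root_.sum_smul_single (v : Euc n) : v = ∑ i, v i • EuclideanSpace.single i (1 : ℝ) := by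
  have := (EuclideanSpace.basisFun (Fin n) ℝ).sum_repr v
  simpa using this.symm

/-- The mean curvature is the trace of the shape operator. -/
lemma meanCurvature_eq_trace (hF : IsOrientedHypersurface F ν) (q : M) (S : Euc n →ₗ[ℝ] Euc n)
    (hS : ∀ v, dmap F q (S v) = -dmap ν q v) :
    meanCurvature F ν q = LinearMap.trace ℝ _ S := by
  let b := (EuclideanSpace.basisFun (Fin n) ℝ).toBasis
  let m := LinearMap.toMatrix b b S
  have hm : ∀ i j, m i j = S (EuclideanSpace.single j 1) i := fun i j => by
    simp [m, b, LinearMap.toMatrix_apply]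
  have hinj : Function.Injective (metricAt F q).mulVec := by
    refine (injective_iff_map_eq_zero (metricAt F q).mulVecLin).2 fun v hv => ?_
    let v' : Euc n := WithLp.toLp 2 v
    have h1 : inner ℝ (dmap F q v') (dmap F q v') = v ⬝ᵥ (metricAt F q).mulVec v := by
      conv_lhs => rw [sum_smul_single v']
      simp only [map_sum, map_smul, sum_inner, inner_sum, real_inner_smul_left,
        real_inner_smul_right, dotProduct, Matrix.mulVec, Finset.mul_sum]
      refine Finset.sum_congr rfl fun i _ => Finset.sum_congr rfl fun j _ => ?_
      rw [show metricAt F q i j = _ from hF.metricAt_apply q i j, real_inner_comm]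
      simp only [v']
      ring
    have h2 : (metricAt F q).mulVec v = 0 := hv
    rw [h2, dotProduct_zero, inner_self_eq_zero] at h1
    have h3 : v' = 0 := hF.dmap_injective q (by rw [h1, map_zero])
    ext i
    exact congrArg (fun z : Euc n => z i) h3
  have hu : IsUnit (metricAt F q) := Matrix.mulVec_injective_iff_isUnit.1 hinj
  have hh : secondFormAt F ν q = mᵀ * metricAt F q := by
    ext i j
    rw [hF.secondFormAt_apply, ← inner_neg_left, ← hS, sum_smul_single (S _), Matrix.mul_apply]
    simp only [map_sum, map_smul, sum_inner, real_inner_smul_left, Matrix.transpose_apply, hm,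
      hF.metricAt_apply]
  rw [meanCurvature, hh, Matrix.trace_mul_comm, Matrix.mul_assoc,
    Matrix.mul_nonsing_inv _ ((Matrix.isUnit_iff_isUnit_det _).1 hu), mul_one,
    Matrix.trace_transpose, LinearMap.trace_eq_matrix_trace ℝ b]

lemma expanderPatch (hF : IsOrientedHypersurface F ν) (hE : IsSelfExpander F ν) (q : M) :
    ExpanderPatch (localPatch F q) (localPatch ν q) (extChartAt (𝓡 n) q q) where
  toHypersurfacePatch := hF.hypersurfacePatch q
  expander := by
    filter_upwards [eventually_mem_target q] with x hx S hS
    obtain ⟨θ, hθ⟩ := exists_fderiv_localPatch_eq q hx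
    have h1 : LinearMap.trace ℝ _ S =
        LinearMap.trace ℝ _ (θ.toLinearEquiv.conj S) := (LinearMap.trace_conj' S _).symm
    rw [h1, ← hF.meanCurvature_eq_trace ((extChartAt (𝓡 n) q).symm x), hE]
    · rfl
    · intro v
      have := hS (θ.symm v)
      rw [hθ F hF.smooth, hθ ν hF.smooth_normal] at this
      simpa [LinearEquiv.conj_apply] using this

lemma neg_inner_dmap_nonneg (hF : IsOrientedHypersurface F ν) (hc : IsConvexHypersurface F ν)
    (q : M) (v : Euc n) : 0 ≤ -inner ℝ (dmap ν q v) (dmap F q v) := by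
  have h := (hc q).dotProduct_mulVec_nonneg v.ofLp
  have h1 : -inner ℝ (dmap ν q v) (dmap F q v) =
      star v.ofLp ⬝ᵥ (secondFormAt F ν q).mulVec v.ofLp := by
    conv_lhs => rw [sum_smul_single v]
    simp only [map_sum, map_smul, sum_inner, inner_sum, real_inner_smul_left,
      real_inner_smul_right, dotProduct, Matrix.mulVec, Finset.mul_sum, ← Finset.sum_neg_distrib]
    refine Finset.sum_congr rfl fun i _ => Finset.sum_congr rfl fun j _ => ?_
    rw [hF.secondFormAt_apply, hF.shape_symm]
    simp only [Pi.star_apply, star_trivial]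
    ring
  rw [h1]; exact h

end IsOrientedHypersurface

end Hypersurface

/-! ### Second order conditions at a maximum -/

section SecondOrder

variable {V : Type*} [NormedAddCommGroup V] [NormedSpace ℝ V]

lemma IsLocalMax.fderiv_fderiv_nonpos {φ : V → ℝ} {x₀ : V} (hφ : ContDiffAt ℝ 2 φ x₀)
    (hmax : IsLocalMax φ x₀) (v : V) : fderiv ℝ (fderiv ℝ φ) x₀ v v ≤ 0 := by
  by_contra! hpos
  let c : ℝ → V := fun s => x₀ + s • v
  have hc : ∀ s, HasDerivAt c v s := fun s => by
    have := HasDerivAt.const_add x₀ ((hasDerivAt_id s).smul_const v)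
    simp only [id, one_smul] at this
    exact this
  have hc0 : c 0 = x₀ := by simp [c]
  have hct : Tendsto c (𝓝 0) (𝓝 x₀) := by
    have := (hc 0).continuousAt.tendsto
    rwa [hc0] at this
  have hd1 : ∀ᶠ s in 𝓝 (0 : ℝ), deriv (φ ∘ c) s = fderiv ℝ φ (c s) v := by
    filter_upwards [hct.eventually (eventually_contDiffAt_two hφ)] with s hs
    exact ((hs.differentiableAt (by norm_num)).hasFDerivAt.comp_hasDerivAt s (hc s)).deriv
  have hd2 : deriv (deriv (φ ∘ c)) 0 = fderiv ℝ (fderiv ℝ φ) x₀ v v := by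
    rw [Filter.EventuallyEq.deriv_eq hd1, ← fderiv_fderiv_apply hφ]
    have h : DifferentiableAt ℝ (fun x => fderiv ℝ φ x v) (c 0) := by
      rw [hc0]
      exact (differentiableAt_fderiv_of_contDiffAt hφ).clm_apply (by fun_prop)
    have := (h.hasFDerivAt.comp_hasDerivAt 0 (hc 0)).deriv
    rw [hc0] at this
    exact this
  have hd0 : deriv (φ ∘ c) 0 = 0 := by
    rw [hd1.self_of_nhds, hc0, hmax.fderiv_eq_zero]; simp
  have hcont : ContinuousAt (φ ∘ c) 0 := by
    refine ContinuousAt.comp ?_ (hc 0).continuousAt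
    rw [hc0]; exact hφ.continuousAt
  have hmin := isLocalMin_of_deriv_deriv_pos (hd2 ▸ hpos) hd0 hcont
  have hconst : φ ∘ c =ᶠ[𝓝 0] fun _ => (φ ∘ c) 0 := by
    filter_upwards [hmin, hct.eventually hmax] with s h1 h2
    refine le_antisymm ?_ h1
    simpa [hc0] using h2
  have : deriv (deriv (φ ∘ c)) 0 = 0 := by
    rw [hconst.deriv.deriv_eq]; simp
  rw [hd2] at this
  exact hpos.ne' this

lemma IsLocalMax.sum_fderiv_fderiv_sub_nonpos {ι : Type*} [Fintype ι] {φ : V → ℝ} {x₀ : V}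
    (hφ : ContDiffAt ℝ 2 φ x₀) (hmax : IsLocalMax φ x₀) (E : ι → V) (γ : V) :
    ∑ i, fderiv ℝ (fderiv ℝ φ) x₀ (E i) (E i) - fderiv ℝ φ x₀ γ ≤ 0 := by
  rw [hmax.fderiv_eq_zero, _root_.zero_apply, sub_zero]
  exact Finset.sum_nonpos fun i _ => hmax.fderiv_fderiv_nonpos hφ (E i)

variable {W : Type*} [NormedAddCommGroup W] [InnerProductSpace ℝ W]

lemma fderiv_fderiv_inner {A B : V → W} {x₀ : V} (hA : ContDiffAt ℝ 2 A x₀)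
    (hB : ContDiffAt ℝ 2 B x₀) (v : V) :
    fderiv ℝ (fderiv ℝ fun x => inner ℝ (A x) (B x)) x₀ v v =
      inner ℝ (fderiv ℝ (fderiv ℝ A) x₀ v v) (B x₀) +
        2 * inner ℝ (fderiv ℝ A x₀ v) (fderiv ℝ B x₀ v) +
        inner ℝ (A x₀) (fderiv ℝ (fderiv ℝ B) x₀ v v) := by
  have hA1 := hA.differentiableAt (by norm_num)
  have hB1 := hB.differentiableAt (by norm_num)
  have hA2 := differentiableAt_fderiv_of_contDiffAt hA
  have hB2 := differentiableAt_fderiv_of_contDiffAt hB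
  rw [← fderiv_fderiv_apply (hA.inner ℝ hB)]
  have h : (fun x => fderiv ℝ (fun x => inner ℝ (A x) (B x)) x v) =ᶠ[𝓝 x₀]
      fun x => inner ℝ (A x) (fderiv ℝ B x v) + inner ℝ (fderiv ℝ A x v) (B x) := by
    filter_upwards [eventually_contDiffAt_two hA, eventually_contDiffAt_two hB] with x h1 h2
    rw [fderiv_inner_apply ℝ (h1.differentiableAt (by norm_num))
      (h2.differentiableAt (by norm_num))]
  rw [h.fderiv_eq]
  have hAv : DifferentiableAt ℝ (fun x => fderiv ℝ A x v) x₀ := hA2.clm_apply (by fun_prop)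
  have hBv : DifferentiableAt ℝ (fun x => fderiv ℝ B x v) x₀ := hB2.clm_apply (by fun_prop)
  rw [fderiv_fun_add (hA1.inner ℝ hBv) (hAv.inner ℝ hB1), _root_.add_apply,
    fderiv_inner_apply ℝ hA1 hBv, fderiv_inner_apply ℝ hAv hB1, fderiv_fderiv_apply hA,
    fderiv_fderiv_apply hB]
  ring

lemma fderiv_fderiv_real_comp {k : ℝ → ℝ} {s : V → ℝ} {x₀ : V} (hk : ContDiffAt ℝ 2 k (s x₀))
    (hs : ContDiffAt ℝ 2 s x₀) (v : V) :
    fderiv ℝ (fderiv ℝ fun x => k (s x)) x₀ v v =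
      deriv (deriv k) (s x₀) * fderiv ℝ s x₀ v ^ 2 +
        deriv k (s x₀) * fderiv ℝ (fderiv ℝ s) x₀ v v := by
  have hs1 := hs.differentiableAt (by norm_num)
  have hs2 := differentiableAt_fderiv_of_contDiffAt hs
  have hks2 : ContDiffAt ℝ 2 (fun x => k (s x)) x₀ := hk.comp x₀ hs
  rw [← fderiv_fderiv_apply hks2]
  have h : (fun x => fderiv ℝ (fun x => k (s x)) x v) =ᶠ[𝓝 x₀]
      fun x => deriv k (s x) * fderiv ℝ s x v := by
    filter_upwards [eventually_contDiffAt_two hs,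
      hs1.continuousAt.eventually (eventually_contDiffAt_two hk)] with x h1 h2
    have := ((h2.differentiableAt (by norm_num)).hasDerivAt.comp_hasFDerivAt x
      (h1.differentiableAt (by norm_num)).hasFDerivAt).fderiv
    change fderiv ℝ (k ∘ s) x v = _
    rw [this]; simp
  rw [h.fderiv_eq]
  have hk2 : DifferentiableAt ℝ (deriv k) (s x₀) :=
    (differentiableAt_fderiv_of_contDiffAt hk).clm_apply (by fun_prop)
  have hks := hk2.hasDerivAt.comp_hasFDerivAt x₀ hs1.hasFDerivAt
  have hsv : DifferentiableAt ℝ (fun x => fderiv ℝ s x v) x₀ := hs2.clm_apply (by fun_prop)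
  have := congrArg (fun L : V →L[ℝ] ℝ => L v) (hks.mul hsv.hasFDerivAt).fderiv
  refine this.trans ?_
  simp [fderiv_fderiv_apply hs]
  ring

end SecondOrder

/-! ### Maximum principles on self-expanders -/

section MaximumPrinciple

variable {n : ℕ} {M : Type*} [TopologicalSpace M] [ChartedSpace (Euc n) M]
  {F ν : M → Euc (n + 1)}

lemma IsLocalMax.comp_extChartAt_symm {φ : M → ℝ} {q : M} (h : IsLocalMax φ q) :
    IsLocalMax (φ ∘ (extChartAt (𝓡 n) q).symm) (extChartAt (𝓡 n) q q) := by
  have hc : Tendsto (extChartAt (𝓡 n) q).symm (𝓝 (extChartAt (𝓡 n) q q)) (𝓝 q) := by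
    have := (continuousAt_extChartAt_symm (I := 𝓡 n) q).tendsto
    rwa [extChartAt_to_inv] at this
  filter_upwards [hc.eventually h] with x hx
  simpa using hx

variable [IsManifold (𝓡 n) ∞ M]

/-- At a touching point of the Jacobi function `⟨R F, ν⟩` of a rotation and of `c (H + ε)`, the
latter cannot be a strict supersolution of the equation `Δφ + ½⟨F, ∇φ⟩ + |A|² φ = ½ φ` of the
former. The numbers `κ i` are the principal curvatures. -/
lemma IsOrientedHypersurface.le_of_isLocalMax_jacobi (hF : IsOrientedHypersurface F ν)
    (hE : IsSelfExpander F ν) (R : Euc (n + 1) →L[ℝ] Euc (n + 1))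
    (hR : ∀ x, inner ℝ (R x) x = 0) (c ε : ℝ) (q : M)
    (hq : inner ℝ (R (F q)) (ν q) = c * (meanCurvature F ν q + ε))
    (hmax : IsLocalMax (fun p => inner ℝ (R (F p)) (ν p) - c * (meanCurvature F ν p + ε)) q) :
    ∃ κ : Fin n → ℝ, (∀ i, ∃ v, ‖dmap F q v‖ = 1 ∧ dmap ν q v = -(κ i • dmap F q v)) ∧
      ∑ i, κ i = meanCurvature F ν q ∧
      c * (meanCurvature F ν q + ε / 2) ≤ c * ε * ∑ i, κ i ^ 2 := by
  have hP := hF.expanderPatch hE q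
  obtain ⟨E, γ, κ, hE1, hκ, hX, hN, hH⟩ := hP.exists_drift_laplacian
  have hmax' := hmax.comp_extChartAt_symm (n := n)
  have hXc := hP.smooth
  have hNc := hP.smooth_normal
  rw [localPatch_apply_self, localPatch_apply_self] at hH
  have hHq : meanCurvature F ν q = ∑ i, κ i := by rw [hH, hE q]
  refine ⟨κ, fun i => ⟨E i, ?_, ?_⟩, hHq.symm, ?_⟩
  · rw [dmap_eq hF.smooth]; exact hE1.1 i
  · rw [dmap_eq hF.smooth, dmap_eq hF.smooth_normal]; exact hκ i
  -- as `H = ½⟨F, ν⟩`, the difference is `⟨B F, ν⟩ - c ε` with `B = R - c / 2`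
  let B : Euc (n + 1) →L[ℝ] Euc (n + 1) := R - (c / 2) • ContinuousLinearMap.id ℝ _
  have hB : ∀ z, B z = R z - (c / 2) • z := fun z => rfl
  set x₀ := extChartAt (𝓡 n) q q with hx₀
  set X := localPatch F q with hXdef
  set N := localPatch ν q with hNdef
  have hφ : ((fun p => inner ℝ (R (F p)) (ν p) - c * (meanCurvature F ν p + ε)) ∘
      (extChartAt (𝓡 n) q).symm) = fun x => inner ℝ (B (X x)) (N x) - c * ε := by
    funext x
    simp only [Function.comp_apply, hE _, hB, hXdef, hNdef, localPatch, inner_sub_left,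
      real_inner_smul_left]
    ring
  rw [hφ] at hmax'
  have hBX : ContDiffAt ℝ 2 (fun x => B (X x)) x₀ := B.contDiff.contDiffAt.comp x₀ hXc
  have hmax2 : IsLocalMax (fun x => inner ℝ (B (X x)) (N x)) x₀ := by
    filter_upwards [hmax'] with x hx
    linarith
  have h1 := hmax2.sum_fderiv_fderiv_sub_nonpos (hBX.inner ℝ hNc) E γ
  have hX1 := hXc.differentiableAt (by norm_num)
  have hN1 := hNc.differentiableAt (by norm_num)
  have hX2 := differentiableAt_fderiv_of_contDiffAt hXc
  have hdB : ∀ v, fderiv ℝ (fun x => B (X x)) x₀ v = B (fderiv ℝ X x₀ v) := fun v =>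
    congrArg (fun L : Euc n →L[ℝ] Euc (n + 1) => L v)
      (B.hasFDerivAt.comp x₀ hX1.hasFDerivAt).fderiv
  have hdB2 : ∀ v, fderiv ℝ (fderiv ℝ fun x => B (X x)) x₀ v v =
      B (fderiv ℝ (fderiv ℝ X) x₀ v v) := fun v => by
    rw [← fderiv_fderiv_apply hBX, ← fderiv_fderiv_apply hXc]
    have : (fun x => fderiv ℝ (fun x => B (X x)) x v) =ᶠ[𝓝 x₀] fun x => B (fderiv ℝ X x v) := by
      filter_upwards [eventually_contDiffAt_two hXc] with x hx
      exact congrArg (fun L : Euc n →L[ℝ] Euc (n + 1) => L v)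
        (B.hasFDerivAt.comp x (hx.differentiableAt (by norm_num)).hasFDerivAt).fderiv
    rw [this.fderiv_eq]
    have hXv : DifferentiableAt ℝ (fun x => fderiv ℝ X x v) x₀ := hX2.clm_apply (by fun_prop)
    exact congrArg (fun L : Euc n →L[ℝ] Euc (n + 1) => L v)
      (B.hasFDerivAt.comp x₀ hXv.hasFDerivAt).fderiv
  have hBE : ∀ i, inner ℝ (B (fderiv ℝ X x₀ (E i))) (fderiv ℝ N x₀ (E i)) = c / 2 * κ i := by
    intro i
    have hEE : inner ℝ (fderiv ℝ X x₀ (E i)) (fderiv ℝ X x₀ (E i)) = (1 : ℝ) := by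
      rw [real_inner_self_eq_norm_sq, hE1.1 i]; norm_num
    rw [hκ, hB, inner_neg_right, real_inner_smul_right, inner_sub_left, hR, real_inner_smul_left,
      hEE]
    ring
  have h2 : ∑ i, fderiv ℝ (fderiv ℝ fun x => inner ℝ (B (X x)) (N x)) x₀ (E i) (E i) -
      fderiv ℝ (fun x => inner ℝ (B (X x)) (N x)) x₀ γ =
      (1 / 2 - ∑ i, κ i ^ 2) * inner ℝ (B (X x₀)) (N x₀) + c * ∑ i, κ i := by
    simp_rw [fderiv_fderiv_inner hBX hNc, hdB2, hdB, hBE]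
    rw [fderiv_inner_apply ℝ (hBX.differentiableAt (by norm_num)) hN1, hdB,
      Finset.sum_add_distrib, Finset.sum_add_distrib, ← sum_inner, ← inner_sum, ← map_sum]
    have h3 : ∑ i, fderiv ℝ (fderiv ℝ X) x₀ (E i) (E i) = fderiv ℝ X x₀ γ + (1 / 2 : ℝ) • X x₀ := by
      rw [← hX]; abel
    have h4 : ∑ i, fderiv ℝ (fderiv ℝ N) x₀ (E i) (E i) =
        fderiv ℝ N x₀ γ - (∑ i, κ i ^ 2) • N x₀ := by
      rw [sub_eq_iff_eq_add.1 hN]; abel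
    rw [h3, h4, map_add, map_smul, inner_add_left, inner_sub_right, real_inner_smul_left,
      real_inner_smul_right]
    have h5 : ∑ i, 2 * (c / 2 * κ i) = c * ∑ i, κ i := by
      rw [Finset.mul_sum]; exact Finset.sum_congr rfl fun i _ => by ring
    rw [← h5]
    ring
  have h6 : inner ℝ (B (X x₀)) (N x₀) = c * ε := by
    rw [hB, inner_sub_left, real_inner_smul_left, hXdef, hNdef, localPatch_apply_self,
      localPatch_apply_self, hq, hE q]
    ring
  rw [h2, h6] at h1
  rw [hHq]
  nlinarith

/-- Second order condition at an interior maximum of `⟨F, a⟩ + k(|F|²)`. -/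
lemma IsOrientedHypersurface.le_of_isLocalMax_position (hF : IsOrientedHypersurface F ν)
    (hE : IsSelfExpander F ν) (a : Euc (n + 1)) {k : ℝ → ℝ} (q : M)
    (hk : ContDiffAt ℝ 2 k (‖F q‖ ^ 2))
    (hmax : IsLocalMax (fun p => inner ℝ (F p) a + k (‖F p‖ ^ 2)) q) :
    ∃ T : ℝ, 0 ≤ T ∧ T ≤ ‖F q‖ ^ 2 ∧
      1 / 2 * inner ℝ (F q) a + deriv k (‖F q‖ ^ 2) * (‖F q‖ ^ 2 + 2 * n) +
        4 * deriv (deriv k) (‖F q‖ ^ 2) * T ≤ 0 := by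
  have hP := hF.expanderPatch hE q
  obtain ⟨E, γ, κ, hE1, hκ, hX, hN, hH⟩ := hP.exists_drift_laplacian
  have hmax' := hmax.comp_extChartAt_symm (n := n)
  have hXc := hP.smooth
  have hFq := localPatch_apply_self F q
  set x₀ := extChartAt (𝓡 n) q q with hx₀
  set X := localPatch F q with hXdef
  have hφ : ((fun p => inner ℝ (F p) a + k (‖F p‖ ^ 2)) ∘ (extChartAt (𝓡 n) q).symm) =
      fun x => inner ℝ (X x) a + k (inner ℝ (X x) (X x)) := by
    funext x
    simp [hXdef, localPatch]
  have hs : ‖F q‖ ^ 2 = inner ℝ (X x₀) (X x₀) := by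
    rw [real_inner_self_eq_norm_sq, hFq]
  rw [hφ] at hmax'
  rw [hs] at hk ⊢
  have hXX : ContDiffAt ℝ 2 (fun x => inner ℝ (X x) (X x)) x₀ := hXc.inner ℝ hXc
  have hXa : ContDiffAt ℝ 2 (fun x => inner ℝ (X x) a) x₀ := hXc.inner ℝ contDiffAt_const
  have hkX : ContDiffAt ℝ 2 (fun x => k (inner ℝ (X x) (X x))) x₀ :=
    ContDiffAt.comp x₀ (g := k) (f := fun x => inner ℝ (X x) (X x)) hk hXX
  have h1 := hmax'.sum_fderiv_fderiv_sub_nonpos (hXa.add hkX) E γ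
  have hX1 := hXc.differentiableAt (by norm_num)
  have hds : ∀ v, fderiv ℝ (fun x => inner ℝ (X x) (X x)) x₀ v =
      2 * inner ℝ (X x₀) (fderiv ℝ X x₀ v) := fun v => by
    rw [fderiv_inner_apply ℝ hX1 hX1, real_inner_comm (X x₀)]; ring
  have hdk : ∀ v, fderiv ℝ (fun x => k (inner ℝ (X x) (X x))) x₀ v =
      deriv k (inner ℝ (X x₀) (X x₀)) * (2 * inner ℝ (X x₀) (fderiv ℝ X x₀ v)) := fun v => by
    rw [← hds]
    have := congrArg (fun L : Euc n →L[ℝ] ℝ => L v)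
      (HasDerivAt.comp_hasFDerivAt (h₂ := k) x₀ (hk.differentiableAt (by norm_num)).hasDerivAt
      (hXX.differentiableAt (by norm_num)).hasFDerivAt).fderiv
    refine this.trans ?_
    simp
  have hadd : ∀ v, fderiv ℝ (fderiv ℝ fun x => inner ℝ (X x) a + k (inner ℝ (X x) (X x))) x₀ v v =
      fderiv ℝ (fderiv ℝ fun x => inner ℝ (X x) a) x₀ v v +
      fderiv ℝ (fderiv ℝ fun x => k (inner ℝ (X x) (X x))) x₀ v v := fun v => by
    have h : fderiv ℝ (fun x => inner ℝ (X x) a + k (inner ℝ (X x) (X x))) =ᶠ[𝓝 x₀]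
        fun x => fderiv ℝ (fun x => inner ℝ (X x) a) x +
          fderiv ℝ (fun x => k (inner ℝ (X x) (X x))) x := by
      filter_upwards [eventually_contDiffAt_two hXa, eventually_contDiffAt_two hkX] with x h1 h2
      exact fderiv_fun_add (h1.differentiableAt (by norm_num)) (h2.differentiableAt (by norm_num))
    rw [h.fderiv_eq, fderiv_fun_add (differentiableAt_fderiv_of_contDiffAt hXa)
      (differentiableAt_fderiv_of_contDiffAt hkX)]
    rfl
  have hEE : ∀ i, inner ℝ (fderiv ℝ X x₀ (E i)) (fderiv ℝ X x₀ (E i)) = (1 : ℝ) := fun i => by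
    rw [real_inner_self_eq_norm_sq, hE1.1 i]; norm_num
  have hda : ∀ v, fderiv ℝ (fderiv ℝ fun x => inner ℝ (X x) a) x₀ v v =
      inner ℝ (fderiv ℝ (fderiv ℝ X) x₀ v v) a := fun v => by
    rw [fderiv_fderiv_inner hXc contDiffAt_const]; simp
  have hda1 : ∀ v, fderiv ℝ (fun x => inner ℝ (X x) a) x₀ v = inner ℝ (fderiv ℝ X x₀ v) a :=
    fun v => by rw [fderiv_inner_apply ℝ hX1 (by fun_prop)]; simp
  refine ⟨∑ i, inner ℝ (X x₀) (fderiv ℝ X x₀ (E i)) ^ 2,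
    Finset.sum_nonneg fun i _ => sq_nonneg _, ?_, ?_⟩
  · have := hE1.sum_inner_products_le (s := Finset.univ) (X x₀)
    rw [real_inner_self_eq_norm_sq]
    refine le_trans (le_of_eq ?_) this
    refine Finset.sum_congr rfl fun i _ => ?_
    rw [Real.norm_eq_abs, sq_abs, real_inner_comm]
  have h2 : ∀ i, fderiv ℝ (fderiv ℝ fun x => inner ℝ (X x) a + k (inner ℝ (X x) (X x))) x₀
      (E i) (E i) = inner ℝ (fderiv ℝ (fderiv ℝ X) x₀ (E i) (E i)) a +
        (4 * deriv (deriv k) (inner ℝ (X x₀) (X x₀)) * inner ℝ (X x₀) (fderiv ℝ X x₀ (E i)) ^ 2 +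
        deriv k (inner ℝ (X x₀) (X x₀)) * (2 * inner ℝ (X x₀) (fderiv ℝ (fderiv ℝ X) x₀ (E i) (E i))
          + 2)) := fun i => by
    rw [hadd, hda, fderiv_fderiv_real_comp (s := fun x => inner ℝ (X x) (X x)) hk hXX, hds,
      fderiv_fderiv_inner hXc hXc, hEE,
      real_inner_comm (X x₀) (fderiv ℝ (fderiv ℝ X) x₀ (E i) (E i))]
    ring
  have h3 : ∑ i, fderiv ℝ (fderiv ℝ X) x₀ (E i) (E i) = fderiv ℝ X x₀ γ + (1 / 2 : ℝ) • X x₀ := by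
    rw [← hX]; abel
  simp_rw [h2] at h1
  rw [fderiv_fun_add (hXa.differentiableAt (by norm_num)) (hkX.differentiableAt (by norm_num)),
    _root_.add_apply, hda1, hdk, Finset.sum_add_distrib, Finset.sum_add_distrib, ← sum_inner, h3,
    ← Finset.mul_sum, ← Finset.mul_sum, Finset.sum_add_distrib, ← Finset.mul_sum, ← inner_sum, h3,
    inner_add_left, inner_add_right, real_inner_smul_left, real_inner_smul_right] at h1
  simp only [Finset.sum_const, Finset.card_univ, Fintype.card_fin, nsmul_eq_mul] at h1
  rw [← hFq]
  linarith

end MaximumPrinciple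

/-! ### Vanishing of rotational Jacobi functions -/

section JacobiVanishing

lemma exists_pos_mul_norm_le {V W : Type*} [NormedAddCommGroup V] [NormedSpace ℝ V]
    [FiniteDimensional ℝ V] [NormedAddCommGroup W] [NormedSpace ℝ W] {L : V →L[ℝ] W}
    (hL : Function.Injective L) : ∃ c : ℝ, 0 < c ∧ ∀ v, c * ‖v‖ ≤ ‖L v‖ := by
  obtain ⟨K, hK, h⟩ := (L : V →ₗ[ℝ] W).exists_antilipschitzWith (LinearMap.ker_eq_bot.2 hL)
  refine ⟨(K : ℝ)⁻¹, by positivity, fun v => ?_⟩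
  have := ZeroHomClass.bound_of_antilipschitz (L : V →ₗ[ℝ] W) h v
  rw [inv_mul_le_iff₀ (by positivity)]
  exact this

variable {n : ℕ} {M : Type*} [TopologicalSpace M] [ChartedSpace (Euc n) M]
  {F ν : M → Euc (n + 1)}

/-- The numbers `κ i` are principal curvatures at `q`, counted with multiplicity. -/
def IsPrincipalCurvatures (F ν : M → Euc (n + 1)) (q : M) (κ : Fin n → ℝ) : Prop :=
  (∀ i, ∃ v, ‖dmap F q v‖ = 1 ∧ dmap ν q v = -(κ i • dmap F q v)) ∧
    ∑ i, κ i = meanCurvature F ν q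

lemma IsPrincipalCurvatures.sum_sq_le {q : M} {κ : Fin n → ℝ} (hκ : IsPrincipalCurvatures F ν q κ)
    {C : ℝ} (hC : ∀ v, ‖dmap ν q v‖ ≤ C * ‖dmap F q v‖) : ∑ i, κ i ^ 2 ≤ n * C ^ 2 := by
  have : ∀ i ∈ Finset.univ, κ i ^ 2 ≤ C ^ 2 := fun i _ => by
    obtain ⟨v, h1, h2⟩ := hκ.1 i
    have h3 := hC v
    rw [h2, norm_neg, norm_smul, h1, mul_one, mul_one, Real.norm_eq_abs] at h3
    calc κ i ^ 2 = |κ i| ^ 2 := (sq_abs _).symm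
      _ ≤ C ^ 2 := by gcongr
  simpa using Finset.sum_le_card_nsmul _ _ _ this

lemma continuous_meanCurvature (hF : IsOrientedHypersurface F ν) (hE : IsSelfExpander F ν) :
    Continuous (meanCurvature F ν) := by
  have : meanCurvature F ν = fun q => 1 / 2 * inner ℝ (F q) (ν q) := funext hE
  rw [this]
  exact continuous_const.mul (hF.smooth.continuous.inner hF.smooth_normal.continuous)

variable [IsManifold (𝓡 n) ∞ M]

lemma IsOrientedHypersurface.eventually_norm_dmap_normal_le (hF : IsOrientedHypersurface F ν)
    (q : M) : ∃ C : ℝ, ∀ᶠ p in 𝓝 q, ∀ v, ‖dmap ν p v‖ ≤ C * ‖dmap F p v‖ := by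
  have hP := hF.hypersurfacePatch q
  obtain ⟨c, hc, hcle⟩ := exists_pos_mul_norm_le hP.injective
  set x₀ := extChartAt (𝓡 n) q q
  set X := localPatch F q
  set N := localPatch ν q
  have hX : ∀ᶠ x in 𝓝 x₀, ‖fderiv ℝ X x - fderiv ℝ X x₀‖ < c / 2 := by
    have h := (differentiableAt_fderiv_of_contDiffAt hP.smooth).continuousAt
    have h2 := Metric.continuousAt_iff'.1 h (c / 2) (by positivity)
    simpa [dist_eq_norm] using h2
  have hN : ∀ᶠ x in 𝓝 x₀, ‖fderiv ℝ N x‖ < ‖fderiv ℝ N x₀‖ + 1 :=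
    (differentiableAt_fderiv_of_contDiffAt hP.smooth_normal).continuousAt.norm.eventually_lt
      continuousAt_const (by linarith)
  refine ⟨(‖fderiv ℝ N x₀‖ + 1) / (c / 2), ?_⟩
  have hcont : Tendsto (extChartAt (𝓡 n) q) (𝓝 q) (𝓝 x₀) := (continuousAt_extChartAt q).tendsto
  filter_upwards [hcont.eventually hX, hcont.eventually hN, hcont.eventually
    (eventually_mem_target q), extChartAt_source_mem_nhds (I := 𝓡 n) q] with p h1 h2 h3 h4 v
  obtain ⟨θ, hθ⟩ := exists_fderiv_localPatch_eq q h3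
  rw [(extChartAt (𝓡 n) q).left_inv h4] at hθ
  have h5 := hθ F hF.smooth (θ.symm v)
  have h6 := hθ ν hF.smooth_normal (θ.symm v)
  rw [ContinuousLinearEquiv.apply_symm_apply] at h5 h6
  rw [← h5, ← h6]
  set u := θ.symm v
  have h7 : ‖fderiv ℝ N (extChartAt (𝓡 n) q p) u‖ ≤ (‖fderiv ℝ N x₀‖ + 1) * ‖u‖ :=
    (ContinuousLinearMap.le_opNorm _ _).trans (by gcongr)
  have h8 : c / 2 * ‖u‖ ≤ ‖fderiv ℝ X (extChartAt (𝓡 n) q p) u‖ := by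
    have h9 := ContinuousLinearMap.le_opNorm
      (fderiv ℝ X (extChartAt (𝓡 n) q p) - fderiv ℝ X x₀) u
    have h10 : ‖fderiv ℝ X (extChartAt (𝓡 n) q p) - fderiv ℝ X x₀‖ * ‖u‖ ≤ c / 2 * ‖u‖ := by
      gcongr
    rw [_root_.sub_apply] at h9
    have h11 := norm_sub_norm_le (fderiv ℝ X x₀ u) (fderiv ℝ X (extChartAt (𝓡 n) q p) u)
    rw [norm_sub_rev] at h11
    have h12 := hcle u
    linarith
  calc _ ≤ (‖fderiv ℝ N x₀‖ + 1) * ‖u‖ := h7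
    _ = (‖fderiv ℝ N x₀‖ + 1) / (c / 2) * (c / 2 * ‖u‖) := by field_simp
    _ ≤ _ := by gcongr

lemma IsOrientedHypersurface.exists_norm_dmap_normal_le (hF : IsOrientedHypersurface F ν)
    {K : Set M} (hK : IsCompact K) :
    ∃ C : ℝ, ∀ p ∈ K, ∀ v, ‖dmap ν p v‖ ≤ C * ‖dmap F p v‖ := by
  refine hK.induction_on (p := fun S => ∃ C : ℝ, ∀ p ∈ S, ∀ v, ‖dmap ν p v‖ ≤ C * ‖dmap F p v‖)
    ⟨0, by simp⟩ ?_ ?_ ?_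
  · rintro s t hst ⟨C, hC⟩
    exact ⟨C, fun p hp => hC p (hst hp)⟩
  · rintro s t ⟨C, hC⟩ ⟨C', hC'⟩
    refine ⟨max C C', fun p hp v => ?_⟩
    rcases hp with hp | hp
    · exact (hC p hp v).trans (by gcongr; exact le_max_left _ _)
    · exact (hC' p hp v).trans (by gcongr; exact le_max_right _ _)
  · intro q _
    obtain ⟨C, hC⟩ := hF.eventually_norm_dmap_normal_le q
    exact ⟨_, mem_nhdsWithin_of_mem_nhds hC, C, fun p hp => hp⟩

/-- Liouville theorem: a rotational Jacobi function `⟨R F, ν⟩` which decays at infinity vanishes on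
a mean-convex self-expander with `|A|² ≤ ½` outside a compact set. It is compared with `H + ε`,
which is a strict positive supersolution for small `ε`. -/
theorem IsOrientedHypersurface.inner_rotation_eq_zero (hF : IsOrientedHypersurface F ν)
    (hE : IsSelfExpander F ν) (hH : IsMeanConvex F ν)
    (hA : ∀ᶠ q in cocompact M, ∀ κ, IsPrincipalCurvatures F ν q κ → ∑ i, κ i ^ 2 ≤ 1 / 2)
    {R : Euc (n + 1) →L[ℝ] Euc (n + 1)} (hR : ∀ x, inner ℝ (R x) x = 0)
    (hf : Tendsto (fun q => inner ℝ (R (F q)) (ν q)) (cocompact M) (𝓝 0)) (q : M) :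
    inner ℝ (R (F q)) (ν q) = 0 := by
  -- one inequality for all rotations suffices, by replacing `R` by `-R`
  have key : ∀ R : Euc (n + 1) →L[ℝ] Euc (n + 1), (∀ x, inner ℝ (R x) x = 0) →
      Tendsto (fun q => inner ℝ (R (F q)) (ν q)) (cocompact M) (𝓝 0) → ∀ q,
      inner ℝ (R (F q)) (ν q) ≤ 0 := by
    clear hR hf q R
    intro R hR hf q₁
    by_contra! hpos
    obtain ⟨K, hK, hKA⟩ := mem_cocompact.1 hA
    have hHc := continuous_meanCurvature hF hE
    obtain ⟨C, hC⟩ := hF.exists_norm_dmap_normal_le hK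
    obtain ⟨h₀, hh₀, hh₀K⟩ : ∃ h₀ > 0, ∀ q ∈ K, h₀ ≤ meanCurvature F ν q := by
      rcases K.eq_empty_or_nonempty with rfl | hne
      · exact ⟨1, one_pos, by simp⟩
      · obtain ⟨p, hp, hmin⟩ := hK.exists_isMinOn hne hHc.continuousOn
        exact ⟨_, hH p, fun q hq => hmin hq⟩
    -- on `K`, where `|A|² ≤ n C²`, this makes `ε |A|²` smaller than `H`
    set ε := h₀ / (n * C ^ 2 + 1) with hε
    have hε0 : 0 < ε := by positivity
    have hεC : ε * (n * C ^ 2) < h₀ := by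
      rw [hε, div_mul_eq_mul_div, div_lt_iff₀ (by positivity)]
      nlinarith
    let f : M → ℝ := fun q => inner ℝ (R (F q)) (ν q)
    have hfc : Continuous f :=
      (R.continuous.comp hF.smooth.continuous).inner hF.smooth_normal.continuous
    let g : M → ℝ := fun q => f q / (meanCurvature F ν q + ε)
    have hden : ∀ q, 0 < meanCurvature F ν q + ε := fun q => add_pos (hH q) hε0
    have hgc : Continuous g := hfc.div (hHc.add continuous_const) fun q => (hden q).ne'
    have hg1 : 0 < g q₁ := div_pos hpos (hden q₁)
    have hsmall : ∀ᶠ q in cocompact M, f q < ε * g q₁ :=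
      hf.eventually_lt_const (by positivity)
    obtain ⟨K₂, hK₂, hK₂f⟩ := mem_cocompact.1 hsmall
    have hout : ∀ q ∉ K₂, g q < g q₁ := fun q hq => by
      have h1 : f q < ε * g q₁ := hK₂f hq
      rw [div_lt_iff₀ (hden q)]
      have := mul_pos (hH q) hg1
      nlinarith
    have hq₁ : q₁ ∈ K₂ := by
      by_contra h
      exact lt_irrefl _ (hout q₁ h)
    obtain ⟨p, hp, hmax⟩ := hK₂.exists_isMaxOn ⟨q₁, hq₁⟩ hgc.continuousOn
    have hmax' : ∀ q, g q ≤ g p := fun q => by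
      by_cases hq : q ∈ K₂
      · exact hmax hq
      · exact (hout q hq).le.trans (hmax hq₁)
    have hgp : 0 < g p := hg1.trans_le (hmax' q₁)
    have hval : f p = g p * (meanCurvature F ν p + ε) := (div_mul_cancel₀ _ (hden p).ne').symm
    obtain ⟨κ, hκ1, hκ2, hκ3⟩ := hF.le_of_isLocalMax_jacobi hE R hR (g p) ε p hval <| by
      refine Eventually.of_forall fun q => ?_
      have h1 : f q ≤ g p * (meanCurvature F ν q + ε) := (div_le_iff₀ (hden q)).1 (hmax' q)
      have h2 : f p - g p * (meanCurvature F ν p + ε) = 0 := sub_eq_zero.2 hval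
      exact (sub_nonpos.2 h1).trans h2.ge
    have hκ : IsPrincipalCurvatures F ν p κ := ⟨hκ1, hκ2⟩
    rw [mul_assoc, mul_le_mul_iff_right₀ hgp] at hκ3
    by_cases hpK : p ∈ K
    · have h1 := hκ.sum_sq_le (hC p hpK)
      have h2 := hh₀K p hpK
      have h3 : ε * ∑ i, κ i ^ 2 ≤ ε * (n * C ^ 2) := by gcongr
      linarith
    · have h1 : ∑ i, κ i ^ 2 ≤ 1 / 2 := hKA hpK κ hκ
      have h2 := hH p
      nlinarith
  refine le_antisymm (key R hR hf q) ?_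
  have := key (-R) (fun x => by simp [hR]) (by simpa using hf.neg) q
  simpa using this

end JacobiVanishing

/-! ### Local left inverses of an immersion -/

section LocalInverse

variable {n : ℕ}

/-- A left inverse of the differential of a patch which kills the normal, and nothing else. -/
lemma HypersurfacePatch.exists_projection {X N : Euc n → Euc (n + 1)} {x₀ : Euc n}
    (hP : HypersurfacePatch X N x₀) :
    ∃ P : Euc (n + 1) →L[ℝ] Euc n, (∀ v, P (fderiv ℝ X x₀ v) = v) ∧
      ∀ z, P z = 0 → ∃ d : ℝ, z = d • N x₀ := by
  obtain ⟨E, κ, hE, hκ, hrep, -⟩ := hP.exists_principal_frame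
  obtain ⟨P, hPapp⟩ : ∃ P : Euc (n + 1) →L[ℝ] Euc n,
      ∀ z, P z = ∑ i, inner ℝ (fderiv ℝ X x₀ (E i)) z • E i :=
    ⟨∑ i, (innerSL ℝ (fderiv ℝ X x₀ (E i))).smulRight (E i), fun z => by simp⟩
  have hPv : ∀ v, P (fderiv ℝ X x₀ v) = v := fun v => by rw [hPapp, ← hrep]
  have horth := hP.orthogonal.self_of_nhds
  have hPN : P (N x₀) = 0 := by
    rw [hPapp]
    exact Finset.sum_eq_zero fun i _ => by rw [horth, zero_smul]
  refine ⟨P, hPv, fun z hz => ⟨inner ℝ z (N x₀), ?_⟩⟩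
  obtain ⟨v, hv⟩ := hP.exists_fderiv_eq (z := z - inner ℝ z (N x₀) • N x₀) <| by
    rw [inner_sub_left, real_inner_smul_left, real_inner_self_eq_norm_sq,
      hP.norm_normal.self_of_nhds]
    ring
  have h1 : v = 0 := by rw [← hPv v, hv, map_sub, map_smul, hz, hPN, smul_zero, sub_zero]
  rw [h1, map_zero] at hv
  exact sub_eq_zero.1 hv.symm

variable {M : Type*} [TopologicalSpace M] [ChartedSpace (Euc n) M]
  [IsManifold (𝓡 n) ∞ M] {F ν : M → Euc (n + 1)}

/-- Near `q₀` the immersion `F` has a smooth left inverse `L`, such that `F ∘ L` moves points only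
in the direction of the normal at `q₀`. -/
lemma IsOrientedHypersurface.exists_local_left_inverse (hF : IsOrientedHypersurface F ν) (q₀ : M) :
    ∃ L : Euc (n + 1) → M, (∀ᶠ q in 𝓝 q₀, L (F q) = q) ∧
      ∀ᶠ z in 𝓝 (F q₀), ContMDiffAt 𝓘(ℝ, Euc (n + 1)) (𝓡 n) ∞ L z ∧
        ∃ d : ℝ, F (L z) = z + d • ν q₀ := by
  have hP := hF.hypersurfacePatch q₀
  obtain ⟨P, hPv, hPker⟩ := hP.exists_projection
  rw [localPatch_apply_self] at hPker
  have hXon := contDiffOn_localPatch hF.smooth q₀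
  have hX0 := localPatch_apply_self F q₀
  have htarget := isOpen_extChartAt_target (I := 𝓡 n) q₀
  have hmem := eventually_mem_target (n := n) q₀
  have hxq : (extChartAt (𝓡 n) q₀).symm (extChartAt (𝓡 n) q₀ q₀) = q₀ := extChartAt_to_inv q₀
  have hXsymm : ∀ x, localPatch F q₀ x = F ((extChartAt (𝓡 n) q₀).symm x) := fun x => rfl
  have hcs := contMDiffOn_extChartAt_symm (I := 𝓡 n) (n := ∞) q₀
  have hc := contMDiffAt_extChartAt (I := 𝓡 n) (n := ∞) (x := q₀)
  have hleft : ∀ q ∈ (extChartAt (𝓡 n) q₀).source,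
      (extChartAt (𝓡 n) q₀).symm (extChartAt (𝓡 n) q₀ q) = q := fun q h =>
    (extChartAt (𝓡 n) q₀).left_inv h
  have hsrc := extChartAt_source_mem_nhds (I := 𝓡 n) q₀
  generalize (extChartAt (𝓡 n) q₀) = χ at *
  set x₀ := χ q₀ with hx₀
  set X := localPatch F q₀ with hX
  have hX1 := hP.smooth.differentiableAt (by norm_num)
  let g : Euc n → Euc n := fun x => P (X x)
  have hgon : ContDiffOn ℝ ∞ g χ.target := P.contDiff.comp_contDiffOn hXon
  have hg0 : ContDiffAt ℝ ∞ g x₀ := hgon.contDiffAt hmem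
  have hg1 : HasFDerivAt g (ContinuousLinearEquiv.refl ℝ (Euc n) : Euc n →L[ℝ] Euc n) x₀ := by
    exact (P.hasFDerivAt.comp x₀ hX1.hasFDerivAt).congr_fderiv (by ext1 v; exact hPv v)
  let h := hg0.toOpenPartialHomeomorph g hg1 (by simp)
  have hcoe : ∀ x, h x = g x := fun x => rfl
  have hsource : x₀ ∈ h.source := hg0.mem_toOpenPartialHomeomorph_source hg1 (by simp)
  have hsymm0 : h.symm (g x₀) = x₀ := h.left_inv hsource
  have hgx : g x₀ = P (F q₀) := by simp only [g]; rw [hX0]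
  have htgt : h.target ∈ 𝓝 (g x₀) := h.open_target.mem_nhds (h.map_source hsource)
  have hsymmc : Tendsto h.symm (𝓝 (g x₀)) (𝓝 x₀) := by
    have := (h.continuousAt_symm (h.map_source hsource)).tendsto
    rw [hcoe] at this
    rwa [hsymm0] at this
  have hinv : ∀ᶠ x in 𝓝 x₀, ∃ f' : Euc n ≃L[ℝ] Euc n, HasFDerivAt g (f' : Euc n →L[ℝ] Euc n) x := by
    have h2 : ContDiffAt ℝ 2 g x₀ := hg0.of_le (by norm_cast)
    have h1 : ContinuousAt (fderiv ℝ g) x₀ :=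
      (differentiableAt_fderiv_of_contDiffAt h2).continuousAt
    have h3 := h1.eventually
      ((ContinuousLinearEquiv.isOpen (𝕜 := ℝ) (E := Euc n) (F := Euc n)).mem_nhds
        (by rw [hg1.fderiv]; exact ⟨_, rfl⟩))
    filter_upwards [h3, eventually_contDiffAt_two h2] with x ⟨f', hf'⟩ hx
    exact ⟨f', by rw [hf']; exact (hx.differentiableAt (by norm_num)).hasFDerivAt⟩
  have hPc : Tendsto P (𝓝 (F q₀)) (𝓝 (g x₀)) := by
    rw [hgx]; exact P.continuous.continuousAt
  refine ⟨fun z => χ.symm (h.symm (P z)), ?_, ?_⟩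
  · have hχc : Tendsto χ (𝓝 q₀) (𝓝 x₀) := hc.continuousAt
    filter_upwards [hsrc, hχc.eventually (h.open_source.mem_nhds hsource)] with q h1 h2
    have h3 : P (F q) = h (χ q) := by
      rw [hcoe]; simp only [g]; rw [hXsymm, hleft q h1]
    rw [h3, h.left_inv h2, hleft q h1]
  · filter_upwards [hPc.eventually htgt, hPc.eventually (hsymmc.eventually hinv),
      hPc.eventually (hsymmc.eventually (htarget.mem_nhds hmem.self_of_nhds))]
      with z h1 ⟨f', hf'⟩ h3
    refine ⟨?_, ?_⟩
    · have h4 : ContDiffAt ℝ ∞ h.symm (P z) :=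
        h.contDiffAt_symm h1 hf' (hgon.contDiffAt (htarget.mem_nhds h3))
      have h5 : ContMDiffAt 𝓘(ℝ, Euc n) (𝓡 n) ∞ χ.symm (h.symm (P z)) :=
        hcs.contMDiffAt (htarget.mem_nhds h3)
      have h6 : ContDiffAt ℝ ∞ (fun z => h.symm (P z)) z := h4.comp z P.contDiff.contDiffAt
      exact ContMDiffAt.comp z h5 h6.contMDiffAt
    · have h4 : P (F (χ.symm (h.symm (P z)))) = P z := by
        rw [← hXsymm]
        exact h.right_inv h1
      obtain ⟨d, hd⟩ := hPker (F (χ.symm (h.symm (P z))) - z) (by rw [map_sub, h4, sub_self])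
      exact ⟨d, by rw [← hd]; abel⟩

lemma IsOrientedHypersurface.isLocallyInjective (hF : IsOrientedHypersurface F ν) :
    IsLocallyInjective F := by
  rw [isLocallyInjective_iff_nhds]
  intro q
  obtain ⟨L, hL, -⟩ := hF.exists_local_left_inverse q
  exact ⟨_, hL, fun a ha b hb hab => by
    have h1 : L (F a) = a := ha
    have h2 : L (F b) = b := hb
    rw [← h1, ← h2, hab]⟩

/-- Lifts along the immersion `F` are determined by their value at one point. -/
lemma IsOrientedHypersurface.eqOn_of_comp_eqOn [T2Space M] (hF : IsOrientedHypersurface F ν)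
    {S : Set ℝ}
    (hS : IsPreconnected S) {c₁ c₂ : ℝ → M} (h₁ : ContinuousOn c₁ S) (h₂ : ContinuousOn c₂ S)
    (he : ∀ t ∈ S, F (c₁ t) = F (c₂ t)) {a : ℝ} (ha : a ∈ S) (hca : c₁ a = c₂ a) :
    EqOn c₁ c₂ S :=
  (T2Space.isSeparatedMap F).eqOn_of_comp_eqOn hF.isLocallyInjective hS h₁ h₂ he ha hca

end LocalInverse

/-! ### Lifting isometries to the hypersurface -/

section RotationLift

/-- A one-parameter group `ρ` of linear isometries of a Euclidean space with generator `R`. -/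
structure IsIsometryGroup {W : Type*} [NormedAddCommGroup W] [NormedSpace ℝ W]
    (ρ : ℝ → W → W) (R : W →L[ℝ] W) : Prop where
  zero_apply : ∀ z, ρ 0 z = z
  add_apply : ∀ s t z, ρ (s + t) z = ρ s (ρ t z)
  norm_apply : ∀ t z, ‖ρ t z‖ = ‖z‖
  hasDerivAt : ∀ t z, HasDerivAt (fun s => ρ s z) (R (ρ t z)) t
  continuous : Continuous fun p : ℝ × W => ρ p.1 p.2
  contDiff : ∀ t, ContDiff ℝ ∞ (ρ t)

variable {n : ℕ} {M : Type*} [TopologicalSpace M] [ChartedSpace (Euc n) M]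
  [IsManifold (𝓡 n) ∞ M] {F ν : M → Euc (n + 1)}
  {ρ : ℝ → Euc (n + 1) → Euc (n + 1)} {R : Euc (n + 1) →L[ℝ] Euc (n + 1)}

/-- If the generator `R` is tangential along the hypersurface, then orbits starting on the
hypersurface stay on it for a short time: the distance `d` of `ρ t (F q)` to the hypersurface in
direction of the normal at `q₀` solves a linear homogeneous equation. -/
lemma IsOrientedHypersurface.exists_local_lift (hF : IsOrientedHypersurface F ν)
    (hρ : IsIsometryGroup ρ R) (hR : ∀ q, inner ℝ (R (F q)) (ν q) = 0) (q₀ : M) :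
    ∃ (τ : ℝ) (U : Set M) (Ψ : ℝ → M → M), 0 < τ ∧ IsOpen U ∧ q₀ ∈ U ∧ ∀ q ∈ U,
      Ψ 0 q = q ∧ ContinuousOn (fun t => Ψ t q) (Ioo (-τ) τ) ∧
      ∀ t ∈ Ioo (-τ) τ, F (Ψ t q) = ρ t (F q) ∧ ContMDiffAt (𝓡 n) (𝓡 n) ∞ (Ψ t) q := by
  obtain ⟨L, hL1, hL2⟩ := hF.exists_local_left_inverse q₀
  have hLq : L (F q₀) = q₀ := hL1.self_of_nhds
  have hLc : ContinuousAt L (F q₀) := hL2.self_of_nhds.1.continuousAt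
  have hν : ∀ᶠ z in 𝓝 (F q₀), 1 / 2 < inner ℝ (ν q₀) (ν (L z)) := by
    have hc : ContinuousAt (fun z => inner ℝ (ν q₀) (ν (L z))) (F q₀) :=
      continuousAt_const.inner (hF.smooth_normal.continuous.continuousAt.comp hLc)
    refine continuousAt_const.eventually_lt hc ?_
    rw [hLq, real_inner_self_eq_norm_sq, hF.norm_normal]; norm_num
  have hgood := hL2.and hν
  have hcont : Tendsto (fun p : ℝ × M => ρ p.1 (F p.2)) (𝓝 0 ×ˢ 𝓝 q₀) (𝓝 (F q₀)) := by
    have h1 : Continuous fun p : ℝ × M => ρ p.1 (F p.2) :=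
      hρ.continuous.comp (continuous_fst.prodMk (hF.smooth.continuous.comp continuous_snd))
    have h2 := h1.tendsto (0, q₀)
    rwa [nhds_prod_eq, hρ.zero_apply] at h2
  obtain ⟨p₁, hp₁, p₂, hp₂, hp⟩ := eventually_prod_iff.1 (hcont.eventually hgood)
  obtain ⟨τ, hτ, hτp⟩ := Metric.eventually_nhds_iff.1 hp₁
  obtain ⟨U, hU, hUo, hqU⟩ := eventually_nhds_iff.1 (hp₂.and hL1)
  refine ⟨τ, U, fun t q => L (ρ t (F q)), hτ, hUo, hqU, fun q hq => ?_⟩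
  have hq1 : L (F q) = q := (hU q hq).2
  have hg : ∀ t ∈ Ioo (-τ) τ, _ := fun t ht =>
    hp (hτp (y := t) (by rw [Real.dist_eq, sub_zero]; exact abs_lt.2 ht)) (hU q hq).1
  have hρd := fun t => hρ.hasDerivAt t (F q)
  refine ⟨by simp only [hρ.zero_apply, hq1], fun t ht => ?_, fun t ht => ⟨?_, ?_⟩⟩
  · exact (((hg t ht).1.1.continuousAt).comp (f := fun s => ρ s (F q))
      (hρd t).continuousAt).continuousWithinAt
  · let d : ℝ → ℝ := fun t => inner ℝ (F (L (ρ t (F q))) - ρ t (F q)) (ν q₀)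
    have hd : ∀ t ∈ Ioo (-τ) τ, F (L (ρ t (F q))) = ρ t (F q) + d t • ν q₀ := fun t ht => by
      obtain ⟨d', hd'⟩ := (hg t ht).1.2
      simp only [d]
      rw [hd', add_sub_cancel_left, real_inner_smul_left, real_inner_self_eq_norm_sq,
        hF.norm_normal]
      norm_num
    -- the coefficient of the linear equation `d' = a d`, which comes from tangency of `R F` and of
    -- `D(F ∘ L)` at `L (ρ t (F q))`
    let a : ℝ → ℝ := fun t => if t ∈ Ioo (-τ) τ then
      inner ℝ (R (ν q₀)) (ν (L (ρ t (F q)))) / inner ℝ (ν q₀) (ν (L (ρ t (F q)))) else 0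
    have hderiv : ∀ t ∈ Ioo (-τ) τ, HasDerivAt d (a t * d t) t := by
      intro t ht
      obtain ⟨⟨hLs, -⟩, hνt⟩ := hg t ht
      set y := ρ t (F q)
      have h1 : MDifferentiableAt 𝓘(ℝ, Euc (n + 1)) (𝓡 n) L y := hLs.mdifferentiableAt (by simp)
      have h2 : MDifferentiableAt (𝓡 n) 𝓘(ℝ, Euc (n + 1)) F (L y) :=
        (hF.smooth (L y)).mdifferentiableAt (by simp)
      have h3 : DifferentiableAt ℝ (F ∘ L) y := (h2.comp y h1).differentiableAt
      have h4 : ∀ v, inner ℝ (fderiv ℝ (F ∘ L) y v) (ν (L y)) = 0 := fun v => by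
        rw [← mfderiv_eq_fderiv, mfderiv_comp y h2 h1]
        exact hF.orthogonal (L y) _
      have h5 := h3.hasFDerivAt.comp_hasDerivAt t (hρd t)
      have h6 : HasDerivAt d (inner ℝ (fderiv ℝ (F ∘ L) y (R y) - R y) (ν q₀)) t := by
        have := (h5.sub (hρd t)).inner ℝ (hasDerivAt_const t (ν q₀))
        simpa using this
      have h7 : fderiv ℝ (F ∘ L) y (R y) =
          R y + inner ℝ (fderiv ℝ (F ∘ L) y (R y) - R y) (ν q₀) • ν q₀ := by
        have h8 : (F ∘ L) ∘ (fun s => ρ s (F q)) =ᶠ[𝓝 t] fun s => ρ s (F q) + d s • ν q₀ := by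
          filter_upwards [isOpen_Ioo.mem_nhds ht] with s hs
          exact hd s hs
        exact (h5.congr_of_eventuallyEq h8.symm).unique ((hρd t).add (h6.smul_const (ν q₀)))
      have h9 := h4 (R y)
      have h10 := hR (L y)
      rw [h7, inner_add_left, real_inner_smul_left] at h9
      rw [hd t ht, map_add, map_smul, inner_add_left, real_inner_smul_left] at h10
      convert h6 using 1
      simp only [a, if_pos ht]
      rw [div_mul_eq_mul_div, div_eq_iff (by linarith)]
      linarith
    have hbound : ∀ t, ‖a t‖ ≤ 2 * ‖R‖ := fun t => by
      by_cases ht : t ∈ Ioo (-τ) τ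
      · have hνt := (hg t ht).2
        simp only [a, if_pos ht]
        rw [norm_div, div_le_iff₀ (by rw [norm_pos_iff]; linarith)]
        have h1 : ‖inner ℝ (R (ν q₀)) (ν (L (ρ t (F q))))‖ ≤ ‖R‖ := by
          refine (norm_inner_le_norm _ _).trans ?_
          rw [hF.norm_normal, mul_one]
          simpa [hF.norm_normal] using R.le_opNorm (ν q₀)
        have h2 : 1 / 2 ≤ ‖inner ℝ (ν q₀) (ν (L (ρ t (F q))))‖ :=
          hνt.le.trans (le_abs_self _)
        nlinarith [norm_nonneg R]
      · simp only [a, if_neg ht, norm_zero]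
        positivity
    have hzero : EqOn d (fun _ => 0) (Ioo (-τ) τ) := by
      refine ODE_solution_unique_of_mem_Ioo (v := fun t x => a t * x) (s := fun _ => univ)
        (K := Real.toNNReal (2 * ‖R‖)) (t₀ := 0) (fun t _ => ?_) (by simp [hτ])
        (fun t ht => ⟨hderiv t ht, mem_univ _⟩)
        (fun t ht => ⟨by simpa using hasDerivAt_const t (0 : ℝ), mem_univ _⟩) ?_
      · refine (LipschitzWith.of_dist_le_mul fun x y => ?_).lipschitzOnWith
        rw [dist_eq_norm, dist_eq_norm, ← mul_sub, norm_mul, Real.coe_toNNReal _ (by positivity)]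
        gcongr
        exact hbound t
      · simp [d, hρ.zero_apply, hq1]
    have := hd t ht
    rwa [hzero ht, zero_smul, add_zero] at this
  · have h1 : ContMDiff (𝓡 n) 𝓘(ℝ, Euc (n + 1)) ∞ fun q => ρ t (F q) :=
      (hρ.contDiff t).contMDiff.comp hF.smooth
    exact ContMDiffAt.comp q (hg t ht).1.1 (h1 q)

lemma IsOrientedHypersurface.exists_uniform_lift (hF : IsOrientedHypersurface F ν)
    (hρ : IsIsometryGroup ρ R) (hR : ∀ q, inner ℝ (R (F q)) (ν q) = 0) {K : Set M}
    (hK : IsCompact K) :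
    ∃ τ : ℝ, 0 < τ ∧ ∀ q ∈ K, ∃ c : ℝ → M, Continuous c ∧ c 0 = q ∧
      ∀ t ∈ Icc (-τ) τ, F (c t) = ρ t (F q) := by
  refine hK.induction_on (p := fun S => ∃ τ : ℝ, 0 < τ ∧ ∀ q ∈ S, ∃ c : ℝ → M,
    Continuous c ∧ c 0 = q ∧ ∀ t ∈ Icc (-τ) τ, F (c t) = ρ t (F q)) ⟨1, one_pos, by simp⟩ ?_ ?_ ?_
  · rintro s t hst ⟨τ, hτ, h⟩
    exact ⟨τ, hτ, fun q hq => h q (hst hq)⟩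
  · rintro s t ⟨τ, hτ, h⟩ ⟨τ', hτ', h'⟩
    refine ⟨min τ τ', lt_min hτ hτ', fun q hq => ?_⟩
    have h1 := min_le_left τ τ'
    have h2 := min_le_right τ τ'
    rcases hq with hq | hq
    · obtain ⟨c, hc, hc0, hcF⟩ := h q hq
      exact ⟨c, hc, hc0, fun t ht => hcF t ⟨by linarith [ht.1], by linarith [ht.2]⟩⟩
    · obtain ⟨c, hc, hc0, hcF⟩ := h' q hq
      exact ⟨c, hc, hc0, fun t ht => hcF t ⟨by linarith [ht.1], by linarith [ht.2]⟩⟩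
  · intro q₀ _
    obtain ⟨τ, U, Ψ, hτ, hU, hqU, hΨ⟩ := hF.exists_local_lift hρ hR q₀
    refine ⟨U, mem_nhdsWithin_of_mem_nhds (hU.mem_nhds hqU), τ / 2, by positivity, fun q hq => ?_⟩
    obtain ⟨h0, hc, hΨF⟩ := hΨ q hq
    have hclamp : ∀ t, max (-(τ / 2)) (min t (τ / 2)) ∈ Ioo (-τ) τ := fun t =>
      ⟨lt_max_of_lt_left (by linarith), max_lt (by linarith)
        ((min_le_right _ _).trans_lt (by linarith))⟩
    refine ⟨fun t => Ψ (max (-(τ / 2)) (min t (τ / 2))) q, ?_, ?_, fun t ht => ?_⟩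
    · exact hc.comp_continuous (by fun_prop) hclamp
    · simp only
      rw [min_eq_left (by linarith), max_eq_right (by linarith), h0]
    · simp only
      rw [min_eq_left ht.2, max_eq_right ht.1]
      exact (hΨF t ⟨by linarith [ht.1], by linarith [ht.2]⟩).1

variable [T2Space M]

/-- Orbits of points of the hypersurface lift to the hypersurface for all times: they stay in a
compact set, on which there is a uniform time of existence. -/
lemma IsOrientedHypersurface.exists_global_lift (hF : IsOrientedHypersurface F ν)
    (hρ : IsIsometryGroup ρ R) (hR : ∀ q, inner ℝ (R (F q)) (ν q) = 0)
    (hproper : ∀ c, IsCompact {q | ‖F q‖ = c}) (q : M) :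
    ∃ c : ℝ → M, Continuous c ∧ c 0 = q ∧ ∀ t, F (c t) = ρ t (F q) := by
  obtain ⟨τ, hτ, hlift⟩ := hF.exists_uniform_lift hρ hR (hproper ‖F q‖)
  have hstep : ∀ m : ℕ, ∃ c : ℝ → M, Continuous c ∧ c 0 = q ∧
      ∀ t ∈ Icc (-(m * τ)) (m * τ), F (c t) = ρ t (F q) := by
    intro m
    induction m with
    | zero =>
      refine ⟨fun _ => q, continuous_const, rfl, fun t ht => ?_⟩
      have : t = 0 := by
        simp only [Nat.cast_zero, zero_mul, neg_zero, Icc_self, mem_singleton_iff] at ht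
        exact ht
      rw [this, hρ.zero_apply]
    | succ m ih =>
      obtain ⟨c, hc, hc0, hcF⟩ := ih
      set b : ℝ := m * τ with hb
      have hb0 : 0 ≤ b := by positivity
      have hbm : ((m + 1 : ℕ) : ℝ) * τ = b + τ := by rw [hb]; push_cast; ring
      have hmem : ∀ t ∈ Icc (-b) b, ‖F (c t)‖ = ‖F q‖ := fun t ht => by
        rw [hcF t ht, hρ.norm_apply]
      obtain ⟨cp, hcp, hcp0, hcpF⟩ := hlift (c b) (hmem b ⟨by linarith, le_rfl⟩)
      obtain ⟨cm, hcm, hcm0, hcmF⟩ := hlift (c (-b)) (hmem (-b) ⟨le_rfl, by linarith⟩)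
      refine ⟨fun t => if t ≤ b then (if -b ≤ t then c t else cm (t + b)) else cp (t - b),
        ?_, ?_, ?_⟩
      · refine Continuous.if_le (Continuous.if_le hc (hcm.comp (by fun_prop)) continuous_const
          continuous_id ?_) (hcp.comp (by fun_prop)) continuous_id continuous_const ?_
        · rintro t rfl
          simp [hcm0]
        · rintro t rfl
          rw [if_pos (by linarith), sub_self, hcp0]
      · simp [hb0, hc0]
      · intro t ht
        rw [hbm] at ht
        simp only
        split_ifs with h1 h2
        · exact hcF t ⟨h2, h1⟩
        · rw [hcmF (t + b) ⟨by linarith [ht.1], by linarith⟩, hcF (-b) ⟨le_rfl, by linarith⟩,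
            ← hρ.add_apply]
          congr 1; ring
        · rw [hcpF (t - b) ⟨by linarith, by linarith [ht.2]⟩, hcF b ⟨by linarith, le_rfl⟩,
            ← hρ.add_apply]
          congr 1; ring
  choose c hc hc0 hcF using hstep
  have huniq : ∀ m k : ℕ, m ≤ k → EqOn (c m) (c k) (Icc (-(m * τ)) (m * τ)) := fun m k hmk => by
    have hmk' : (m : ℝ) * τ ≤ k * τ := by gcongr
    have h0 : (0 : ℝ) ≤ m * τ := by positivity
    refine hF.eqOn_of_comp_eqOn isPreconnected_Icc (hc m).continuousOn (hc k).continuousOn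
      (fun t ht => ?_) (a := 0) ⟨by linarith, h0⟩ (by rw [hc0, hc0])
    rw [hcF m t ht, hcF k t ⟨by linarith [ht.1], by linarith [ht.2]⟩]
  let m : ℝ → ℕ := fun t => ⌈|t| / τ⌉₊
  have hm : ∀ t, t ∈ Icc (-((m t : ℕ) * τ)) ((m t : ℕ) * τ) := fun t => by
    rw [mem_Icc, ← abs_le, ← div_le_iff₀ hτ]
    exact Nat.le_ceil _
  refine ⟨fun t => c (m t) t, ?_, by simp only [hc0], fun t => hcF _ t (hm t)⟩
  rw [continuous_iff_continuousAt]
  intro t₀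
  have heq : (fun t => c (m t) t) =ᶠ[𝓝 t₀] c ⌈(|t₀| + 1) / τ⌉₊ := by
    have : ∀ᶠ t in 𝓝 t₀, |t| < |t₀| + 1 :=
      continuous_abs.continuousAt.eventually_lt continuousAt_const (by linarith)
    filter_upwards [this] with t ht
    exact huniq _ _ (Nat.ceil_mono (by gcongr)) (hm t)
  exact (hc _).continuousAt.congr heq.symm

/-- A one-parameter group of isometries whose generator is tangential along a proper hypersurface
is induced by diffeomorphisms of the hypersurface. -/
theorem IsOrientedHypersurface.exists_diffeomorph (hF : IsOrientedHypersurface F ν)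
    (hρ : IsIsometryGroup ρ R) (hR : ∀ q, inner ℝ (R (F q)) (ν q) = 0)
    (hproper : ∀ c, IsCompact {q | ‖F q‖ = c}) (t : ℝ) :
    ∃ ψ : M ≃ₘ^∞⟮𝓡 n, 𝓡 n⟯ M, ∀ q : M, F (ψ q) = ρ t (F q) := by
  choose φ hφc hφ0 hφF using hF.exists_global_lift hρ hR hproper
  have hgroup : ∀ q s t, φ (φ q t) s = φ q (s + t) := by
    intro q s t
    refine hF.eqOn_of_comp_eqOn isPreconnected_univ (c₁ := φ (φ q t)) (c₂ := fun s => φ q (s + t))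
      (hφc _).continuousOn ((hφc q).comp (by fun_prop)).continuousOn (fun s _ => ?_)
      (mem_univ 0) (by simp [hφ0]) (mem_univ s)
    rw [hφF, hφF, hφF, hρ.add_apply]
  have hlocal : ∀ q₀, ∃ (τ : ℝ) (U : Set M), 0 < τ ∧ IsOpen U ∧ q₀ ∈ U ∧
      ∀ q ∈ U, ∀ t ∈ Ioo (-τ) τ, ContMDiffAt (𝓡 n) (𝓡 n) ∞ (fun p => φ p t) q := by
    intro q₀
    obtain ⟨τ, U, Ψ, hτ, hU, hqU, hΨ⟩ := hF.exists_local_lift hρ hR q₀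
    refine ⟨τ, U, hτ, hU, hqU, fun q hq t ht => ?_⟩
    refine ((hΨ q hq).2.2 t ht).2.congr_of_eventuallyEq ?_
    filter_upwards [hU.mem_nhds hq] with p hp
    obtain ⟨h0, hc, hΨF⟩ := hΨ p hp
    exact hF.eqOn_of_comp_eqOn isPreconnected_Ioo (hφc p).continuousOn hc
      (fun s hs => by rw [hφF, (hΨF s hs).1]) (a := 0) ⟨by linarith, hτ⟩ (by rw [hφ0, h0]) ht
  have hsmooth : ∀ t, ContMDiff (𝓡 n) (𝓡 n) ∞ (fun p => φ p t) := by
    intro t q₀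
    let S : Set ℝ := {t | ContMDiffAt (𝓡 n) (𝓡 n) ∞ (fun p => φ p t) q₀}
    -- being smooth at `q₀` is a property of `t` which is locally constant
    have hloc : ∀ t₀, ∀ᶠ s in 𝓝 t₀, (s ∈ S ↔ t₀ ∈ S) := by
      intro t₀
      obtain ⟨τ, U, hτ, hU, hqU, hsm⟩ := hlocal (φ q₀ t₀)
      have h1 : ∀ᶠ s in 𝓝 t₀, φ q₀ s ∈ U := (hφc q₀).continuousAt.eventually (hU.mem_nhds hqU)
      have hstep : ∀ s s', φ q₀ s ∈ U → |s' - s| < τ → s ∈ S → s' ∈ S := by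
        intro s s' hs hss' hsS
        have h2 : (fun p => φ p s') = (fun p => φ p (s' - s)) ∘ fun p => φ p s := by
          funext p
          simp only [Function.comp_apply, hgroup, sub_add_cancel]
        change ContMDiffAt (𝓡 n) (𝓡 n) ∞ (fun p => φ p s') q₀
        rw [h2]
        exact ContMDiffAt.comp q₀ (hsm _ hs _ (abs_lt.1 hss')) hsS
      filter_upwards [h1, Metric.ball_mem_nhds t₀ hτ] with s hs hst
      rw [Metric.mem_ball, Real.dist_eq] at hst
      exact ⟨hstep s t₀ hs (by rwa [abs_sub_comm]), hstep t₀ s hqU hst⟩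
    have hclopen : IsClopen S := by
      refine ⟨⟨isOpen_iff_mem_nhds.2 fun t₀ ht₀ => ?_⟩, isOpen_iff_mem_nhds.2 fun t₀ ht₀ => ?_⟩
      · filter_upwards [hloc t₀] with s hs
        exact fun h => ht₀ (hs.1 h)
      · filter_upwards [hloc t₀] with s hs
        exact hs.2 ht₀
    have h0 : (0 : ℝ) ∈ S := by
      change ContMDiffAt (𝓡 n) (𝓡 n) ∞ (fun p => φ p 0) q₀
      have : (fun p => φ p 0) = id := funext hφ0
      rw [this]
      exact contMDiffAt_id
    have h : t ∈ S := by
      rw [hclopen.eq_univ ⟨0, h0⟩]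
      exact mem_univ t
    exact h
  exact ⟨{ toFun := fun p => φ p t
           invFun := fun p => φ p (-t)
           left_inv := fun p => by simp only [hgroup, neg_add_cancel, hφ0]
           right_inv := fun p => by simp only [hgroup, add_neg_cancel, hφ0]
           contMDiff_toFun := hsmooth t
           contMDiff_invFun := hsmooth (-t) }, fun q => hφF q t⟩

end RotationLift

/-! ### Rotations in planes orthogonal to the axis -/

noncomputable section PlaneRotations

variable {V : Type*} [NormedAddCommGroup V] [InnerProductSpace ℝ V]

/-- The infinitesimal rotation in the oriented plane spanned by the orthonormal vectors `p`, `s`. -/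
def rotationGenerator (p s : V) : V →L[ℝ] V :=
  (innerSL ℝ p).smulRight s - (innerSL ℝ s).smulRight p

/-- The rotation by the angle `t` in the oriented plane spanned by the orthonormal vectors `p`, `s`;
it fixes the orthogonal complement of the plane. -/
def planeRotation (p s : V) (t : ℝ) : V →L[ℝ] V :=
  ContinuousLinearMap.id ℝ V +
    (Real.cos t - 1) • ((innerSL ℝ p).smulRight p + (innerSL ℝ s).smulRight s)
    + Real.sin t • rotationGenerator p s

lemma rotationGenerator_apply (p s z : V) :
    rotationGenerator p s z = (inner ℝ p z : ℝ) • s - (inner ℝ s z : ℝ) • p := by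
  simp [rotationGenerator]

lemma inner_rotationGenerator_self (p s z : V) : inner ℝ (rotationGenerator p s z) z = 0 := by
  rw [rotationGenerator_apply, inner_sub_left, inner_smul_left, inner_smul_left]
  simp only [conj_trivial]; ring

lemma planeRotation_apply (p s : V) (t : ℝ) (z : V) :
    planeRotation p s t z = z + (Real.cos t - 1) • ((inner ℝ p z : ℝ) • p + (inner ℝ s z : ℝ) • s)
      + Real.sin t • ((inner ℝ p z : ℝ) • s - (inner ℝ s z : ℝ) • p) := by
  simp [planeRotation, rotationGenerator]

lemma planeRotation_apply_of_orthogonal {p s z : V} (hp : inner ℝ p z = (0 : ℝ))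
    (hs : inner ℝ s z = (0 : ℝ)) (t : ℝ) : planeRotation p s t z = z := by
  simp [planeRotation_apply, hp, hs]

lemma rotationGenerator_apply_of_orthogonal {p s z : V} (hp : inner ℝ p z = (0 : ℝ))
    (hs : inner ℝ s z = (0 : ℝ)) : rotationGenerator p s z = 0 := by
  simp [rotationGenerator_apply, hp, hs]

variable {p s : V}

lemma inner_planeRotation_left (hp : ‖p‖ = 1) (hps : inner ℝ p s = (0 : ℝ)) (t : ℝ)
    (z : V) : inner ℝ p (planeRotation p s t z) =
    Real.cos t * inner ℝ p z - Real.sin t * inner ℝ s z := by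
  simp only [planeRotation_apply, inner_add_right, inner_sub_right, inner_smul_right, hps,
    real_inner_self_eq_norm_sq, hp]
  ring

lemma inner_planeRotation_right (hs : ‖s‖ = 1) (hps : inner ℝ p s = (0 : ℝ)) (t : ℝ)
    (z : V) : inner ℝ s (planeRotation p s t z) =
    Real.sin t * inner ℝ p z + Real.cos t * inner ℝ s z := by
  have hsp : inner ℝ s p = (0 : ℝ) := by rw [real_inner_comm, hps]
  simp only [planeRotation_apply, inner_add_right, inner_sub_right, inner_smul_right, hsp,
    real_inner_self_eq_norm_sq, hs]
  ring

lemma norm_planeRotation (hp : ‖p‖ = 1) (hs : ‖s‖ = 1)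
    (hps : inner ℝ p s = (0 : ℝ)) (t : ℝ) (z : V) : ‖planeRotation p s t z‖ = ‖z‖ := by
  have hsp : inner ℝ s p = (0 : ℝ) := by rw [real_inner_comm, hps]
  rw [← sq_eq_sq₀ (norm_nonneg _) (norm_nonneg _), ← real_inner_self_eq_norm_sq]
  nth_rewrite 1 [planeRotation_apply]
  simp only [inner_add_left, inner_sub_left, inner_smul_left, conj_trivial,
    inner_planeRotation_left hp hps, inner_planeRotation_right hs hps]
  rw [planeRotation_apply]
  simp only [inner_add_right, inner_sub_right, inner_smul_right, real_inner_self_eq_norm_sq,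
    real_inner_comm p z, real_inner_comm s z]
  linear_combination (inner ℝ p z ^ 2 + inner ℝ s z ^ 2) * Real.sin_sq_add_cos_sq t

lemma planeRotation_add (hp : ‖p‖ = 1) (hs : ‖s‖ = 1)
    (hps : inner ℝ p s = (0 : ℝ)) (t u : ℝ) (z : V) :
    planeRotation p s (t + u) z = planeRotation p s t (planeRotation p s u z) := by
  rw [planeRotation_apply p s t, inner_planeRotation_left hp hps,
    inner_planeRotation_right hs hps, planeRotation_apply, planeRotation_apply, Real.cos_add,
    Real.sin_add]
  module

lemma isIsometryGroup_planeRotation (hp : ‖p‖ = 1) (hs : ‖s‖ = 1)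
    (hps : inner ℝ p s = (0 : ℝ)) :
    IsIsometryGroup (fun t => planeRotation p s t) (rotationGenerator p s) where
  zero_apply z := by simp [planeRotation_apply]
  add_apply := planeRotation_add hp hs hps
  norm_apply := norm_planeRotation hp hs hps
  hasDerivAt t z := by
    have h1 := ((Real.hasDerivAt_cos t).sub_const 1).smul_const
      ((inner ℝ p z : ℝ) • p + (inner ℝ s z : ℝ) • s)
    have h2 := (Real.hasDerivAt_sin t).smul_const
      ((inner ℝ p z : ℝ) • s - (inner ℝ s z : ℝ) • p)
    have h3 := (h1.const_add z).add h2
    refine (h3.congr_of_eventuallyEq (Eventually.of_forall fun u => planeRotation_apply p s u z)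
      ).congr_deriv ?_
    rw [rotationGenerator_apply, inner_planeRotation_left hp hps,
      inner_planeRotation_right hs hps]
    module
  continuous := by
    simp only [planeRotation_apply]
    fun_prop
  contDiff t := (planeRotation p s t).contDiff

lemma det_planeRotation [FiniteDimensional ℝ V] (hp : ‖p‖ = 1) (hs : ‖s‖ = 1)
    (hps : inner ℝ p s = (0 : ℝ)) (t : ℝ) :
    LinearMap.det (planeRotation p s t : V →ₗ[ℝ] V) = 1 := by
  have h1 : (planeRotation p s t : V →ₗ[ℝ] V) =
      (planeRotation p s (t / 2) : V →ₗ[ℝ] V) ∘ₗ (planeRotation p s (t / 2) : V →ₗ[ℝ] V) := by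
    ext z
    simp [← planeRotation_add hp hs hps]
  have h2 : ‖LinearMap.det (planeRotation p s (t / 2) : V →ₗ[ℝ] V)‖ = 1 := by
    have := LinearIsometry.normDet_eq_one
      (⟨(planeRotation p s (t / 2) : V →ₗ[ℝ] V), norm_planeRotation hp hs hps _⟩ : V →ₗᵢ[ℝ] V)
    rwa [LinearMap.normDet_eq_norm_det] at this
  rw [h1, LinearMap.det_comp, ← sq, ← sq_abs, ← Real.norm_eq_abs, h2, one_pow]

open Module in
/-- The rotations about the axis `e` are generated by the rotations in planes orthogonal to `e`.
As in the theorem of Cartan and Dieudonné, each factor enlarges the fixed subspace. -/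
theorem rotation_induction [FiniteDimensional ℝ V] {e : V} {P : (V →ₗ[ℝ] V) → Prop}
    (hid : P LinearMap.id)
    (hmul : ∀ (p s : V) (t : ℝ) (L : V →ₗ[ℝ] V), ‖p‖ = 1 → ‖s‖ = 1 → inner ℝ p s = (0 : ℝ) →
      inner ℝ p e = (0 : ℝ) → inner ℝ s e = (0 : ℝ) → P L →
      P ((planeRotation p s t : V →ₗ[ℝ] V) ∘ₗ L))
    (L : V →ₗ[ℝ] V) (hL : ∀ z, ‖L z‖ = ‖z‖) (hLe : L e = e) (hdet : LinearMap.det L = 1) : P L := by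
  obtain ⟨k, hk⟩ : ∃ k, finrank ℝ (LinearMap.ker (LinearMap.id - L))ᗮ ≤ k := ⟨_, le_rfl⟩
  induction k generalizing L with
  | zero =>
    have h1 : LinearMap.ker (LinearMap.id - L) = ⊤ := by
      rwa [Nat.le_zero, Submodule.finrank_eq_zero, Submodule.orthogonal_eq_bot_iff] at hk
    have h2 : L = LinearMap.id := by
      rw [LinearMap.ker_eq_top, sub_eq_zero] at h1
      exact h1.symm
    rwa [h2]
  | succ k IH =>
    obtain ⟨W, hWdef⟩ : ∃ W, W = LinearMap.ker (LinearMap.id - L) := ⟨_, rfl⟩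
    have hW : ∀ w, w ∈ W ↔ L w = w := fun w => by
      rw [hWdef, LinearMap.mem_ker, LinearMap.sub_apply, LinearMap.id_apply, sub_eq_zero, eq_comm]
    rw [← hWdef] at hk
    by_cases hk' : finrank ℝ Wᗮ ≤ k
    · exact IH L hL hLe hdet (hWdef ▸ hk')
    have hinner : ∀ x y, inner ℝ (L x) (L y) = (inner ℝ x y : ℝ) :=
      (⟨L, hL⟩ : V →ₗᵢ[ℝ] V).inner_map_map
    have : Nontrivial Wᗮ := nontrivial_of_finrank_pos (by lia : 0 < finrank ℝ Wᗮ)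
    obtain ⟨v, hv⟩ := exists_norm_eq Wᗮ (zero_le_one (α := ℝ))
    obtain ⟨v, hvW⟩ := v
    have hv1 : ‖v‖ = 1 := hv
    have hLv : L v ∈ Wᗮ := fun w hw => by
      rw [← (hW w).1 hw, hinner]; exact hvW w hw
    have hv' : v ∉ W := fun h => by
      have : (inner ℝ v v : ℝ) = 0 := hvW v h
      rw [real_inner_self_eq_norm_sq, hv1] at this
      norm_num at this
    -- `L v` arises from `v` by a rotation in a plane spanned by `v` and a vector `q` in `Wᗮ`
    obtain ⟨q, θ, hq, hq1, hvq, hLvq⟩ : ∃ (q : V) (θ : ℝ), q ∈ Wᗮ ∧ ‖q‖ = 1 ∧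
        inner ℝ v q = (0 : ℝ) ∧ L v = Real.cos θ • v + Real.sin θ • q := by
      obtain ⟨c, hc⟩ : ∃ c : ℝ, c = inner ℝ v (L v) := ⟨_, rfl⟩
      obtain ⟨d, hd⟩ : ∃ d, d = L v - c • v := ⟨_, rfl⟩
      have hdW : d ∈ Wᗮ := hd ▸ Submodule.sub_mem _ hLv (Submodule.smul_mem _ _ hvW)
      have hvd : inner ℝ v d = (0 : ℝ) := by
        rw [hd, inner_sub_right, inner_smul_right, real_inner_self_eq_norm_sq, hv1, ← hc]; ring
      have hdn : ‖d‖ ^ 2 = 1 - c ^ 2 := by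
        have : L v = d + c • v := by rw [hd]; abel
        have h2 := hL v
        rw [this] at h2
        have h3 := norm_add_sq_real d (c • v)
        rw [h2, inner_smul_right, real_inner_comm, hvd, norm_smul, hv1, mul_one, Real.norm_eq_abs,
          sq_abs] at h3
        linarith
      by_cases hd0 : d = 0
      · have hLc : L v = c • v := by rw [← sub_eq_zero, ← hd, hd0]
        have hc1 : c = -1 := by
          rw [hd0, norm_zero] at hdn
          have : (c - 1) * (c + 1) = 0 := by linarith
          rcases mul_eq_zero.1 this with h | h
          · exact absurd ((hW v).2 (by rw [hLc, sub_eq_zero.1 h, one_smul])) hv'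
          · linarith
        by_cases hex : ∃ q ∈ Wᗮ, ‖q‖ = 1 ∧ inner ℝ v q = (0 : ℝ)
        · obtain ⟨q, h1, h2, h3⟩ := hex
          exact ⟨q, Real.pi, h1, h2, h3, by rw [hLc, hc1]; simp⟩
        -- otherwise `L` is the reflection in the hyperplane orthogonal to `v`
        exfalso
        have hWv : ∀ z ∈ (ℝ ∙ v)ᗮ, z ∈ W := by
          intro z hz
          rw [Submodule.mem_orthogonal_singleton_iff_inner_right] at hz
          obtain ⟨x, hx, y, hy, rfl⟩ := W.exists_add_mem_mem_orthogonal z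
          have hy0 : y = 0 := by
            by_contra hy0
            refine hex ⟨(‖y‖⁻¹ : ℝ) • y, Submodule.smul_mem _ _ hy, ?_, ?_⟩
            · rw [norm_smul, norm_inv, norm_norm, inv_mul_cancel₀ (norm_ne_zero_iff.2 hy0)]
            · have : inner ℝ v x = (0 : ℝ) := by rw [real_inner_comm]; exact hvW x hx
              rw [inner_add_right, this, zero_add] at hz
              rw [inner_smul_right, hz, mul_zero]
          rwa [hy0, add_zero]
        have hrefl : L = ((ℝ ∙ v)ᗮ.reflection.toLinearMap) := by
          ext z
          obtain ⟨x, hx, y, hy, rfl⟩ := (ℝ ∙ v)ᗮ.exists_add_mem_mem_orthogonal z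
          rw [Submodule.orthogonal_orthogonal] at hy
          obtain ⟨a, rfl⟩ := Submodule.mem_span_singleton.1 hy
          have h1 : (ℝ ∙ v)ᗮ.reflection x = x := Submodule.reflection_mem_subspace_eq_self hx
          have h2 : (ℝ ∙ v)ᗮ.reflection v = -v :=
            Submodule.reflection_orthogonalComplement_singleton_eq_neg v
          rw [map_add, (hW x).1 (hWv x hx), map_smul, hLc, hc1]
          change _ = (ℝ ∙ v)ᗮ.reflection (x + a • v)
          rw [map_add, map_smul, h1, h2]
          simp
        have hv0 : v ≠ 0 := fun h => by simp [h] at hv1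
        rw [hrefl, Submodule.det_reflection, Submodule.orthogonal_orthogonal,
          finrank_span_singleton hv0] at hdet
        norm_num at hdet
      · have hdpos : 0 < ‖d‖ := norm_pos_iff.2 hd0
        have hc2 : c ^ 2 ≤ 1 := by nlinarith
        have hc3 := abs_le.1 (abs_le_one_iff_mul_self_le_one.2 (by nlinarith : c * c ≤ 1))
        refine ⟨‖d‖⁻¹ • d, Real.arccos c, Submodule.smul_mem _ _ hdW, ?_, ?_, ?_⟩
        · rw [norm_smul, norm_inv, norm_norm, inv_mul_cancel₀ hdpos.ne']
        · rw [inner_smul_right, hvd, mul_zero]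
        · rw [Real.cos_arccos hc3.1 hc3.2, Real.sin_arccos, ← hdn, Real.sqrt_sq hdpos.le, smul_smul,
            mul_inv_cancel₀ hdpos.ne', one_smul, hd]
          abel
    have heW : e ∈ W := (hW e).2 hLe
    have hWv : ∀ w ∈ W, inner ℝ v w = (0 : ℝ) := fun w hw => by
      rw [real_inner_comm]; exact hvW w hw
    have hWq : ∀ w ∈ W, inner ℝ q w = (0 : ℝ) := fun w hw => by
      rw [real_inner_comm]; exact hq w hw
    have hback : L = (planeRotation v q θ : V →ₗ[ℝ] V) ∘ₗ
        ((planeRotation v q (-θ) : V →ₗ[ℝ] V) ∘ₗ L) := by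
      ext z
      have := planeRotation_add hv1 hq1 hvq θ (-θ) (L z)
      rw [add_neg_cancel, (isIsometryGroup_planeRotation hv1 hq1 hvq).zero_apply] at this
      exact this
    rw [hback]
    refine hmul v q θ _ hv1 hq1 hvq (hWv e heW) (hWq e heW) (IH _ (fun z => ?_) ?_ ?_ ?_)
    · exact (norm_planeRotation hv1 hq1 hvq _ _).trans (hL z)
    · change planeRotation v q (-θ) (L e) = e
      rw [hLe, planeRotation_apply_of_orthogonal (hWv e heW) (hWq e heW)]
    · rw [LinearMap.det_comp, det_planeRotation hv1 hq1 hvq, hdet, one_mul]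
    · obtain ⟨W', hW'def⟩ : ∃ W', W' = LinearMap.ker (LinearMap.id -
        ((planeRotation v q (-θ) : V →ₗ[ℝ] V) ∘ₗ L)) := ⟨_, rfl⟩
      have hW' : ∀ w, w ∈ W' ↔ planeRotation v q (-θ) (L w) = w := fun w => by
        rw [hW'def, LinearMap.mem_ker, LinearMap.sub_apply, LinearMap.id_apply, sub_eq_zero,
          eq_comm]
        rfl
      rw [← hW'def]
      have hle : W ≤ W' := fun w hw => (hW' w).2 (by
        rw [(hW w).1 hw, planeRotation_apply_of_orthogonal (hWv w hw) (hWq w hw)])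
      have hvW' : v ∈ W' := by
        rw [hW']
        have h1 : L v = planeRotation v q θ v := by
          rw [hLvq, planeRotation_apply, real_inner_self_eq_norm_sq, hv1, real_inner_comm v q, hvq]
          module
        rw [h1, ← planeRotation_add hv1 hq1 hvq, neg_add_cancel,
          (isIsometryGroup_planeRotation hv1 hq1 hvq).zero_apply]
      have h1 : finrank ℝ W + 1 ≤ finrank ℝ W' := Submodule.finrank_lt_finrank_of_lt
        ((SetLike.lt_iff_le_and_exists (B := V)).2 ⟨hle, v, hvW', hv'⟩)
      have h2 := W.finrank_add_finrank_orthogonal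
      have h3 := W'.finrank_add_finrank_orthogonal
      lia

end PlaneRotations

/-! ### From tangential rotations to rotational symmetry -/

section Symmetry

variable {n : ℕ} {M : Type*} [TopologicalSpace M] [ChartedSpace (Euc n) M]
  {F ν : M → Euc (n + 1)} {e : Euc (n + 1)}

/-- Every rotation about the axis is induced by a diffeomorphism as soon as this holds for the
rotations in planes orthogonal to the axis. -/
lemma exists_diffeomorph_of_planeRotation
    (h : ∀ (p s : Euc (n + 1)) (t : ℝ), ‖p‖ = 1 → ‖s‖ = 1 → inner ℝ p s = (0 : ℝ) →
      inner ℝ p e = (0 : ℝ) → inner ℝ s e = (0 : ℝ) →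
      ∃ ψ : M ≃ₘ^∞⟮𝓡 n, 𝓡 n⟯ M, ∀ q : M, F (ψ q) = planeRotation p s t (F q))
    (g : Euc (n + 1) ≃ₗᵢ[ℝ] Euc (n + 1)) (hge : g e = e)
    (hdet : LinearMap.det (g.toLinearEquiv : Euc (n + 1) →ₗ[ℝ] Euc (n + 1)) = 1) :
    ∃ ψ : M ≃ₘ^∞⟮𝓡 n, 𝓡 n⟯ M, ∀ q : M, F (ψ q) = g (F q) := by
  refine rotation_induction (e := e)
    (P := fun L => ∃ ψ : M ≃ₘ^∞⟮𝓡 n, 𝓡 n⟯ M, ∀ q : M, F (ψ q) = L (F q))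
    ⟨Diffeomorph.refl (𝓡 n) M ∞, fun q => rfl⟩ ?_
    (g.toLinearEquiv : Euc (n + 1) →ₗ[ℝ] Euc (n + 1)) g.norm_map hge hdet
  rintro p s t L hp hs hps hpe hse ⟨ψ, hψ⟩
  obtain ⟨ψ', hψ'⟩ := h p s t hp hs hps hpe hse
  refine ⟨ψ.trans ψ', fun q => ?_⟩
  change F (ψ' (ψ q)) = planeRotation p s t (L (F q))
  rw [hψ', hψ]

/-- For `n ≥ 2` the invariance under rotations implies the invariance of the image under all
isometries fixing the axis, since each point is fixed by a reflection fixing the axis. -/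
lemma isRotationallySymmetric_of_planeRotation (hn : 2 ≤ n)
    (h : ∀ (p s : Euc (n + 1)) (t : ℝ), ‖p‖ = 1 → ‖s‖ = 1 → inner ℝ p s = (0 : ℝ) →
      inner ℝ p e = (0 : ℝ) → inner ℝ s e = (0 : ℝ) →
      ∃ ψ : M ≃ₘ^∞⟮𝓡 n, 𝓡 n⟯ M, ∀ q : M, F (ψ q) = planeRotation p s t (F q)) :
    IsRotationallySymmetric F e := by
  have hmem : ∀ g : Euc (n + 1) ≃ₗᵢ[ℝ] Euc (n + 1), g e = e → ∀ q, g (F q) ∈ range F := by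
    intro g hge q
    have habs : |LinearMap.det (g.toLinearEquiv : Euc (n + 1) →ₗ[ℝ] Euc (n + 1))| = 1 := by
      have := LinearIsometry.normDet_eq_one g.toLinearIsometry
      rw [LinearMap.normDet_eq_norm_det] at this
      exact this
    rcases (abs_eq zero_le_one).1 habs with hdet | hdet
    · obtain ⟨ψ, hψ⟩ := exists_diffeomorph_of_planeRotation h g hge hdet
      exact ⟨ψ q, hψ q⟩
    · obtain ⟨p, hp0, hpe, hpF⟩ : ∃ p : Euc (n + 1), p ≠ 0 ∧ inner ℝ p e = (0 : ℝ) ∧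
          inner ℝ p (F q) = (0 : ℝ) := by
        have h1 : Module.finrank ℝ (Submodule.span ℝ {e, F q}) ≤ 2 := by
          classical
          have := finrank_span_finset_le_card (R := ℝ) {e, F q}
          rw [Finset.coe_insert, Finset.coe_singleton] at this
          exact this.trans Finset.card_le_two
        have h2 := (Submodule.span ℝ {e, F q}).finrank_add_finrank_orthogonal
        rw [finrank_euclideanSpace_fin] at h2
        have h3 : 0 < Module.finrank ℝ (Submodule.span ℝ {e, F q})ᗮ := by
          by_contra h0
          rw [Nat.eq_zero_of_not_pos h0] at h2
          lia
        have := Module.nontrivial_of_finrank_pos (R := ℝ) h3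
        obtain ⟨⟨p, hp⟩, hp0⟩ := exists_ne (0 : (Submodule.span ℝ {e, F q})ᗮ)
        rw [Submodule.mem_orthogonal'] at hp
        exact ⟨p, fun h => hp0 (Subtype.ext h), hp e (Submodule.subset_span (by simp)),
          hp (F q) (Submodule.subset_span (by simp))⟩
      have hfix : ∀ z, inner ℝ p z = (0 : ℝ) → (ℝ ∙ p)ᗮ.reflection z = z := fun z hz =>
        Submodule.reflection_mem_subspace_eq_self
          (Submodule.mem_orthogonal_singleton_iff_inner_right.2 hz)
      obtain ⟨ψ, hψ⟩ := exists_diffeomorph_of_planeRotation h ((ℝ ∙ p)ᗮ.reflection.trans g)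
        (by rw [LinearIsometryEquiv.trans_apply, hfix e hpe, hge]) (by
          have h1 : (((ℝ ∙ p)ᗮ.reflection.trans g).toLinearEquiv :
              Euc (n + 1) →ₗ[ℝ] Euc (n + 1)) =
              (g.toLinearEquiv : Euc (n + 1) →ₗ[ℝ] Euc (n + 1)) ∘ₗ
                (ℝ ∙ p)ᗮ.reflection.toLinearMap := rfl
          rw [h1, LinearMap.det_comp, hdet, Submodule.det_reflection,
            Submodule.orthogonal_orthogonal, finrank_span_singleton hp0]
          norm_num)
      exact ⟨ψ q, by rw [hψ, LinearIsometryEquiv.trans_apply, hfix _ hpF]⟩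
  refine ⟨fun g hge => ?_, fun g hge hdet => exists_diffeomorph_of_planeRotation h g hge hdet⟩
  apply Subset.antisymm
  · rintro _ ⟨_, ⟨q, rfl⟩, rfl⟩
    exact hmem g hge q
  · rintro _ ⟨q, rfl⟩
    refine ⟨g.symm (F q), hmem g.symm ?_ q, g.apply_symm_apply _⟩
    rw [LinearIsometryEquiv.symm_apply_eq, hge]

/-- The symmetry result, reduced to the behaviour of the self-expander outside of compact sets. For
the lifting of rotations it is enough that the preimages of spheres are compact. -/
theorem IsOrientedHypersurface.isRotationallySymmetric [IsManifold (𝓡 n) ∞ M] [T2Space M]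
    (hn : 2 ≤ n)
    (hF : IsOrientedHypersurface F ν) (hE : IsSelfExpander F ν) (hH : IsMeanConvex F ν)
    (hA : ∀ᶠ q in cocompact M, ∀ κ, IsPrincipalCurvatures F ν q κ → ∑ i, κ i ^ 2 ≤ 1 / 2)
    (hproper : ∀ c, IsCompact {q | ‖F q‖ = c})
    (hf : ∀ p s : Euc (n + 1), inner ℝ p e = (0 : ℝ) → inner ℝ s e = (0 : ℝ) →
      Tendsto (fun q => inner ℝ (rotationGenerator p s (F q)) (ν q)) (cocompact M) (𝓝 0)) :
    IsRotationallySymmetric F e :=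
  isRotationallySymmetric_of_planeRotation hn fun _ _ t hp hs hps hpe hse =>
    hF.exists_diffeomorph (isIsometryGroup_planeRotation hp hs hps)
      (hF.inner_rotation_eq_zero hE hH hA (inner_rotationGenerator_self _ _) (hf _ _ hpe hse))
      hproper t

end Symmetry

/-! ### Homogeneous functions and their derivatives -/

section Homogeneous

variable {V W : Type*} [NormedAddCommGroup V] [NormedSpace ℝ V] [FiniteDimensional ℝ V]
  [NormedAddCommGroup W] [NormedSpace ℝ W]

lemma exists_norm_le_of_homogeneous {f : V → W} {d : ℤ} (hf : ContinuousOn f {0}ᶜ)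
    (hom : ∀ t : ℝ, 0 < t → ∀ y, f (t • y) = t ^ d • f y) :
    ∃ K : ℝ, 0 ≤ K ∧ ∀ y, y ≠ 0 → ‖f y‖ ≤ K * ‖y‖ ^ d := by
  obtain ⟨K, hK⟩ := (isCompact_sphere (0 : V) 1).exists_bound_of_continuousOn
    (hf.mono fun y hy => by
      rw [mem_compl_singleton_iff, ← norm_ne_zero_iff, mem_sphere_zero_iff_norm.1 hy]
      exact one_ne_zero)
  refine ⟨max K 0, le_max_right _ _, fun y hy => ?_⟩
  have hy0 : 0 < ‖y‖ := norm_pos_iff.2 hy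
  have h1 : y = ‖y‖ • (‖y‖⁻¹ • y) := by rw [smul_smul, mul_inv_cancel₀ hy0.ne', one_smul]
  have h2 : ‖‖y‖⁻¹ • y‖ = 1 := by rw [norm_smul, norm_inv, norm_norm, inv_mul_cancel₀ hy0.ne']
  have h3 := hK _ (mem_sphere_zero_iff_norm.2 h2)
  calc ‖f y‖ = ‖y‖ ^ d * ‖f (‖y‖⁻¹ • y)‖ := by
        rw [← abs_of_pos (zpow_pos hy0 d), ← Real.norm_eq_abs, ← norm_smul, ← hom _ hy0, ← h1]
    _ ≤ ‖y‖ ^ d * max K 0 := by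
        gcongr
        exact h3.trans (le_max_left _ _)
    _ = max K 0 * ‖y‖ ^ d := mul_comm _ _

omit [FiniteDimensional ℝ V] in
lemma fderiv_homogeneous {f : V → W} {d : ℤ}
    (hom : ∀ t : ℝ, 0 < t → ∀ y, f (t • y) = t ^ d • f y) {t : ℝ} (ht : 0 < t) (y : V) :
    fderiv ℝ f (t • y) = t ^ (d - 1) • fderiv ℝ f y := by
  have h1 := fderiv_comp_smul (𝕜 := ℝ) (f := f) (x := y) t
  rw [show (fun x => f (t • x)) = fun x => t ^ d • f x from funext (hom t ht)] at h1
  have h2 : fderiv ℝ (fun x => t ^ d • f x) y = t ^ d • fderiv ℝ f y := by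
    have := congrFun (fderiv_const_smul_field (𝕜 := ℝ) (f := f) (t ^ d)) y
    exact this
  rw [h2] at h1
  rw [zpow_sub_one₀ ht.ne', mul_comm, mul_smul, h1, smul_smul, inv_mul_cancel₀ ht.ne', one_smul]

/-- The derivatives of a function which is homogeneous of degree `d` decay like its degree. -/
lemma exists_norm_fderiv_le_of_homogeneous {f : V → W} {d : ℤ} (hf : ContDiffOn ℝ 2 f {0}ᶜ)
    (hom : ∀ t : ℝ, 0 < t → ∀ y, f (t • y) = t ^ d • f y) :
    ∃ K : ℝ, 0 ≤ K ∧ ∀ y, y ≠ 0 → ‖f y‖ ≤ K * ‖y‖ ^ d ∧ ‖fderiv ℝ f y‖ ≤ K * ‖y‖ ^ (d - 1) ∧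
      ‖fderiv ℝ (fderiv ℝ f) y‖ ≤ K * ‖y‖ ^ (d - 2) := by
  have ho : IsOpen ({0}ᶜ : Set V) := isOpen_compl_singleton
  have hom1 : ∀ t : ℝ, 0 < t → ∀ y, fderiv ℝ f (t • y) = t ^ (d - 1) • fderiv ℝ f y :=
    fun t ht y => fderiv_homogeneous hom ht y
  have hom2 : ∀ t : ℝ, 0 < t → ∀ y,
      fderiv ℝ (fderiv ℝ f) (t • y) = t ^ (d - 1 - 1) • fderiv ℝ (fderiv ℝ f) y :=
    fun t ht y => fderiv_homogeneous hom1 ht y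
  have h1 : ContDiffOn ℝ 1 (fderiv ℝ f) {0}ᶜ := hf.fderiv_of_isOpen ho (by norm_num)
  have h2 : ContinuousOn (fderiv ℝ (fderiv ℝ f)) {0}ᶜ :=
    h1.continuousOn_fderiv_of_isOpen ho le_rfl
  obtain ⟨K₀, hK₀, h0⟩ := exists_norm_le_of_homogeneous hf.continuousOn hom
  obtain ⟨K₁, hK₁, h1⟩ := exists_norm_le_of_homogeneous (f := fderiv ℝ f) h1.continuousOn hom1
  obtain ⟨K₂, hK₂, h2⟩ := exists_norm_le_of_homogeneous (f := fderiv ℝ (fderiv ℝ f)) h2 hom2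
  refine ⟨K₀ + K₁ + K₂, by positivity, fun y hy => ⟨(h0 y hy).trans ?_, (h1 y hy).trans ?_, ?_⟩⟩
  · gcongr; linarith
  · gcongr; linarith
  · rw [show d - 2 = d - 1 - 1 by ring]
    refine (h2 y hy).trans ?_
    gcongr; linarith

end Homogeneous

/-! ### The coordinates of the round cone -/

noncomputable section Cone

variable {n : ℕ} {e : Euc (n + 1)} {α : ℝ} {J : Euc n →ₗᵢ[ℝ] Euc (n + 1)}

/-- The unit normal of the round cone in the coordinates of `conePatch`. -/
def conePatchNormal (e : Euc (n + 1)) (α : ℝ) (J : Euc n →ₗᵢ[ℝ] Euc (n + 1)) (y : Euc n) :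
    Euc (n + 1) :=
  Real.sin α • e - (Real.cos α * ‖y‖⁻¹) • J y

lemma conePatch_smul {t : ℝ} (ht : 0 < t) (y : Euc n) :
    conePatch e α J (t • y) = t • conePatch e α J y := by
  rw [conePatch, conePatch, map_smul, norm_smul, Real.norm_of_nonneg ht.le]
  module

lemma conePatchNormal_smul {t : ℝ} (ht : 0 < t) (y : Euc n) :
    conePatchNormal e α J (t • y) = conePatchNormal e α J y := by
  rw [conePatchNormal, conePatchNormal, map_smul, norm_smul, Real.norm_of_nonneg ht.le, smul_smul,
    mul_inv, mul_assoc, mul_assoc, mul_comm ‖y‖⁻¹ t, inv_mul_cancel_left₀ ht.ne']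

lemma contDiffOn_conePatch {k : ℕ∞ω} : ContDiffOn ℝ k (conePatch e α J) {0}ᶜ := by
  intro y hy
  have h1 : ContDiffAt ℝ k (fun y : Euc n => ‖y‖) y := contDiffAt_norm ℝ hy
  have h2 : ContDiffAt ℝ k (fun y => J y) y := J.toContinuousLinearMap.contDiff.contDiffAt
  exact (h2.add ((contDiffAt_const.mul h1).smul contDiffAt_const)).contDiffWithinAt

lemma contDiffOn_conePatchNormal {k : ℕ∞ω} : ContDiffOn ℝ k (conePatchNormal e α J) {0}ᶜ := by
  intro y hy
  have h1 : ContDiffAt ℝ k (fun y : Euc n => ‖y‖⁻¹) y :=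
    (contDiffAt_norm ℝ hy).inv (norm_ne_zero_iff.2 hy)
  have h2 : ContDiffAt ℝ k (fun y => J y) y := J.toContinuousLinearMap.contDiff.contDiffAt
  exact (contDiffAt_const.sub ((contDiffAt_const.mul h1).smul h2)).contDiffWithinAt

lemma hasFDerivAt_norm_euc {y : Euc n} (hy : y ≠ 0) :
    HasFDerivAt (fun y : Euc n => ‖y‖) (‖y‖⁻¹ • innerSL ℝ y) y := by
  have h1 := (hasStrictFDerivAt_norm_sq y).hasFDerivAt.sqrt (by simpa using hy)
  have h2 : (fun y : Euc n => √(‖y‖ ^ 2)) = fun y => ‖y‖ :=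
    funext fun y => Real.sqrt_sq (norm_nonneg y)
  rw [h2, Real.sqrt_sq (norm_nonneg y)] at h1
  refine h1.congr_fderiv ?_
  have hy0 : ‖y‖ ≠ 0 := norm_ne_zero_iff.2 hy
  ext v
  simp only [smul_apply, innerSL_apply_apply, smul_eq_mul, nsmul_eq_mul]
  field_simp
  norm_num

lemma hasFDerivAt_conePatch {y : Euc n} (hy : y ≠ 0) : HasFDerivAt (conePatch e α J)
    (J.toContinuousLinearMap +
      ((Real.cos α / Real.sin α) • (‖y‖⁻¹ • innerSL ℝ y)).smulRight e) y :=
  J.toContinuousLinearMap.hasFDerivAt.add (((hasFDerivAt_norm_euc hy).const_mul _).smul_const e)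

lemma fderiv_conePatch_apply {y : Euc n} (hy : y ≠ 0) (v : Euc n) :
    fderiv ℝ (conePatch e α J) y v =
      J v + (Real.cos α / Real.sin α * (‖y‖⁻¹ * inner ℝ y v)) • e := by
  rw [(hasFDerivAt_conePatch hy).fderiv]
  rfl

lemma fderiv_conePatch_self {y : Euc n} (hy : y ≠ 0) :
    fderiv ℝ (conePatch e α J) y y = conePatch e α J y := by
  rw [fderiv_conePatch_apply hy, conePatch, real_inner_self_eq_norm_sq, sq,
    inv_mul_cancel_left₀ (norm_ne_zero_iff.2 hy)]

lemma hasFDerivAt_conePatchNormal {y : Euc n} (hy : y ≠ 0) : HasFDerivAt (conePatchNormal e α J)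
    (-((Real.cos α * ‖y‖⁻¹) • J.toContinuousLinearMap +
      (Real.cos α • -((‖y‖ ^ 2)⁻¹ • (‖y‖⁻¹ • innerSL ℝ y))).smulRight (J y))) y := by
  have h1 := ((hasDerivAt_inv (norm_ne_zero_iff.2 hy)).comp_hasFDerivAt y
    (hasFDerivAt_norm_euc hy)).const_mul (Real.cos α)
  have h2 := (h1.smul J.toContinuousLinearMap.hasFDerivAt).const_sub (Real.sin α • e)
  rw [neg_smul] at h2
  exact h2

lemma fderiv_conePatchNormal_self {y : Euc n} (hy : y ≠ 0) :
    fderiv ℝ (conePatchNormal e α J) y y = 0 := by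
  have hy0 : ‖y‖ ≠ 0 := norm_ne_zero_iff.2 hy
  rw [(hasFDerivAt_conePatchNormal hy).fderiv]
  simp only [neg_apply, add_apply, smul_apply, ContinuousLinearMap.smulRight_apply,
    innerSL_apply_apply, real_inner_self_eq_norm_sq, LinearIsometry.coe_toContinuousLinearMap,
    smul_eq_mul]
  rw [← add_smul, neg_eq_zero]
  convert zero_smul ℝ _
  field_simp
  ring

/-- Along a circle the normal of the cone turns proportionally to the position. -/
lemma fderiv_conePatchNormal_of_orthogonal {y v : Euc n} (hy : y ≠ 0) (hv : inner ℝ y v = (0 : ℝ)) :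
    fderiv ℝ (conePatchNormal e α J) y v = -((Real.cos α * ‖y‖⁻¹) • J v) := by
  rw [(hasFDerivAt_conePatchNormal hy).fderiv]
  simp [hv]

variable (he : ‖e‖ = 1) (hJ : ∀ y, inner ℝ (J y) e = 0) (hα0 : 0 < α) (hα : α ≤ Real.pi / 2)

lemma sin_pos_of_angle (hα0 : 0 < α) (hα : α ≤ Real.pi / 2) : 0 < Real.sin α :=
  Real.sin_pos_of_pos_of_lt_pi hα0 (by linarith [Real.pi_pos])

lemma cos_nonneg_of_angle (hα0 : 0 < α) (hα : α ≤ Real.pi / 2) : 0 ≤ Real.cos α :=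
  Real.cos_nonneg_of_mem_Icc ⟨by linarith [Real.pi_pos], hα⟩

include he hJ

lemma inner_add_smul_axis (v w : Euc n) (a b : ℝ) :
    inner ℝ (J v + a • e) (J w + b • e) = inner ℝ v w + a * b := by
  have h (w : Euc n) : inner ℝ e (J w) = 0 := by rw [real_inner_comm, hJ]
  simp only [inner_add_left, inner_add_right, inner_smul_left, inner_smul_right, hJ, h,
    real_inner_self_eq_norm_sq, he, J.inner_map_map, conj_trivial]
  ring

lemma norm_add_smul_axis_sq (v : Euc n) (a : ℝ) : ‖J v + a • e‖ ^ 2 = ‖v‖ ^ 2 + a ^ 2 := by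
  rw [← real_inner_self_eq_norm_sq, inner_add_smul_axis he hJ, real_inner_self_eq_norm_sq]
  ring

lemma norm_conePatchNormal {y : Euc n} (hy : y ≠ 0) : ‖conePatchNormal e α J y‖ = 1 := by
  have hy0 : ‖y‖ ≠ 0 := norm_ne_zero_iff.2 hy
  have h1 : conePatchNormal e α J y = J (-(Real.cos α * ‖y‖⁻¹) • y) + Real.sin α • e := by
    rw [conePatchNormal, map_smul]; module
  rw [← sq_eq_sq₀ (norm_nonneg _) zero_le_one, h1, norm_add_smul_axis_sq he hJ, norm_smul, mul_pow,
    Real.norm_eq_abs, sq_abs]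
  field_simp
  linarith [Real.sin_sq_add_cos_sq α]

lemma inner_conePatch_conePatchNormal {y : Euc n} (hs : Real.sin α ≠ 0) (hy : y ≠ 0) :
    inner ℝ (conePatch e α J y) (conePatchNormal e α J y) = (0 : ℝ) := by
  have hy0 : ‖y‖ ≠ 0 := norm_ne_zero_iff.2 hy
  have h1 : conePatchNormal e α J y = J (-(Real.cos α * ‖y‖⁻¹) • y) + Real.sin α • e := by
    rw [conePatchNormal, map_smul]; module
  rw [h1, conePatch, inner_add_smul_axis he hJ, inner_smul_right, real_inner_self_eq_norm_sq]
  field_simp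
  ring

include hα0 hα

lemma norm_conePatch (y : Euc n) : ‖conePatch e α J y‖ = ‖y‖ / Real.sin α := by
  have hs := sin_pos_of_angle hα0 hα
  rw [← sq_eq_sq₀ (norm_nonneg _) (by positivity), conePatch, norm_add_smul_axis_sq he hJ]
  field_simp
  rw [Real.sin_sq_add_cos_sq, mul_one]

lemma coneNormal_conePatch {y : Euc n} (hy : y ≠ 0) :
    coneNormal e α (conePatch e α J y) = conePatchNormal e α J y := by
  have hs := (sin_pos_of_angle hα0 hα).ne'
  have hy0 : ‖y‖ ≠ 0 := norm_ne_zero_iff.2 hy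
  rw [coneNormal, norm_conePatch he hJ hα0 hα, conePatch, conePatchNormal, smul_sub, smul_smul,
    smul_add, smul_smul]
  have h1 : (Real.sin α)⁻¹ * (Real.cos α / (‖y‖ / Real.sin α)) = Real.cos α * ‖y‖⁻¹ := by
    field_simp
  have h2 : Real.sin α = (Real.sin α)⁻¹ -
      (Real.sin α)⁻¹ * (Real.cos α / (‖y‖ / Real.sin α)) * (Real.cos α / Real.sin α * ‖y‖) := by
    field_simp
    linarith [Real.sin_sq_add_cos_sq α]
  rw [h1] at h2 ⊢
  nth_rewrite 3 [h2]
  module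

lemma exists_conePatch_eq {x : Euc (n + 1)} (hx : x ∈ roundCone e α) :
    ∃ y, conePatch e α J y = x := by
  have hs := sin_pos_of_angle hα0 hα
  have hc := cos_nonneg_of_angle hα0 hα
  -- the range of `J` is the hyperplane orthogonal to `e`
  have hrange : LinearMap.range J.toLinearMap = (ℝ ∙ e)ᗮ := by
    refine Submodule.eq_of_le_of_finrank_eq ?_ ?_
    · rintro _ ⟨y, rfl⟩
      rw [Submodule.mem_orthogonal_singleton_iff_inner_left]
      exact hJ y
    · have : Fact (Module.finrank ℝ (Euc (n + 1)) = n + 1) := ⟨finrank_euclideanSpace_fin⟩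
      rw [LinearMap.finrank_range_of_inj J.injective,
        Submodule.finrank_orthogonal_span_singleton (n := n)
          (norm_ne_zero_iff.1 (he ▸ one_ne_zero)),
        finrank_euclideanSpace_fin]
  have hmem : x - (inner ℝ x e : ℝ) • e ∈ LinearMap.range J.toLinearMap := by
    rw [hrange, Submodule.mem_orthogonal_singleton_iff_inner_left, inner_sub_left, inner_smul_left,
      real_inner_self_eq_norm_sq, he]
    simp
  obtain ⟨y, hy⟩ := hmem
  replace hy : J y = x - (inner ℝ x e : ℝ) • e := hy
  refine ⟨y, ?_⟩
  have hx1 : inner ℝ x e = ‖x‖ * Real.cos α := hx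
  have hx2 : x = J y + (inner ℝ x e : ℝ) • e := by rw [hy]; abel
  have h1 := norm_add_smul_axis_sq he hJ y (inner ℝ x e)
  rw [← hx2, hx1] at h1
  have h2 : ‖y‖ = ‖x‖ * Real.sin α := by
    rw [← sq_eq_sq₀ (norm_nonneg _) (by positivity)]
    linear_combination -h1 - ‖x‖ ^ 2 * Real.sin_sq_add_cos_sq α
  rw [conePatch, h2, hy, hx1]
  have h3 : Real.cos α / Real.sin α * (‖x‖ * Real.sin α) = ‖x‖ * Real.cos α := by
    field_simp
  rw [h3, sub_add_cancel]

lemma conePatch_mem_roundCone (y : Euc n) : conePatch e α J y ∈ roundCone e α := by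
  have hs := (sin_pos_of_angle hα0 hα).ne'
  change inner ℝ _ _ = _
  rw [norm_conePatch he hJ hα0 hα, conePatch, inner_add_left, inner_smul_left, hJ,
    real_inner_self_eq_norm_sq, he]
  simp only [conj_trivial]
  ring

lemma coneExterior_eq_image (ρ : ℝ) :
    coneExterior e α ρ = conePatch e α J '' {y | ρ * Real.sin α < ‖y‖} := by
  have hs := sin_pos_of_angle hα0 hα
  ext x
  constructor
  · rintro ⟨h1, h2⟩
    obtain ⟨y, rfl⟩ := exists_conePatch_eq he hJ hα0 hα h1
    rw [norm_conePatch he hJ hα0 hα, lt_div_iff₀ hs] at h2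
    exact ⟨y, h2, rfl⟩
  · rintro ⟨y, hy, rfl⟩
    refine ⟨conePatch_mem_roundCone he hJ hα0 hα y, ?_⟩
    rw [norm_conePatch he hJ hα0 hα, lt_div_iff₀ hs]
    exact hy

end Cone

/-! ### The norm of covariant tensors -/

section TensorNorm

variable {n m : ℕ}

lemma sum_prod_mul_prod (A B : Matrix (Fin n) (Fin n) ℝ) (I K : Fin m → Fin n) :
    ∑ L : Fin m → Fin n, (∏ a, A (I a) (L a)) * ∏ a, B (L a) (K a) = ∏ a, (A * B) (I a) (K a) := by
  simp only [Matrix.mul_apply]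
  rw [Finset.prod_univ_sum, Fintype.piFinset_univ]
  exact Finset.sum_congr rfl fun L _ => Finset.prod_mul_distrib.symm

/-- If `g⁻¹ = Bᵀ B`, then `|T|²` is the sum of the squares of the components of the tensor
transformed by `B`, and the components of `T` are recovered by means of `B⁻¹`. -/
lemma abs_le_tensorNorm {X : Euc n → Euc (n + 1)} {y : Euc n} {B B' : Matrix (Fin n) (Fin n) ℝ}
    (hB : (firstForm X y)⁻¹ = Bᵀ * B) (hB' : B' * B = 1) {K : ℝ} (hK : ∀ i j, |B' i j| ≤ K)
    (T : (Fin m → Fin n) → ℝ) (I : Fin m → Fin n) :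
    |T I| ≤ (n * K) ^ m * tensorNorm X y T := by
  obtain ⟨S, hS⟩ : ∃ S : (Fin m → Fin n) → ℝ, ∀ L, S L = ∑ I, (∏ a, B (L a) (I a)) * T I :=
    ⟨_, fun _ => rfl⟩
  have hnorm : tensorNorm X y T = √(∑ L, S L ^ 2) := by
    rw [tensorNorm]
    congr 1
    calc _ = ∑ I, ∑ K, (∑ L : Fin m → Fin n, (∏ a, Bᵀ (I a) (L a)) * ∏ a, B (L a) (K a)) *
          T I * T K := by simp only [sum_prod_mul_prod, hB]
      _ = ∑ L : Fin m → Fin n, ∑ I : Fin m → Fin n, ∑ K : Fin m → Fin n,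
          (∏ a, B (L a) (I a)) * (∏ a, B (L a) (K a)) * T I * T K := by
        simp only [Finset.sum_mul, Matrix.transpose_apply]
        rw [Finset.sum_congr rfl fun I _ => Finset.sum_comm, Finset.sum_comm]
      _ = _ := by
        refine Finset.sum_congr rfl fun L _ => ?_
        rw [hS, sq, Finset.sum_mul_sum]
        exact Finset.sum_congr rfl fun I _ => Finset.sum_congr rfl fun K _ => by ring
  have hS1 : ∀ L, |S L| ≤ tensorNorm X y T := fun L => by
    rw [hnorm]
    exact Real.abs_le_sqrt
      (Finset.single_le_sum (f := fun L => S L ^ 2) (fun L _ => sq_nonneg _) (Finset.mem_univ L))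
  have hT : T I = ∑ L, (∏ a, B' (I a) (L a)) * S L := by
    calc T I = ∑ K, (∏ a, (1 : Matrix (Fin n) (Fin n) ℝ) (I a) (K a)) * T K := by
          rw [Finset.sum_eq_single I]
          · simp
          · intro K _ hK
            obtain ⟨a, ha⟩ := Function.ne_iff.1 hK
            rw [Finset.prod_eq_zero (Finset.mem_univ a), zero_mul]
            exact Matrix.one_apply_ne ha.symm
          · simp
      _ = _ := by
          simp only [← hB', ← sum_prod_mul_prod, hS, Finset.sum_mul, Finset.mul_sum]
          rw [Finset.sum_comm]
          simp only [mul_assoc]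
  have hB1 : ∀ L : Fin m → Fin n, |∏ a, B' (I a) (L a)| ≤ K ^ m := fun L => by
    rw [Finset.abs_prod]
    calc _ ≤ ∏ _a : Fin m, K := Finset.prod_le_prod (fun _ _ => abs_nonneg _) fun a _ => hK _ _
      _ = K ^ m := by simp
  rw [hT]
  calc _ ≤ ∑ L : Fin m → Fin n, |(∏ a, B' (I a) (L a)) * S L| := Finset.abs_sum_le_sum_abs _ _
    _ ≤ ∑ _L : Fin m → Fin n, K ^ m * tensorNorm X y T := Finset.sum_le_sum fun L _ => by
        rw [abs_mul]
        exact mul_le_mul (hB1 L) (hS1 L) (abs_nonneg _) ((abs_nonneg _).trans (hB1 L))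
    _ = (n * K) ^ m * tensorNorm X y T := by
        simp [mul_pow]
        ring

end TensorNorm

/-! ### Covariant derivatives on the cone -/

noncomputable section ConeMetric

variable {n : ℕ} {e : Euc (n + 1)} {α : ℝ} {J : Euc n →ₗᵢ[ℝ] Euc (n + 1)}

/-- The matrix of the orthogonal projection onto the line spanned by `y`. -/
def radialMatrix (y : Euc n) : Matrix (Fin n) (Fin n) ℝ :=
  Matrix.of fun i j => (‖y‖ ^ 2)⁻¹ * (y i * y j)

lemma radialMatrix_transpose (y : Euc n) : (radialMatrix y)ᵀ = radialMatrix y := by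
  ext i j
  simp [radialMatrix, mul_comm]

lemma radialMatrix_mul_self {y : Euc n} (hy : y ≠ 0) :
    radialMatrix y * radialMatrix y = radialMatrix y := by
  have hy0 : ‖y‖ ^ 2 ≠ 0 := pow_ne_zero _ (norm_ne_zero_iff.2 hy)
  ext i j
  simp only [radialMatrix, Matrix.mul_apply, Matrix.of_apply]
  have h1 : ∑ k, y k ^ 2 = ‖y‖ ^ 2 := by
    rw [EuclideanSpace.norm_sq_eq]; simp
  calc _ = (‖y‖ ^ 2)⁻¹ * (y i * y j) * ((‖y‖ ^ 2)⁻¹ * ∑ k, y k ^ 2) := by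
        rw [Finset.mul_sum, Finset.mul_sum]
        exact Finset.sum_congr rfl fun k _ => by ring
    _ = _ := by rw [h1, inv_mul_cancel₀ hy0, mul_one]

lemma abs_radialMatrix_le {y : Euc n} (i j : Fin n) : |radialMatrix y i j| ≤ 1 := by
  have h (i : Fin n) : |y i| ≤ ‖y‖ := by simpa using PiLp.norm_apply_le y i
  rw [radialMatrix, Matrix.of_apply, abs_mul, abs_inv, abs_mul, abs_of_nonneg (sq_nonneg _), sq]
  exact inv_mul_le_one_of_le₀ (mul_le_mul (h i) (h j) (abs_nonneg _) (norm_nonneg _))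
    (by positivity)

variable (he : ‖e‖ = 1) (hJ : ∀ y, inner ℝ (J y) e = 0) (hα0 : 0 < α) (hα : α ≤ Real.pi / 2)
include he hJ

lemma firstForm_conePatch {y : Euc n} (hy : y ≠ 0) :
    firstForm (conePatch e α J) y = 1 + (Real.cos α / Real.sin α) ^ 2 • radialMatrix y := by
  ext i j
  have h (i : Fin n) : inner ℝ y (EuclideanSpace.single i (1 : ℝ)) = y i := by
    rw [EuclideanSpace.inner_single_right]; simp
  simp only [firstForm, Matrix.of_apply, pderiv, fderiv_conePatch_apply hy,
    inner_add_smul_axis he hJ, h, radialMatrix, Matrix.add_apply, Matrix.smul_apply,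
    Matrix.one_apply, EuclideanSpace.inner_single_left, smul_eq_mul]
  simp only [PiLp.single_apply, map_one, one_mul]
  congr 1
  ring

include hα0 hα

lemma inv_firstForm_conePatch {y : Euc n} (hy : y ≠ 0) :
    (firstForm (conePatch e α J) y)⁻¹ = 1 - (Real.cos α ^ 2) • radialMatrix y := by
  have hs := (sin_pos_of_angle hα0 hα).ne'
  refine Matrix.inv_eq_left_inv ?_
  rw [firstForm_conePatch he hJ hy, sub_mul, mul_add, mul_one, one_mul, mul_add, mul_one,
    Matrix.smul_mul, Matrix.mul_smul, radialMatrix_mul_self hy, smul_smul]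
  have h1 : (Real.cos α / Real.sin α) ^ 2 - Real.cos α ^ 2 -
      Real.cos α ^ 2 * (Real.cos α / Real.sin α) ^ 2 = 0 := by
    field_simp
    linear_combination -Real.cos α ^ 2 * Real.sin_sq_add_cos_sq α
  have h2 : (1 : Matrix (Fin n) (Fin n) ℝ) + (Real.cos α / Real.sin α) ^ 2 • radialMatrix y -
      (Real.cos α ^ 2 • radialMatrix y + (Real.cos α ^ 2 * (Real.cos α / Real.sin α) ^ 2) •
        radialMatrix y) = 1 + ((Real.cos α / Real.sin α) ^ 2 - Real.cos α ^ 2 -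
      Real.cos α ^ 2 * (Real.cos α / Real.sin α) ^ 2) • radialMatrix y := by module
  rw [h2, h1, zero_smul, add_zero]

/-- On a cone the components of a tensor are controlled by its norm. -/
lemma abs_le_tensorNorm_conePatch {m : ℕ} {y : Euc n} (hy : y ≠ 0) (T : (Fin m → Fin n) → ℝ)
    (I : Fin m → Fin n) :
    |T I| ≤ (n * (1 + |1 / Real.sin α - 1|)) ^ m * tensorNorm (conePatch e α J) y T := by
  have hs := (sin_pos_of_angle hα0 hα).ne'
  refine abs_le_tensorNorm (B := 1 - (1 - Real.sin α) • radialMatrix y)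
    (B' := 1 + (1 / Real.sin α - 1) • radialMatrix y) ?_ ?_ (fun i j => ?_) T I
  · rw [inv_firstForm_conePatch he hJ hα0 hα hy, Matrix.transpose_sub, Matrix.transpose_one,
      Matrix.transpose_smul, radialMatrix_transpose, sub_mul, one_mul, mul_sub, mul_one,
      Matrix.smul_mul, Matrix.mul_smul, radialMatrix_mul_self hy, Real.cos_sq']
    module
  · rw [add_mul, one_mul, mul_sub, mul_one, Matrix.smul_mul, Matrix.mul_smul,
      radialMatrix_mul_self hy, smul_smul]
    have h1 : (1 / Real.sin α - 1) - (1 - Real.sin α) -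
        (1 / Real.sin α - 1) * (1 - Real.sin α) = 0 := by
      field_simp
      ring
    have h2 : (1 : Matrix (Fin n) (Fin n) ℝ) - (1 - Real.sin α) • radialMatrix y +
        ((1 / Real.sin α - 1) • radialMatrix y -
        ((1 / Real.sin α - 1) * (1 - Real.sin α)) • radialMatrix y) =
        1 + ((1 / Real.sin α - 1) - (1 - Real.sin α) -
        (1 / Real.sin α - 1) * (1 - Real.sin α)) • radialMatrix y := by module
    rw [h2, h1, zero_smul, add_zero]
  · rw [Matrix.add_apply, Matrix.smul_apply, smul_eq_mul]
    refine (abs_add_le _ _).trans (add_le_add ?_ ?_)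
    · rw [Matrix.one_apply]; split_ifs <;> simp
    · rw [abs_mul]
      exact mul_le_of_le_one_right (abs_nonneg _) (abs_radialMatrix_le i j)

lemma exists_christoffel_conePatch_le :
    ∃ K, 0 ≤ K ∧ ∀ (y : Euc n) (l i j : Fin n), 1 ≤ ‖y‖ →
      |christoffel (conePatch e α J) l i j y| ≤ K := by
  obtain ⟨K, hK0, hK⟩ := exists_norm_fderiv_le_of_homogeneous (d := 1)
    (contDiffOn_conePatch (e := e) (α := α) (J := J) (k := 2)) (fun t ht y => by
      rw [conePatch_smul ht, zpow_one])
  refine ⟨n * (2 * (K * K)), by positivity, fun y l i j hy1 => ?_⟩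
  have hy : y ≠ 0 := norm_pos_iff.1 (by linarith)
  have hy0 : 0 < ‖y‖ := norm_pos_iff.2 hy
  obtain ⟨-, h1, h2⟩ := hK y hy
  have h3 (i : Fin n) : ‖pderiv i (conePatch e α J) y‖ ≤ K := by
    refine ((fderiv ℝ (conePatch e α J) y).le_opNorm _).trans ?_
    simpa using h1
  have h4 : ‖pderiv i (pderiv j (conePatch e α J)) y‖ ≤ K := by
    have hd : ContDiffAt ℝ 2 (conePatch e α J) y :=
      contDiffOn_conePatch.contDiffAt (isOpen_compl_singleton.mem_nhds hy)
    have h5 : pderiv i (pderiv j (conePatch e α J)) y =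
        fderiv ℝ (fderiv ℝ (conePatch e α J)) y (EuclideanSpace.single i 1)
          (EuclideanSpace.single j 1) := by
      unfold pderiv
      exact fderiv_fderiv_apply hd _ _
    rw [h5]
    refine (ContinuousLinearMap.le_opNorm₂ _ _ _).trans ?_
    simp only [PiLp.norm_single, norm_one, mul_one]
    refine h2.trans (mul_le_of_le_one_right hK0 ?_)
    rw [show (1 : ℤ) - 2 = -1 by norm_num, zpow_neg_one]
    exact inv_le_one_of_one_le₀ hy1
  have h6 : ∀ l m, |(firstForm (conePatch e α J) y)⁻¹ l m| ≤ 2 := fun l m => by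
    rw [inv_firstForm_conePatch he hJ hα0 hα hy, Matrix.sub_apply, Matrix.smul_apply, smul_eq_mul]
    have h7 : |(1 : Matrix (Fin n) (Fin n) ℝ) l m| ≤ 1 := by
      rw [Matrix.one_apply]; split_ifs <;> simp
    have h8 : |Real.cos α ^ 2 * radialMatrix y l m| ≤ 1 := by
      rw [abs_mul, abs_of_nonneg (sq_nonneg _)]
      exact mul_le_one₀ (Real.cos_sq_le_one α) (abs_nonneg _) (abs_radialMatrix_le l m)
    exact (abs_sub _ _).trans (by linarith)
  rw [christoffel]
  refine (Finset.abs_sum_le_sum_abs _ _).trans ?_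
  refine (Finset.sum_le_card_nsmul _ _ (2 * (K * K)) fun m _ => ?_).trans (by simp)
  rw [abs_mul]
  exact mul_le_mul (h6 l m) ((abs_real_inner_le_norm _ _).trans
    (mul_le_mul h4 (h3 m) (norm_nonneg _) hK0)) (abs_nonneg _) zero_le_two

omit he hJ hα0 hα in
lemma norm_le_sum_norm_apply_single {W : Type*} [NormedAddCommGroup W] [NormedSpace ℝ W]
    (L : Euc n →L[ℝ] W) : ‖L‖ ≤ ∑ i, ‖L (EuclideanSpace.single i 1)‖ := by
  refine L.opNorm_le_bound (Finset.sum_nonneg fun _ _ => norm_nonneg _) fun v => ?_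
  have h2 : L v = ∑ i, v i • L (EuclideanSpace.single i 1) := by
    nth_rewrite 1 [sum_smul_single v]
    simp [map_sum]
  rw [h2, Finset.sum_mul]
  refine (norm_sum_le _ _).trans (Finset.sum_le_sum fun i _ => ?_)
  rw [norm_smul, mul_comm]
  gcongr
  exact PiLp.norm_apply_le v i

lemma tendsto_component {m : ℕ} {T : Euc n → (Fin m → Fin n) → ℝ}
    (hT : (fun y => tensorNorm (conePatch e α J) y (T y))
      =o[Bornology.cobounded (Euc n)] fun y => ‖conePatch e α J y‖⁻¹ ^ m) (I : Fin m → Fin n) :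
    Tendsto (fun y => ‖y‖ ^ m * T y I) (Bornology.cobounded (Euc n)) (𝓝 0) := by
  have hs := (sin_pos_of_angle hα0 hα)
  have h1 := hT.tendsto_div_nhds_zero.const_mul
    ((n * (1 + |1 / Real.sin α - 1|)) ^ m * Real.sin α ^ m)
  rw [mul_zero] at h1
  refine squeeze_zero_norm' ?_ h1
  have h2 : ∀ᶠ y : Euc n in Bornology.cobounded (Euc n), 1 ≤ ‖y‖ :=
    tendsto_norm_cobounded_atTop.eventually_ge_atTop 1
  filter_upwards [h2] with y hy1
  have hy : y ≠ 0 := norm_pos_iff.1 (by linarith)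
  have hy0 : 0 < ‖y‖ := norm_pos_iff.2 hy
  rw [norm_mul, norm_pow, norm_norm, norm_conePatch he hJ hα0 hα, Real.norm_eq_abs]
  calc _ ≤ ‖y‖ ^ m * ((n * (1 + |1 / Real.sin α - 1|)) ^ m *
        tensorNorm (conePatch e α J) y (T y)) := by
        gcongr
        exact abs_le_tensorNorm_conePatch he hJ hα0 hα hy _ _
    _ = _ := by
        rw [inv_pow, div_inv_eq_mul, div_pow]
        field_simp

/-- The decay of the covariant derivatives in terms of the coordinates of `conePatch`. -/
lemma tendsto_of_isLittleO_tensorNorm {k : ℕ} {w : Euc n → ℝ} {r : ℝ}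
    (hw : ContDiffOn ℝ k w {y | r < ‖y‖})
    (h : ∀ j ≤ k, (fun y => tensorNorm (conePatch e α J) y (iterCovDeriv (conePatch e α J) w j y))
        =o[Bornology.cobounded (Euc n)] fun y => ‖conePatch e α J y‖⁻¹ ^ j) :
    Tendsto w (Bornology.cobounded (Euc n)) (𝓝 0) ∧
    (1 ≤ k → Tendsto (fun y => ‖y‖ * ‖fderiv ℝ w y‖) (Bornology.cobounded (Euc n)) (𝓝 0)) ∧
    (2 ≤ k → Tendsto (fun y => ‖fderiv ℝ (fderiv ℝ w) y‖) (Bornology.cobounded (Euc n)) (𝓝 0)) := by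
  have hcomp : 1 ≤ k → ∀ i,
      Tendsto (fun y => ‖y‖ * pderiv i w y) (Bornology.cobounded (Euc n)) (𝓝 0) := fun hk i => by
    have := tendsto_component he hJ hα0 hα (h 1 hk) (fun _ => i)
    simpa [iterCovDeriv, covDeriv] using this
  have hle : ∀ r, ∀ᶠ y : Euc n in Bornology.cobounded (Euc n), r < ‖y‖ := fun r =>
    tendsto_norm_cobounded_atTop.eventually_gt_atTop r
  refine ⟨?_, fun hk => ?_, fun hk => ?_⟩
  · have := tendsto_component he hJ hα0 hα (h 0 (Nat.zero_le k)) Fin.elim0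
    simpa [iterCovDeriv] using this
  · have h1 : Tendsto (fun y => ∑ i, ‖‖y‖ * pderiv i w y‖) (Bornology.cobounded (Euc n))
        (𝓝 0) := by
      have := tendsto_finsetSum Finset.univ fun i _ => (hcomp hk i).norm
      simpa using this
    refine squeeze_zero (fun y => by positivity) (fun y => ?_) h1
    simp only [norm_mul, norm_norm, ← Finset.mul_sum]
    gcongr
    exact norm_le_sum_norm_apply_single _
  · obtain ⟨K, hK0, hK⟩ := exists_christoffel_conePatch_le he hJ hα0 hα
    have hd : ∀ l, Tendsto (fun y => pderiv l w y) (Bornology.cobounded (Euc n)) (𝓝 0) :=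
      fun l => by
        refine squeeze_zero_norm' ?_ (tendsto_zero_iff_norm_tendsto_zero.1
          (hcomp (by lia) l))
        filter_upwards [hle 1] with y hy
        rw [norm_mul, norm_norm]
        exact le_mul_of_one_le_left (norm_nonneg _) hy.le
    have h2 : ∀ i j, Tendsto (fun y => pderiv i (pderiv j w) y) (Bornology.cobounded (Euc n))
        (𝓝 0) := fun i j => by
      have h3 := tendsto_component he hJ hα0 hα (h 2 hk) ![i, j]
      have h4 : Tendsto (fun y => iterCovDeriv (conePatch e α J) w 2 y ![i, j])
          (Bornology.cobounded (Euc n)) (𝓝 0) := by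
        refine squeeze_zero_norm' ?_ (tendsto_zero_iff_norm_tendsto_zero.1 h3)
        filter_upwards [hle 1] with y hy
        rw [norm_mul, norm_pow, norm_norm]
        exact le_mul_of_one_le_left (norm_nonneg _) (one_le_pow₀ hy.le)
      have h5 : Tendsto (fun y => ∑ l, christoffel (conePatch e α J) l i j y * pderiv l w y)
          (Bornology.cobounded (Euc n)) (𝓝 0) := by
        have := tendsto_finsetSum (Finset.univ : Finset (Fin n)) (fun l _ => show Tendsto
          (fun y => christoffel (conePatch e α J) l i j y * pderiv l w y)
          (Bornology.cobounded (Euc n)) (𝓝 0) from ?_)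
        · simpa using this
        · have h6 := ((hd l).norm.const_mul K)
          rw [norm_zero, mul_zero] at h6
          refine squeeze_zero_norm' ?_ h6
          filter_upwards [hle 1] with y hy
          rw [norm_mul]
          gcongr
          exact hK y l i j hy.le
      have h7 := h4.add h5
      rw [add_zero] at h7
      refine h7.congr fun y => ?_
      simp [iterCovDeriv, covDeriv, Fin.tail]
    have h8 : Tendsto (fun y => ∑ i, ∑ j, ‖pderiv i (pderiv j w) y‖)
        (Bornology.cobounded (Euc n)) (𝓝 0) := by
      have := tendsto_finsetSum (Finset.univ : Finset (Fin n)) fun i _ =>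
        tendsto_finsetSum (Finset.univ : Finset (Fin n)) fun j _ => (h2 i j).norm
      simpa using this
    refine squeeze_zero' (Eventually.of_forall fun y => norm_nonneg (fderiv ℝ (fderiv ℝ w) y)) ?_ h8
    filter_upwards [hle r] with y hy
    have hopen : IsOpen {y : Euc n | r < ‖y‖} := isOpen_lt continuous_const continuous_norm
    have hcd : ContDiffAt ℝ 2 w y :=
      (hw.contDiffAt (hopen.mem_nhds hy)).of_le (by exact_mod_cast hk)
    refine (norm_le_sum_norm_apply_single _).trans (Finset.sum_le_sum fun i _ => ?_)
    refine (norm_le_sum_norm_apply_single _).trans (Finset.sum_le_sum fun j _ => ?_)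
    have h5 : pderiv i (pderiv j w) y = fderiv ℝ (fderiv ℝ w) y (EuclideanSpace.single i 1)
        (EuclideanSpace.single j 1) := by
      unfold pderiv
      exact fderiv_fderiv_apply hcd _ _
    rw [h5]

end ConeMetric

/-! ### Conical ends as graphs over the punctured hyperplane -/

section ConicalEnd

variable {n : ℕ} {M : Type*} [TopologicalSpace M] [ChartedSpace (Euc n) M]

/-- The parametrization `Φ` of the set `E`, defined for `‖y‖ > r` in the coordinates of
`conePatch`, exhibits `E` as the normal graph of the function `w`, which decays with its
derivatives. -/
structure IsConicalGraph (k : ℕ) (F : M → Euc (n + 1)) (E : Set M) (e : Euc (n + 1)) (α : ℝ)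
    (J : Euc n →ₗᵢ[ℝ] Euc (n + 1)) (r : ℝ) (w : Euc n → ℝ) (Φ : Euc n → M) : Prop where
  one_le : 1 ≤ k
  norm_axis : ‖e‖ = 1
  inner_axis : ∀ y, inner ℝ (J y) e = 0
  angle_pos : 0 < α
  angle_le : α ≤ Real.pi / 2
  radius_pos : 0 < r
  injOn : InjOn Φ {y | r < ‖y‖}
  isOpen_image : ∀ U ⊆ {y | r < ‖y‖}, IsOpen U → IsOpen (Φ '' U)
  image_eq : Φ '' {y | r < ‖y‖} = E
  contMDiffOn : ContMDiffOn 𝓘(ℝ, Euc n) (𝓡 n) k Φ {y | r < ‖y‖}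
  contDiffOn : ContDiffOn ℝ k w {y | r < ‖y‖}
  apply_eq : ∀ y, r < ‖y‖ → F (Φ y) = conePatch e α J y + w y • conePatchNormal e α J y
  tendsto_zero : Tendsto w (Bornology.cobounded (Euc n)) (𝓝 0)
  tendsto_fderiv : Tendsto (fun y => ‖y‖ * ‖fderiv ℝ w y‖) (Bornology.cobounded (Euc n)) (𝓝 0)
  tendsto_fderiv_fderiv : 2 ≤ k →
    Tendsto (fun y => ‖fderiv ℝ (fderiv ℝ w) y‖) (Bornology.cobounded (Euc n)) (𝓝 0)

lemma IsAsymptoticToCone.exists_isConicalGraph {k : ℕ} {F : M → Euc (n + 1)} {E : Set M}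
    {e : Euc (n + 1)} {α : ℝ} (h : IsAsymptoticToCone k F E e α) (hk : 1 ≤ k) (he : ‖e‖ = 1)
    (hα0 : 0 < α) (hα : α ≤ Real.pi / 2) :
    ∃ J r w Φ, IsConicalGraph k F E e α J r w Φ := by
  obtain ⟨ρ, u, φ, J, hρ, hJ, hφ, hE, hΦ, hFφ, hu, hdecay⟩ := h
  have hs := sin_pos_of_angle hα0 hα
  have hΩ : {y | ρ < ‖conePatch e α J y‖} = {y | ρ * Real.sin α < ‖y‖} := by
    ext y
    simp only [mem_ofPred_eq, norm_conePatch he hJ hα0 hα, lt_div_iff₀ hs]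
  rw [hΩ] at hΦ hu
  have hr : 0 < ρ * Real.sin α := by positivity
  have himg := coneExterior_eq_image he hJ hα0 hα ρ
  have hmem : ∀ y, ρ * Real.sin α < ‖y‖ → conePatch e α J y ∈ coneExterior e α ρ := fun y hy => by
    rw [himg]; exact mem_image_of_mem _ hy
  -- the adjoint of `J` inverts the coordinates of the cone
  obtain ⟨π, hπ⟩ : ∃ π : Euc (n + 1) → Euc n, Continuous π ∧ ∀ y, π (conePatch e α J y) = y := by
    refine ⟨J.toContinuousLinearMap.adjoint, J.toContinuousLinearMap.adjoint.continuous,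
      fun y => ext_inner_left ℝ fun z => ?_⟩
    rw [ContinuousLinearMap.adjoint_inner_right, conePatch, inner_add_right, inner_smul_right]
    change inner ℝ (J z) (J y) + _ * inner ℝ (J z) e = _
    rw [hJ, mul_zero, add_zero, J.inner_map_map]
  have hinj : InjOn φ (coneExterior e α ρ) := by
    intro x hx x' hx' hxx
    have := hφ.injective (a₁ := ⟨x, hx⟩) (a₂ := ⟨x', hx'⟩) hxx
    exact congrArg Subtype.val this
  obtain ⟨h0, h1, h2⟩ := tendsto_of_isLittleO_tensorNorm he hJ hα0 hα hu hdecay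
  refine ⟨J, ρ * Real.sin α, u ∘ conePatch e α J, φ ∘ conePatch e α J, hk, he, hJ, hα0, hα, hr, ?_,
    ?_, ?_, hΦ, hu, ?_, h0, h1 hk, h2⟩
  · intro y hy y' hy' hyy
    rw [← hπ.2 y, hinj (hmem y hy) (hmem y' hy') hyy, hπ.2]
  · intro U hU hUo
    have h3 : (φ ∘ conePatch e α J) '' U =
        (coneExterior e α ρ).domRestrict φ '' (Subtype.val ⁻¹' (π ⁻¹' U)) := by
      ext q
      constructor
      · rintro ⟨y, hy, rfl⟩
        exact ⟨⟨conePatch e α J y, hmem y (hU hy)⟩, by simpa [hπ.2] using hy, rfl⟩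
      · rintro ⟨⟨x, hx⟩, hxU, rfl⟩
        have hx' := hx
        rw [himg] at hx'
        obtain ⟨y, -, rfl⟩ := hx'
        refine ⟨y, ?_, rfl⟩
        simpa [hπ.2] using hxU
    rw [h3]
    exact hφ.isOpenMap _ ((hUo.preimage hπ.1).preimage continuous_subtype_val)
  · rw [image_comp, ← himg, hE]
  · intro y hy
    have hy0 : y ≠ 0 := norm_pos_iff.1 (hr.trans hy)
    have := hFφ _ (hmem y hy)
    rwa [coneNormal_conePatch he hJ hα0 hα hy0] at this

end ConicalEnd

namespace IsConicalGraph

variable {n : ℕ} {M : Type*} [TopologicalSpace M] [ChartedSpace (Euc n) M]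
  {F ν : M → Euc (n + 1)} {k : ℕ} {E : Set M} {e : Euc (n + 1)} {α : ℝ}
  {J : Euc n →ₗᵢ[ℝ] Euc (n + 1)} {r : ℝ} {w : Euc n → ℝ} {Φ : Euc n → M}

/-! ### Normal and support function of a conical graph -/

section Formulas

variable (h : IsConicalGraph k F E e α J r w Φ)
include h

lemma sin_pos : 0 < Real.sin α := sin_pos_of_angle h.angle_pos h.angle_le

lemma ne_zero {y : Euc n} (hy : r < ‖y‖) : y ≠ 0 := norm_pos_iff.1 (h.radius_pos.trans hy)

omit h in
lemma isOpen_domain (r : ℝ) : IsOpen {y : Euc n | r < ‖y‖} :=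
  isOpen_lt continuous_const continuous_norm

omit h in
lemma domain_mem_nhds {y : Euc n} (hy : r < ‖y‖) : {y : Euc n | r < ‖y‖} ∈ 𝓝 y :=
  (isOpen_domain r).mem_nhds hy

omit h in
lemma eventually_cobounded (r : ℝ) : ∀ᶠ y : Euc n in Bornology.cobounded (Euc n), r < ‖y‖ :=
  tendsto_norm_cobounded_atTop.eventually_gt_atTop r

lemma contDiffAt {y : Euc n} (hy : r < ‖y‖) : ContDiffAt ℝ k w y :=
  h.contDiffOn.contDiffAt (domain_mem_nhds hy)

lemma differentiableAt {y : Euc n} (hy : r < ‖y‖) : DifferentiableAt ℝ w y :=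
  (h.contDiffAt hy).differentiableAt (by have := h.one_le; norm_cast; lia)

lemma mdifferentiableAt {y : Euc n} (hy : r < ‖y‖) :
    MDifferentiableAt 𝓘(ℝ, Euc n) (𝓡 n) Φ y :=
  (h.contMDiffOn.contMDiffAt (domain_mem_nhds hy)).mdifferentiableAt
    (by have := h.one_le; norm_cast; lia)

lemma continuousOn : ContinuousOn Φ {y | r < ‖y‖} := h.contMDiffOn.continuousOn

omit h in
lemma contDiffAt_patch {j : ℕ∞ω} {y : Euc n} (hy : y ≠ 0) :
    ContDiffAt ℝ j (conePatch e α J) y :=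
  contDiffOn_conePatch.contDiffAt (isOpen_compl_singleton.mem_nhds hy)

omit h in
lemma contDiffAt_normal {j : ℕ∞ω} {y : Euc n} (hy : y ≠ 0) :
    ContDiffAt ℝ j (conePatchNormal e α J) y :=
  contDiffOn_conePatchNormal.contDiffAt (isOpen_compl_singleton.mem_nhds hy)

lemma eventuallyEq {y : Euc n} (hy : r < ‖y‖) :
    F ∘ Φ =ᶠ[𝓝 y] fun z => conePatch e α J z + w z • conePatchNormal e α J z := by
  filter_upwards [domain_mem_nhds hy] with z hz using h.apply_eq z hz

lemma fderiv_comp_apply {y : Euc n} (hy : r < ‖y‖) (v : Euc n) :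
    fderiv ℝ (F ∘ Φ) y v = fderiv ℝ (conePatch e α J) y v +
      (w y • fderiv ℝ (conePatchNormal e α J) y v + fderiv ℝ w y v • conePatchNormal e α J y) := by
  have hy0 := h.ne_zero hy
  have h1 := ((contDiffAt_patch hy0 (j := 1)).differentiableAt (by norm_num)).hasFDerivAt.add
    ((h.differentiableAt hy).hasFDerivAt.smul
      ((contDiffAt_normal hy0 (j := 1)).differentiableAt (by norm_num)).hasFDerivAt)
      (g := fun z => w z • conePatchNormal e α J z) (f := conePatch e α J)
  rw [(h.eventuallyEq hy).fderiv_eq, (h1 : HasFDerivAt (fun z => _ + _) _ _).fderiv]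
  rfl

lemma norm_sq_apply {y : Euc n} (hy : r < ‖y‖) :
    ‖F (Φ y)‖ ^ 2 = (‖y‖ / Real.sin α) ^ 2 + w y ^ 2 := by
  rw [h.apply_eq y hy, norm_add_sq_real, inner_smul_right,
    inner_conePatch_conePatchNormal h.norm_axis h.inner_axis h.sin_pos.ne' (h.ne_zero hy),
    norm_smul, norm_conePatchNormal h.norm_axis h.inner_axis (h.ne_zero hy),
    norm_conePatch h.norm_axis h.inner_axis h.angle_pos h.angle_le, Real.norm_eq_abs, mul_one,
    sq_abs, mul_zero, mul_zero, add_zero]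

/-- The differential of the graph in the radial direction. -/
lemma fderiv_comp_self {y : Euc n} (hy : r < ‖y‖) :
    fderiv ℝ (F ∘ Φ) y y = conePatch e α J y + fderiv ℝ w y y • conePatchNormal e α J y := by
  rw [h.fderiv_comp_apply hy, fderiv_conePatch_self (h.ne_zero hy),
    fderiv_conePatchNormal_self (h.ne_zero hy), smul_zero, zero_add]

/-- The differential of the graph in the directions tangential to the spheres. -/
lemma fderiv_comp_of_orthogonal {y v : Euc n} (hy : r < ‖y‖) (hv : inner ℝ y v = (0 : ℝ)) :
    fderiv ℝ (F ∘ Φ) y v = (1 - Real.cos α * (‖y‖⁻¹ * w y)) • J v +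
      fderiv ℝ w y v • conePatchNormal e α J y := by
  rw [h.fderiv_comp_apply hy, fderiv_conePatch_apply (h.ne_zero hy), hv,
    fderiv_conePatchNormal_of_orthogonal (h.ne_zero hy) hv]
  module

lemma norm_fderiv_comp_ge {y : Euc n} {K : ℝ} (hy : r < ‖y‖)
    (hK : ‖fderiv ℝ (conePatchNormal e α J) y‖ ≤ K) (v : Euc n) :
    (1 - |w y| * K - ‖fderiv ℝ w y‖) * ‖v‖ ≤ ‖fderiv ℝ (F ∘ Φ) y v‖ := by
  have h1 : ‖v‖ ≤ ‖fderiv ℝ (conePatch e α J) y v‖ := by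
    rw [fderiv_conePatch_apply (h.ne_zero hy), ← sq_le_sq₀ (norm_nonneg _) (norm_nonneg _),
      norm_add_smul_axis_sq h.norm_axis h.inner_axis]
    nlinarith
  have h2 : ‖w y • fderiv ℝ (conePatchNormal e α J) y v‖ ≤ |w y| * K * ‖v‖ := by
    rw [norm_smul, Real.norm_eq_abs, mul_assoc]
    gcongr
    exact ((fderiv ℝ (conePatchNormal e α J) y).le_opNorm v).trans (by gcongr)
  have h3 : ‖fderiv ℝ w y v • conePatchNormal e α J y‖ ≤ ‖fderiv ℝ w y‖ * ‖v‖ := by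
    rw [norm_smul, norm_conePatchNormal h.norm_axis h.inner_axis (h.ne_zero hy), mul_one]
    exact (fderiv ℝ w y).le_opNorm v
  rw [h.fderiv_comp_apply hy]
  have h4 := norm_sub_le_norm_add (fderiv ℝ (conePatch e α J) y v)
    (w y • fderiv ℝ (conePatchNormal e α J) y v + fderiv ℝ w y v • conePatchNormal e α J y)
  have h5 := norm_add_le (w y • fderiv ℝ (conePatchNormal e α J) y v)
    (fderiv ℝ w y v • conePatchNormal e α J y)
  linarith

variable (hF : IsOrientedHypersurface F ν)
include hF

lemma inner_fderiv_comp {y : Euc n} (hy : r < ‖y‖) (v : Euc n) :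
    inner ℝ (fderiv ℝ (F ∘ Φ) y v) (ν (Φ y)) = 0 := by
  rw [fderiv_comp_eq_dmap_comp hF.smooth (h.mdifferentiableAt hy)]
  exact hF.inner_dmap _ _

lemma inner_apply_normal {y : Euc n} (hy : r < ‖y‖) : inner ℝ (F (Φ y)) (ν (Φ y)) =
    (w y - fderiv ℝ w y y) * inner ℝ (conePatchNormal e α J y) (ν (Φ y)) := by
  have h1 := h.inner_fderiv_comp hF hy y
  rw [h.fderiv_comp_self hy, inner_add_left, inner_smul_left] at h1
  rw [h.apply_eq y hy, inner_add_left, inner_smul_left]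
  simp only [conj_trivial] at h1 ⊢
  linear_combination h1

lemma abs_inner_normal_le {y : Euc n} (hy : r < ‖y‖) :
    |inner ℝ (conePatchNormal e α J y) (ν (Φ y))| ≤ 1 := by
  refine (abs_real_inner_le_norm _ _).trans ?_
  rw [norm_conePatchNormal h.norm_axis h.inner_axis (h.ne_zero hy), hF.norm_normal, mul_one]

lemma abs_inner_apply_normal_le {y : Euc n} (hy : r < ‖y‖) :
    |inner ℝ (F (Φ y)) (ν (Φ y))| ≤ |w y| + ‖y‖ * ‖fderiv ℝ w y‖ := by
  rw [h.inner_apply_normal hF hy, abs_mul]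
  refine (mul_le_of_le_one_right (abs_nonneg _) (h.abs_inner_normal_le hF hy)).trans ?_
  refine (abs_sub _ _).trans ?_
  gcongr
  rw [mul_comm]
  exact (fderiv ℝ w y).le_opNorm y

/-- An infinitesimal rotation about the axis is tangential to the cone, and thus its normal
component along the graph is controlled by the derivative of the graph function. -/
lemma abs_inner_rotation_normal_le {p s : Euc (n + 1)} (hp : inner ℝ p e = (0 : ℝ))
    (hs : inner ℝ s e = (0 : ℝ)) {y : Euc n} (hy : r < ‖y‖) :
    |inner ℝ (rotationGenerator p s (F (Φ y))) (ν (Φ y))| ≤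
      ‖rotationGenerator p s‖ * (‖y‖ * ‖fderiv ℝ w y‖) := by
  have he : rotationGenerator p s e = 0 := rotationGenerator_apply_of_orthogonal hp hs
  have hperp : inner ℝ (rotationGenerator p s (J y)) e = (0 : ℝ) := by
    rw [rotationGenerator_apply, inner_sub_left, inner_smul_left, inner_smul_left, hp, hs]
    simp
  obtain ⟨v, hv⟩ : ∃ v, J v = rotationGenerator p s (J y) := by
    have hmem : rotationGenerator p s (J y) ∈ roundCone e (Real.pi / 2) := by
      change inner ℝ _ _ = _
      rw [hperp, Real.cos_pi_div_two, mul_zero]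
    obtain ⟨v, hv⟩ := exists_conePatch_eq h.norm_axis h.inner_axis (by positivity) le_rfl hmem
    exact ⟨v, by simpa [conePatch] using hv⟩
  have hyv : inner ℝ y v = (0 : ℝ) := by
    rw [← J.inner_map_map, hv, real_inner_comm, inner_rotationGenerator_self]
  have hvn : ‖v‖ ≤ ‖rotationGenerator p s‖ * ‖y‖ := by
    rw [← J.norm_map, hv, ← J.norm_map y]
    exact (rotationGenerator p s).le_opNorm _
  have h1 : rotationGenerator p s (F (Φ y)) =
      fderiv ℝ (F ∘ Φ) y v - fderiv ℝ w y v • conePatchNormal e α J y := by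
    rw [h.fderiv_comp_of_orthogonal hy hyv, h.apply_eq y hy, conePatch, conePatchNormal, hv]
    simp only [map_add, map_sub, map_smul, he]
    module
  rw [h1, inner_sub_left, h.inner_fderiv_comp hF hy, zero_sub, abs_neg, inner_smul_left, abs_mul]
  refine (mul_le_of_le_one_right (abs_nonneg _) (h.abs_inner_normal_le hF hy)).trans ?_
  simp only [conj_trivial]
  calc |fderiv ℝ w y v| ≤ ‖fderiv ℝ w y‖ * ‖v‖ := (fderiv ℝ w y).le_opNorm v
    _ ≤ ‖fderiv ℝ w y‖ * (‖rotationGenerator p s‖ * ‖y‖) := by gcongr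
    _ = _ := by ring

end Formulas

/-! ### Asymptotics of a conical graph -/

section Asymptotics

variable (h : IsConicalGraph k F E e α J r w Φ) (hF : IsOrientedHypersurface F ν)
include h hF

lemma tendsto_inner_apply_normal : Tendsto (fun y => inner ℝ (F (Φ y)) (ν (Φ y)))
    (Bornology.cobounded (Euc n)) (𝓝 0) := by
  have h1 := h.tendsto_zero.abs.add h.tendsto_fderiv
  rw [abs_zero, add_zero] at h1
  refine squeeze_zero_norm' ?_ h1
  filter_upwards [eventually_cobounded r] with y hy using h.abs_inner_apply_normal_le hF hy

lemma tendsto_inner_rotation_normal {p s : Euc (n + 1)} (hp : inner ℝ p e = (0 : ℝ))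
    (hs : inner ℝ s e = (0 : ℝ)) :
    Tendsto (fun y => inner ℝ (rotationGenerator p s (F (Φ y))) (ν (Φ y)))
    (Bornology.cobounded (Euc n)) (𝓝 0) := by
  have h1 := h.tendsto_fderiv.const_mul ‖rotationGenerator p s‖
  rw [mul_zero] at h1
  refine squeeze_zero_norm' ?_ h1
  filter_upwards [eventually_cobounded r] with y hy
    using h.abs_inner_rotation_normal_le hF hp hs hy

omit hF in
lemma eventually_norm_fderiv_comp_ge : ∀ᶠ y in Bornology.cobounded (Euc n),
    ∀ v, 1 / 2 * ‖v‖ ≤ ‖fderiv ℝ (F ∘ Φ) y v‖ := by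
  obtain ⟨K, hK0, hK⟩ := exists_norm_fderiv_le_of_homogeneous (d := 0)
    (contDiffOn_conePatchNormal (e := e) (α := α) (J := J) (k := 2)) (fun t ht y => by
      rw [conePatchNormal_smul ht, zpow_zero, one_smul])
  have h1 : Tendsto (fun y => |w y| * K + ‖y‖ * ‖fderiv ℝ w y‖) (Bornology.cobounded (Euc n))
      (𝓝 0) := by
    have := (h.tendsto_zero.abs.mul_const K).add h.tendsto_fderiv
    simpa using this
  filter_upwards [eventually_cobounded r, eventually_cobounded 1,
    h1.eventually (gt_mem_nhds (show (0 : ℝ) < 1 / 2 by norm_num))] with y hy hy1 hy2 v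
  have h2 : ‖fderiv ℝ (conePatchNormal e α J) y‖ ≤ K := by
    refine ((hK y (h.ne_zero hy)).2.1).trans (mul_le_of_le_one_right hK0 ?_)
    rw [show (0 : ℤ) - 1 = -1 by norm_num, zpow_neg_one]
    exact inv_le_one_of_one_le₀ hy1.le
  refine le_trans ?_ (h.norm_fderiv_comp_ge hy h2 v)
  have h3 : ‖fderiv ℝ w y‖ ≤ ‖y‖ * ‖fderiv ℝ w y‖ :=
    le_mul_of_one_le_left (norm_nonneg _) hy1.le
  gcongr
  linarith

omit hF in
/-- The second derivatives of a `C²` conical graph decay. -/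
lemma tendsto_norm_fderiv_fderiv_comp (hk : 2 ≤ k) :
    Tendsto (fun y => ‖fderiv ℝ (fderiv ℝ (F ∘ Φ)) y‖) (Bornology.cobounded (Euc n)) (𝓝 0) := by
  obtain ⟨K, hK0, hK⟩ := exists_norm_fderiv_le_of_homogeneous (d := 0)
    (contDiffOn_conePatchNormal (e := e) (α := α) (J := J) (k := 2)) (fun t ht y => by
      rw [conePatchNormal_smul ht, zpow_zero, one_smul])
  obtain ⟨K', hK'0, hK'⟩ := exists_norm_fderiv_le_of_homogeneous (d := 1)
    (contDiffOn_conePatch (e := e) (α := α) (J := J) (k := 2)) (fun t ht y => by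
      rw [conePatch_smul ht, zpow_one])
  have h1 : Tendsto (fun y => K' * ‖y‖⁻¹ + (|w y| * K + 2 * (‖y‖ * ‖fderiv ℝ w y‖) * K +
      ‖fderiv ℝ (fderiv ℝ w) y‖)) (Bornology.cobounded (Euc n)) (𝓝 0) := by
    have h2 : Tendsto (fun y : Euc n => ‖y‖⁻¹) (Bornology.cobounded (Euc n)) (𝓝 0) :=
      tendsto_inv_atTop_zero.comp tendsto_norm_cobounded_atTop
    have := (h2.const_mul K').add (((h.tendsto_zero.abs.mul_const K).add
      ((h.tendsto_fderiv.const_mul 2).mul_const K)).add (h.tendsto_fderiv_fderiv hk))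
    simpa using this
  refine squeeze_zero' (Eventually.of_forall fun y => norm_nonneg (fderiv ℝ (fderiv ℝ (F ∘ Φ)) y))
    ?_ h1
  filter_upwards [eventually_cobounded r, eventually_cobounded 1] with y hy hy1
  have hy0 := h.ne_zero hy
  have hpos : 0 < ‖y‖ := norm_pos_iff.2 hy0
  have hw : ContDiffAt ℝ 2 w y := (h.contDiffAt hy).of_le (by exact_mod_cast hk)
  have hG : ContDiffAt ℝ 2 (F ∘ Φ) y :=
    ((contDiffAt_patch hy0).add (hw.smul (contDiffAt_normal hy0))).congr_of_eventuallyEq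
      (h.eventuallyEq hy)
  have hinv : ‖y‖⁻¹ ≤ 1 := inv_le_one_of_one_le₀ hy1.le
  obtain ⟨-, -, hX2⟩ := hK' y hy0
  obtain ⟨-, hb1, hb2⟩ := hK y hy0
  rw [show (1 : ℤ) - 2 = -1 by norm_num, zpow_neg_one] at hX2
  rw [show (0 : ℤ) - 1 = -1 by norm_num, zpow_neg_one] at hb1
  have hb1' : ‖fderiv ℝ (conePatchNormal e α J) y‖ ≤ K :=
    hb1.trans (mul_le_of_le_one_right hK0 hinv)
  have hb2' : ‖fderiv ℝ (fderiv ℝ (conePatchNormal e α J)) y‖ ≤ K := by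
    refine hb2.trans (mul_le_of_le_one_right hK0 ?_)
    rw [show (0 : ℤ) - 2 = -2 by norm_num, zpow_neg]
    exact inv_le_one_of_one_le₀ (one_le_zpow₀ hy1.le (by norm_num))
  have hb0 := norm_conePatchNormal h.norm_axis h.inner_axis (α := α) hy0
  refine ContinuousLinearMap.opNorm_le_bound₂ _ (by positivity) fun u v => ?_
  rw [← fderiv_fderiv_apply hG]
  have h3 : (fun z => fderiv ℝ (F ∘ Φ) z v) =ᶠ[𝓝 y] fun z => fderiv ℝ (conePatch e α J) z v +
      (w z • fderiv ℝ (conePatchNormal e α J) z v +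
        fderiv ℝ w z v • conePatchNormal e α J z) := by
    filter_upwards [domain_mem_nhds hy] with z hz using h.fderiv_comp_apply hz v
  have hdX : DifferentiableAt ℝ (fun z => fderiv ℝ (conePatch e α J) z v) y :=
    (differentiableAt_fderiv_of_contDiffAt (contDiffAt_patch hy0)).clm_apply (by fun_prop)
  have hdb : DifferentiableAt ℝ (fun z => fderiv ℝ (conePatchNormal e α J) z v) y :=
    (differentiableAt_fderiv_of_contDiffAt (contDiffAt_normal hy0)).clm_apply (by fun_prop)
  have hdw : DifferentiableAt ℝ (fun z => fderiv ℝ w z v) y :=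
    (differentiableAt_fderiv_of_contDiffAt hw).clm_apply (by fun_prop)
  have hb := (contDiffAt_normal (e := e) (α := α) (J := J) hy0 (j := 1)).differentiableAt
    (by norm_num)
  have h4 : HasFDerivAt (fun z => fderiv ℝ (conePatch e α J) z v +
      (w z • fderiv ℝ (conePatchNormal e α J) z v +
        fderiv ℝ w z v • conePatchNormal e α J z)) _ y :=
    hdX.hasFDerivAt.add (((h.differentiableAt hy).hasFDerivAt.smul hdb.hasFDerivAt).add
      (hdw.hasFDerivAt.smul hb.hasFDerivAt))
  have h5 : fderiv ℝ (fun z => fderiv ℝ (F ∘ Φ) z v) y u =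
      fderiv ℝ (fderiv ℝ (conePatch e α J)) y u v +
      ((w y • fderiv ℝ (fderiv ℝ (conePatchNormal e α J)) y u v +
        fderiv ℝ w y u • fderiv ℝ (conePatchNormal e α J) y v) +
      (fderiv ℝ w y v • fderiv ℝ (conePatchNormal e α J) y u +
        fderiv ℝ (fderiv ℝ w) y u v • conePatchNormal e α J y)) := by
    rw [h3.fderiv_eq, h4.fderiv, ← fderiv_fderiv_apply hw,
      ← fderiv_fderiv_apply (contDiffAt_patch hy0), ← fderiv_fderiv_apply (contDiffAt_normal hy0)]
    rfl
  have hw1 : ‖fderiv ℝ w y‖ ≤ ‖y‖ * ‖fderiv ℝ w y‖ :=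
    le_mul_of_one_le_left (norm_nonneg _) hy1.le
  have b1 : ‖fderiv ℝ (fderiv ℝ (conePatch e α J)) y u v‖ ≤ K' * ‖y‖⁻¹ * (‖u‖ * ‖v‖) := by
    refine (ContinuousLinearMap.le_opNorm₂ _ _ _).trans ?_
    rw [mul_assoc]; gcongr
  have b2 : ‖w y • fderiv ℝ (fderiv ℝ (conePatchNormal e α J)) y u v‖ ≤
      |w y| * K * (‖u‖ * ‖v‖) := by
    rw [norm_smul, Real.norm_eq_abs, mul_assoc]
    gcongr
    refine (ContinuousLinearMap.le_opNorm₂ _ _ _).trans ?_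
    rw [mul_assoc]; gcongr
  have b3 (u v : Euc n) : ‖fderiv ℝ w y u • fderiv ℝ (conePatchNormal e α J) y v‖ ≤
      (‖y‖ * ‖fderiv ℝ w y‖) * K * (‖u‖ * ‖v‖) := by
    rw [norm_smul]
    calc _ ≤ (‖fderiv ℝ w y‖ * ‖u‖) * (‖fderiv ℝ (conePatchNormal e α J) y‖ * ‖v‖) := by
          gcongr <;> exact ContinuousLinearMap.le_opNorm _ _
      _ ≤ ((‖y‖ * ‖fderiv ℝ w y‖) * ‖u‖) * (K * ‖v‖) := by gcongr
      _ = _ := by ring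
  have b4 : ‖fderiv ℝ (fderiv ℝ w) y u v • conePatchNormal e α J y‖ ≤
      ‖fderiv ℝ (fderiv ℝ w) y‖ * (‖u‖ * ‖v‖) := by
    rw [norm_smul, hb0, mul_one, ← mul_assoc]
    exact ContinuousLinearMap.le_opNorm₂ _ _ _
  rw [h5, mul_assoc _ ‖u‖ ‖v‖]
  have b5 := b3 v u
  rw [mul_comm ‖v‖] at b5
  refine (norm_add_le _ _).trans ((add_le_add b1 ((norm_add_le _ _).trans (add_le_add
    ((norm_add_le _ _).trans (add_le_add b2 (b3 u v))) ((norm_add_le _ _).trans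
      (add_le_add b5 b4))))).trans (le_of_eq ?_))
  ring

variable [IsManifold (𝓡 n) ∞ M]

/-- The second fundamental form of a `C²` conical graph decays. -/
lemma eventually_norm_dmap_normal_le (hk : 2 ≤ k) {ε : ℝ} (hε : 0 < ε) :
    ∀ᶠ y in Bornology.cobounded (Euc n), ∀ v,
      ‖dmap ν (Φ y) v‖ ≤ ε * ‖dmap F (Φ y) v‖ := by
  have h1 := (h.tendsto_norm_fderiv_fderiv_comp hk).eventually
    (gt_mem_nhds (show (0 : ℝ) < ε / 4 by positivity))
  filter_upwards [eventually_cobounded r, h.eventually_norm_fderiv_comp_ge, h1]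
    with y hy hge hy1 v
  have hy0 := h.ne_zero hy
  have hw : ContDiffAt ℝ 2 w y := (h.contDiffAt hy).of_le (by exact_mod_cast hk)
  have hG : ContDiffAt ℝ 2 (F ∘ Φ) y :=
    ((contDiffAt_patch hy0).add (hw.smul (contDiffAt_normal hy0))).congr_of_eventuallyEq
      (h.eventuallyEq hy)
  obtain ⟨D, hD⟩ : ∃ D : Euc n →L[ℝ] Euc n,
      D = (mfderiv 𝓘(ℝ, Euc n) (𝓡 n) Φ y : Euc n →L[ℝ] Euc n) := ⟨_, rfl⟩
  have hDF : fderiv ℝ (F ∘ Φ) y = (dmap F (Φ y)).comp D := by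
    rw [hD]; exact fderiv_comp_eq_dmap_comp hF.smooth (h.mdifferentiableAt hy)
  have hDν : fderiv ℝ (ν ∘ Φ) y = (dmap ν (Φ y)).comp D := by
    rw [hD]; exact fderiv_comp_eq_dmap_comp hF.smooth_normal (h.mdifferentiableAt hy)
  have hDsurj : Function.Surjective D := by
    refine (LinearMap.injective_iff_surjective (f := (D : Euc n →ₗ[ℝ] Euc n))).1 ?_
    refine (injective_iff_map_eq_zero _).2 fun u hu => ?_
    have h2 := hge u
    rw [hDF, ContinuousLinearMap.comp_apply, show D u = 0 from hu, map_zero, norm_zero] at h2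
    exact norm_le_zero_iff.1 (by linarith)
  obtain ⟨u, rfl⟩ := hDsurj v
  obtain ⟨v', hv'⟩ := (hF.hypersurfacePatch (Φ y)).exists_fderiv_eq (z := dmap ν (Φ y) (D u))
    (by rw [localPatch_apply_self]; exact hF.inner_dmap_normal _ _)
  rw [← dmap_eq hF.smooth] at hv'
  obtain ⟨u', rfl⟩ := hDsurj v'
  have hνd : DifferentiableAt ℝ (ν ∘ Φ) y :=
    (((hF.smooth_normal (Φ y)).mdifferentiableAt (by simp)).comp y
      (h.mdifferentiableAt hy)).differentiableAt
  have hdd : DifferentiableAt ℝ (fun z => fderiv ℝ (F ∘ Φ) z u') y :=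
    (differentiableAt_fderiv_of_contDiffAt hG).clm_apply (by fun_prop)
  -- differentiate the orthogonality relation of the normal and the tangent vector
  have h3 : fderiv ℝ (fun z => inner ℝ (fderiv ℝ (F ∘ Φ) z u') ((ν ∘ Φ) z)) y u = (0 : ℝ) := by
    have : (fun z => inner ℝ (fderiv ℝ (F ∘ Φ) z u') ((ν ∘ Φ) z)) =ᶠ[𝓝 y] fun _ => (0 : ℝ) := by
      filter_upwards [domain_mem_nhds hy] with z hz using h.inner_fderiv_comp hF hz u'
    rw [this.fderiv_eq]
    simp
  rw [fderiv_inner_apply ℝ hdd hνd, fderiv_fderiv_apply hG] at h3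
  have h4 : ‖dmap ν (Φ y) (D u)‖ ^ 2 ≤
      ε / 4 * (‖u‖ * ‖u'‖) := by
    have h5 : ‖dmap ν (Φ y) (D u)‖ ^ 2 =
        -inner ℝ (fderiv ℝ (fderiv ℝ (F ∘ Φ)) y u u') ((ν ∘ Φ) y) := by
      rw [← real_inner_self_eq_norm_sq]
      nth_rewrite 1 [← hv']
      rw [hDF, hDν] at h3
      simp only [ContinuousLinearMap.comp_apply] at h3
      linarith
    rw [h5]
    refine (neg_le_abs _).trans ((abs_real_inner_le_norm _ _).trans ?_)
    rw [Function.comp_apply, hF.norm_normal, mul_one]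
    refine (ContinuousLinearMap.le_opNorm₂ _ _ _).trans ?_
    rw [mul_assoc]
    gcongr
  have h6 := hge u
  have h7 := hge u'
  rw [hDF, ContinuousLinearMap.comp_apply] at h6 h7
  rw [hv'] at h7
  by_contra! hlt
  have h8 : 0 < ‖dmap ν (Φ y) (D u)‖ := lt_of_le_of_lt (by positivity) hlt
  have h9 : ‖u‖ * ‖u'‖ ≤ (2 * ‖dmap F (Φ y) (D u)‖) * (2 * ‖dmap ν (Φ y) (D u)‖) := by
    gcongr <;> linarith
  have h10 := mul_lt_mul_of_pos_right hlt h8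
  nlinarith

end Asymptotics

end IsConicalGraph

/-! ### The intrinsic distance -/

section IntrinsicDistance

lemma IsPreconnected.subset_of_disjoint_frontier {X : Type*} [TopologicalSpace X] {S W : Set X}
    (hS : IsPreconnected S) (hW : IsOpen W) (hdisj : Disjoint S (frontier W))
    (hne : (S ∩ W).Nonempty) : S ⊆ W := by
  refine hS.subset_left_of_subset_union hW (isClosed_closure (s := W)).isOpen_compl
    (disjoint_compl_right_iff_subset.2 subset_closure) (fun x hx => ?_) hne
  by_cases hxW : x ∈ W
  · exact Or.inl hxW
  · refine Or.inr fun hxc => disjoint_left.1 hdisj hx ?_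
    rw [hW.frontier_eq]
    exact ⟨hxc, hxW⟩

variable {n : ℕ} {M : Type*} [TopologicalSpace M] [ChartedSpace (Euc n) M]
  {F ν : M → Euc (n + 1)}

/-- A curve which starts outside a small neighbourhood of `p` and ends at `p` crosses the boundary
of the neighbourhood, where `F` has a positive distance to `F p`. -/
lemma IsOrientedHypersurface.exists_le_intrinsicEDist [T2Space M] [IsManifold (𝓡 n) ∞ M]
    (hF : IsOrientedHypersurface F ν)
    {p : M} {U : Set M} (hU : U ∈ 𝓝 p) :
    ∃ c : ℝ≥0∞, 0 < c ∧ ∀ x ∉ U, c ≤ intrinsicEDist F x p := by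
  have : LocallyCompactSpace M := ChartedSpace.locallyCompactSpace (Euc n) M
  obtain ⟨V, hV, hinj⟩ := isLocallyInjective_iff_nhds.1 hF.isLocallyInjective p
  obtain ⟨K, hK, hKU, hKc⟩ := local_compact_nhds (inter_mem hU hV)
  have hpW : p ∈ interior K := mem_interior_iff_mem_nhds.2 hK
  have hfr : frontier (interior K) ⊆ K :=
    frontier_subset_closure.trans (closure_minimal interior_subset hKc.isClosed)
  have hfc : IsCompact (frontier (interior K)) := hKc.of_isClosed_subset isClosed_frontier hfr
  have hFp : F p ∉ F '' frontier (interior K) := by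
    rintro ⟨q, hq, hqp⟩
    have : q = p := hinj (hKU (hfr hq)).2 (mem_of_mem_nhds hV) hqp
    rw [this, isOpen_interior.frontier_eq] at hq
    exact hq.2 hpW
  obtain ⟨δ, hδ, hball⟩ := Metric.mem_nhds_iff.1
    ((hfc.image hF.smooth.continuous).isClosed.isOpen_compl.mem_nhds hFp)
  refine ⟨ENNReal.ofReal δ, ENNReal.ofReal_pos.2 hδ, fun x hx => ?_⟩
  rw [intrinsicEDist]
  refine le_iInf₂ fun γ ⟨hγ, hγ0, hγ1⟩ => ?_
  obtain ⟨t₀, ht₀, ht₀W⟩ : ∃ t₀ ∈ Icc (0 : ℝ) 1, γ t₀ ∈ frontier (interior K) := by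
    by_contra! hcon
    have h1 : γ '' Icc 0 1 ⊆ interior K := by
      refine (isPreconnected_Icc.image γ hγ.continuousOn).subset_of_disjoint_frontier
        isOpen_interior (disjoint_left.2 ?_) ⟨p, ⟨1, by simp, hγ1⟩, hpW⟩
      rintro _ ⟨t, ht, rfl⟩
      exact hcon t ht
    have h2 := h1 ⟨0, by simp, rfl⟩
    rw [hγ0] at h2
    exact hx (hKU (interior_subset h2)).1
  have hd : ContDiffOn ℝ 1 (F ∘ γ) (Icc 0 1) :=
    ((hF.smooth.of_le (by norm_cast)).comp_contMDiffOn hγ).contDiffOn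
  have h1 := enorm_sub_le_lintegral_deriv_of_contDiffOn_Icc
    (hd.mono (Icc_subset_Icc_left ht₀.1)) ht₀.2
  have h2 : ENNReal.ofReal δ ≤ ‖(F ∘ γ) 1 - (F ∘ γ) t₀‖ₑ := by
    rw [← ofReal_norm]
    refine ENNReal.ofReal_le_ofReal ?_
    by_contra! hlt
    refine hball (show F (γ t₀) ∈ Metric.ball (F p) δ from ?_) ⟨γ t₀, ht₀W, rfl⟩
    rw [Metric.mem_ball, dist_comm, dist_eq_norm, ← hγ1]
    exact hlt
  refine h2.trans (h1.trans ((lintegral_mono_set (Icc_subset_Icc_left ht₀.1)).trans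
    (le_of_eq ?_)))
  apply lintegral_congr_ae
  rw [← restrict_Ioo_eq_restrict_Icc]
  filter_upwards [self_mem_ae_restrict measurableSet_Ioo] with x hx
  rw [derivWithin_of_mem_nhds (Icc_mem_nhds hx.1 hx.2)]

/-- Convergence with respect to the intrinsic distance implies convergence in `M`. -/
lemma IsOrientedHypersurface.tendsto_of_intrinsicEDist [T2Space M] [IsManifold (𝓡 n) ∞ M]
    (hF : IsOrientedHypersurface F ν) {s : ℕ → M} {p : M}
    (hs : Tendsto (fun k => intrinsicEDist F (s k) p) atTop (𝓝 0)) : Tendsto s atTop (𝓝 p) := by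
  intro U hU
  obtain ⟨c, hc, h⟩ := hF.exists_le_intrinsicEDist hU
  change ∀ᶠ k in atTop, s k ∈ U
  filter_upwards [hs.eventually (gt_mem_nhds hc)] with k hk
  by_contra hkU
  exact absurd (h _ hkU) (not_le.2 hk)

/-- The length of a curve is at most the increment of a function whose derivative bounds the
speed. -/
lemma intrinsicEDist_le {γ : ℝ → M} (hγ : ContMDiffOn 𝓘(ℝ, ℝ) (𝓡 n) 1 γ (Icc 0 1))
    {g g' : ℝ → ℝ} (hg : ∀ t ∈ Icc (0 : ℝ) 1, HasDerivAt g (g' t) t)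
    (hg' : ContinuousOn g' (Icc 0 1))
    (hle : ∀ t ∈ Ioo (0 : ℝ) 1, ‖deriv (F ∘ γ) t‖ ≤ g' t) :
    intrinsicEDist F (γ 0) (γ 1) ≤ ENNReal.ofReal (g 1 - g 0) := by
  rw [intrinsicEDist]
  refine (iInf₂_le γ ⟨hγ, rfl, rfl⟩).trans ?_
  have hint : IntegrableOn g' (Icc 0 1) := hg'.integrableOn_Icc
  have h1 : ∫ t in Icc (0 : ℝ) 1, g' t = g 1 - g 0 := by
    rw [integral_Icc_eq_integral_Ioc, ← intervalIntegral.integral_of_le zero_le_one]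
    refine intervalIntegral.integral_eq_sub_of_hasDerivAt (fun t ht => hg t ?_) ?_
    · rwa [uIcc_of_le zero_le_one] at ht
    · rw [intervalIntegrable_iff_integrableOn_Icc_of_le zero_le_one]
      exact hint
  have hae : ∀ᵐ t ∂volume.restrict (Icc (0 : ℝ) 1),
      ‖derivWithin (F ∘ γ) (Icc 0 1) t‖ ≤ g' t := by
    rw [← restrict_Ioo_eq_restrict_Icc]
    filter_upwards [self_mem_ae_restrict measurableSet_Ioo] with t ht
    rw [derivWithin_of_mem_nhds (Icc_mem_nhds ht.1 ht.2)]
    exact hle t ht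
  rw [← h1, ofReal_integral_eq_lintegral_ofReal hint
    (hae.mono fun t ht => (norm_nonneg _).trans ht)]
  refine lintegral_mono_ae (hae.mono fun t ht => ?_)
  rw [← ofReal_norm]
  exact ENNReal.ofReal_le_ofReal ht

end IntrinsicDistance

/-! ### Connectedness of annuli -/

section Spheres

variable {n : ℕ}

lemma exists_ne_zero_inner_eq_zero (hn : 2 ≤ n) (y : Euc n) :
    ∃ v : Euc n, v ≠ 0 ∧ inner ℝ y v = (0 : ℝ) := by
  have h1 : Module.finrank ℝ (ℝ ∙ y) ≤ 1 := by
    have := finrank_span_finset_le_card (R := ℝ) {y}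
    rwa [Finset.coe_singleton, Finset.card_singleton] at this
  have h2 := (ℝ ∙ y).finrank_add_finrank_orthogonal
  rw [finrank_euclideanSpace_fin] at h2
  have h3 : 0 < Module.finrank ℝ (ℝ ∙ y)ᗮ := by
    by_contra h0
    rw [Nat.eq_zero_of_not_pos h0] at h2
    lia
  have := Module.nontrivial_of_finrank_pos (R := ℝ) h3
  obtain ⟨⟨v, hv⟩, hv0⟩ := exists_ne (0 : (ℝ ∙ y)ᗮ)
  exact ⟨v, fun h => hv0 (Subtype.ext h), Submodule.mem_orthogonal_singleton_iff_inner_right.1 hv⟩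

lemma isPreconnected_norm_mem (hn : 2 ≤ n) {I : Set ℝ} (hI : IsPreconnected I) (hpos : I ⊆ Ioi 0) :
    IsPreconnected {y : Euc n | ‖y‖ ∈ I} := by
  have hrank : 1 < Module.rank ℝ (Euc n) := by
    rw [rank_eq_card_basis (EuclideanSpace.basisFun (Fin n) ℝ).toBasis, Fintype.card_fin]
    exact_mod_cast hn
  have h1 := (hI.prod (isPreconnected_sphere hrank (0 : Euc n) 1)).image
    (fun q : ℝ × Euc n => q.1 • q.2) (by fun_prop)
  convert h1 using 1
  ext y
  constructor
  · intro hy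
    have hy0 : 0 < ‖y‖ := hpos hy
    refine ⟨(‖y‖, ‖y‖⁻¹ • y), ⟨hy, ?_⟩, ?_⟩
    · rw [mem_sphere_zero_iff_norm, norm_smul, norm_inv, norm_norm, inv_mul_cancel₀ hy0.ne']
    · simp [smul_smul, mul_inv_cancel₀ hy0.ne']
  · rintro ⟨⟨t, v⟩, ⟨ht, hv⟩, rfl⟩
    have ht0 : 0 < t := hpos ht
    rw [mem_sphere_zero_iff_norm] at hv
    change ‖t • v‖ ∈ I
    rwa [norm_smul, hv, mul_one, Real.norm_of_nonneg ht0.le]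

end Spheres

namespace IsConicalGraph

variable {n : ℕ} {M : Type*} [TopologicalSpace M] [ChartedSpace (Euc n) M]
  {F ν : M → Euc (n + 1)} {k : ℕ} {E : Set M} {e : Euc (n + 1)} {α : ℝ}
  {J : Euc n →ₗᵢ[ℝ] Euc (n + 1)} {r : ℝ} {w : Euc n → ℝ} {Φ : Euc n → M}

/-! ### Sign of the mean curvature on a conical graph -/

section Horizontal

variable (h : IsConicalGraph k F E e α J r w Φ)
include h

lemma apply_eq_horizontal {y : Euc n} (hy : r < ‖y‖) : F (Φ y) =
    (1 - Real.cos α * (‖y‖⁻¹ * w y)) • J y +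
      (Real.cos α / Real.sin α * ‖y‖ + Real.sin α * w y) • e := by
  rw [h.apply_eq y hy, conePatch, conePatchNormal]
  module

lemma tendsto_factor : Tendsto (fun y => 1 - Real.cos α * (‖y‖⁻¹ * w y))
    (Bornology.cobounded (Euc n)) (𝓝 1) := by
  have h2 : Tendsto (fun y : Euc n => ‖y‖⁻¹) (Bornology.cobounded (Euc n)) (𝓝 0) :=
    tendsto_inv_atTop_zero.comp tendsto_norm_cobounded_atTop
  have := ((h2.mul h.tendsto_zero).const_mul (Real.cos α)).const_sub 1
  simpa using this

omit h in
lemma tendsto_smul_cobounded {y : Euc n} (hy : y ≠ 0) :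
    Tendsto (fun t : ℝ => t • y) atTop (Bornology.cobounded (Euc n)) := by
  rw [← tendsto_norm_atTop_iff_cobounded]
  refine (tendsto_id.atTop_mul_const (norm_pos_iff.2 hy)).congr' ?_
  filter_upwards [eventually_ge_atTop 0] with t ht
  rw [norm_smul, Real.norm_of_nonneg ht, id]

variable [IsManifold (𝓡 n) ∞ M] (hF : IsOrientedHypersurface F ν) (hE : IsSelfExpander F ν)
  (hH : IsMeanConvex F ν)
include hF hE hH

/-- On a point of the graph which lies on the axis, the hypersurface would be transversal to the
axis, and its horizontal projection would cover a neighbourhood of the origin; but the graph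
projects into a cone. -/
lemma factor_ne_zero (hn : 2 ≤ n) {y₀ : Euc n} (hy₀ : r < ‖y₀‖) :
    1 - Real.cos α * (‖y₀‖⁻¹ * w y₀) ≠ 0 := by
  intro h0
  have hy0 := h.ne_zero hy₀
  have hpos : 0 < ‖y₀‖ := norm_pos_iff.2 hy0
  obtain ⟨q₀, hq₀⟩ : ∃ q₀, q₀ = Φ y₀ := ⟨_, rfl⟩
  obtain ⟨z₀, hFz⟩ : ∃ z₀ : ℝ, F q₀ = z₀ • e := by
    refine ⟨Real.cos α / Real.sin α * ‖y₀‖ + Real.sin α * w y₀, ?_⟩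
    rw [hq₀, h.apply_eq_horizontal hy₀, h0, zero_smul, zero_add]
  have hνe : inner ℝ e (ν q₀) ≠ (0 : ℝ) := by
    intro h1
    have h2 := hH q₀
    rw [hE q₀, hFz, inner_smul_left, h1] at h2
    simp at h2
  obtain ⟨π, hπ⟩ : ∃ π : Euc (n + 1) →L[ℝ] Euc n, ∀ (y : Euc n) (a : ℝ), π (J y + a • e) = y := by
    refine ⟨J.toContinuousLinearMap.adjoint, fun y a => ext_inner_left ℝ fun z => ?_⟩
    rw [ContinuousLinearMap.adjoint_inner_right, inner_add_right, inner_smul_right]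
    change inner ℝ (J z) (J y) + _ * inner ℝ (J z) e = _
    rw [h.inner_axis, mul_zero, add_zero, J.inner_map_map]
  have hdecomp : ∀ x : Euc (n + 1), ∃ (y : Euc n) (a : ℝ), x = J y + a • e := fun x => by
    have hmem : x - (inner ℝ x e : ℝ) • e ∈ roundCone e (Real.pi / 2) := by
      change inner ℝ _ _ = _
      rw [Real.cos_pi_div_two, mul_zero, inner_sub_left, inner_smul_left,
        real_inner_self_eq_norm_sq, h.norm_axis]
      simp
    obtain ⟨y, hy⟩ := exists_conePatch_eq h.norm_axis h.inner_axis (by positivity) le_rfl hmem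
    refine ⟨y, inner ℝ x e, ?_⟩
    have : J y = x - (inner ℝ x e : ℝ) • e := by simpa [conePatch] using hy
    rw [this, sub_add_cancel]
  -- the horizontal projection is a local diffeomorphism at `q₀`
  have hX := contDiffAt_localPatch hF.smooth q₀
  have hstrict : HasStrictFDerivAt (fun x => π (localPatch F q₀ x)) (π.comp (dmap F q₀))
      (extChartAt (𝓡 n) q₀ q₀) := by
    rw [dmap_eq hF.smooth]
    exact π.hasStrictFDerivAt.comp _ (hX.hasStrictFDerivAt (by simp))
  have hsurj : Function.Surjective (π.comp (dmap F q₀)) := by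
    refine (LinearMap.injective_iff_surjective
      (f := (π.comp (dmap F q₀) : Euc n →ₗ[ℝ] Euc n))).1 ?_
    refine (injective_iff_map_eq_zero _).2 fun v hv => ?_
    have hv' : π (dmap F q₀ v) = 0 := hv
    obtain ⟨y, a, hya⟩ := hdecomp (dmap F q₀ v)
    rw [hya, hπ] at hv'
    have h1 := hF.inner_dmap q₀ v
    rw [hya, hv', map_zero, zero_add, inner_smul_left] at h1
    have ha : a = 0 := by simpa [hνe] using h1
    rw [hv', ha, map_zero, zero_smul, zero_add] at hya
    exact hF.dmap_injective q₀ (hya.trans (map_zero _).symm)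
  have hmap := hstrict.map_nhds_eq_of_surj (LinearMap.range_eq_top.2 hsurj)
  rw [localPatch_apply_self, hFz, show π (z₀ • e) = 0 by simpa using hπ 0 z₀] at hmap
  have hU : Φ '' (Metric.ball y₀ ‖y₀‖ ∩ {y | r < ‖y‖}) ∈ 𝓝 q₀ :=
    (h.isOpen_image _ inter_subset_right (Metric.isOpen_ball.inter (isOpen_domain r))).mem_nhds
      ⟨y₀, ⟨Metric.mem_ball_self hpos, hy₀⟩, hq₀.symm⟩
  have hA : (fun x => π (localPatch F q₀ x)) ''
      ((extChartAt (𝓡 n) q₀).symm ⁻¹' (Φ '' (Metric.ball y₀ ‖y₀‖ ∩ {y | r < ‖y‖}))) ∈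
        𝓝 (0 : Euc n) := by
    rw [← hmap]
    refine image_mem_map ((continuousAt_extChartAt_symm q₀).preimage_mem_nhds ?_)
    rwa [extChartAt_to_inv]
  obtain ⟨v, hv0, hv⟩ := exists_ne_zero_inner_eq_zero hn y₀
  have hsm : ∀ᶠ t : ℝ in 𝓝[≠] 0, t • v ∈ (fun x => π (localPatch F q₀ x)) ''
      ((extChartAt (𝓡 n) q₀).symm ⁻¹' (Φ '' (Metric.ball y₀ ‖y₀‖ ∩ {y | r < ‖y‖}))) := by
    have hc : ContinuousAt (fun t : ℝ => t • v) 0 := by fun_prop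
    have := hc.preimage_mem_nhds (by rw [zero_smul]; exact hA)
    exact nhdsWithin_le_nhds this
  obtain ⟨t, ht, ht0⟩ := (hsm.and self_mem_nhdsWithin).exists
  obtain ⟨x, ⟨y, ⟨hyb, hyr⟩, hyx⟩, hxt⟩ := ht
  have hxt' : π (F (Φ y)) = t • v := by rw [hyx]; exact hxt
  rw [h.apply_eq_horizontal hyr, ← map_smul, hπ] at hxt'
  have hyy : 0 < inner ℝ y₀ y := by
    rw [Metric.mem_ball, dist_eq_norm] at hyb
    have h1 := norm_sub_sq_real y y₀
    rw [real_inner_comm] at h1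
    nlinarith [norm_nonneg (y - y₀), sq_nonneg ‖y‖, norm_pos_iff.2 (h.ne_zero hyr)]
  have h1 : (1 - Real.cos α * (‖y‖⁻¹ * w y)) * inner ℝ y₀ y = 0 := by
    rw [← inner_smul_right, hxt', inner_smul_right, hv, mul_zero]
  have h2 := (mul_eq_zero.1 h1).resolve_right hyy.ne'
  rw [h2, zero_smul] at hxt'
  exact (smul_ne_zero ht0 hv0) hxt'.symm

lemma factor_pos (hn : 2 ≤ n) {y : Euc n} (hy : r < ‖y‖) :
    0 < 1 - Real.cos α * (‖y‖⁻¹ * w y) := by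
  have hy0 := h.ne_zero hy
  have hmem : ∀ t ∈ Ici (1 : ℝ), r < ‖t • y‖ := fun t ht => by
    rw [norm_smul, Real.norm_of_nonneg (zero_le_one.trans ht)]
    exact hy.trans_le (le_mul_of_one_le_left (norm_nonneg _) ht)
  have hcont : ContinuousOn (fun t : ℝ => 1 - Real.cos α * (‖t • y‖⁻¹ * w (t • y))) (Ici 1) := by
    have h1 : ContinuousOn (fun t : ℝ => w (t • y)) (Ici 1) :=
      h.contDiffOn.continuousOn.comp (by fun_prop) hmem
    have h2 : ContinuousOn (fun t : ℝ => ‖t • y‖⁻¹) (Ici 1) :=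
      ContinuousOn.inv₀ (by fun_prop) fun t ht => (h.radius_pos.trans (hmem t ht)).ne'
    exact continuousOn_const.sub (continuousOn_const.mul (h2.mul h1))
  obtain ⟨t₁, ht₁, ht₁pos⟩ : ∃ t₁ ∈ Ici (1 : ℝ),
      0 < 1 - Real.cos α * (‖t₁ • y‖⁻¹ * w (t₁ • y)) := by
    have h1 := (h.tendsto_factor.comp (tendsto_smul_cobounded hy0)).eventually
      (lt_mem_nhds (zero_lt_one (α := ℝ)))
    obtain ⟨t, ht1, ht2⟩ := ((eventually_ge_atTop 1).and h1).exists
    exact ⟨t, ht1, ht2⟩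
  by_contra! hneg
  have h1 := isPreconnected_Ici.intermediate_value
    (show (1 : ℝ) ∈ Ici (1 : ℝ) from self_mem_Ici) ht₁ hcont
  obtain ⟨t, ht, ht0⟩ := h1 ⟨by simpa using hneg, ht₁pos.le⟩
  exact h.factor_ne_zero hF hE hH hn (hmem t ht) ht0

omit [IsManifold (𝓡 n) ∞ M] in
/-- Mean convexity gives `w - ∂w/∂log|y|` a constant sign, which makes `w / |y|` monotone along
rays. -/
lemma exists_sign (hn : 2 ≤ n) :
    ∃ σ : ℝ, (σ = 1 ∨ σ = -1) ∧ ∀ y, r < ‖y‖ → 0 < σ * (w y - fderiv ℝ w y y) := by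
  have hpre : IsPreconnected {y : Euc n | r < ‖y‖} :=
    isPreconnected_norm_mem hn (isPreconnected_Ioi (a := r))
      (Ioi_subset_Ioi h.radius_pos.le)
  have hcont : ContinuousOn (fun y => w y - fderiv ℝ w y y) {y | r < ‖y‖} :=
    h.contDiffOn.continuousOn.sub
      ((h.contDiffOn.continuousOn_fderiv_of_isOpen (isOpen_domain r)
        (by exact_mod_cast h.one_le)).clm_apply continuousOn_id)
  have hne : ∀ y, r < ‖y‖ → w y - fderiv ℝ w y y ≠ 0 := fun y hy h0 => by
    have h1 := hH (Φ y)
    rw [hE, h.inner_apply_normal hF hy, h0, zero_mul, mul_zero] at h1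
    exact lt_irrefl _ h1
  by_cases hall : ∀ y, r < ‖y‖ → 0 < w y - fderiv ℝ w y y
  · exact ⟨1, Or.inl rfl, fun y hy => by rw [one_mul]; exact hall y hy⟩
  · push Not at hall
    obtain ⟨y₁, hy₁, hneg⟩ := hall
    refine ⟨-1, Or.inr rfl, fun y hy => ?_⟩
    by_contra! hle
    obtain ⟨z, hz, hz0⟩ := hpre.intermediate_value hy₁ hy hcont ⟨hneg, by linarith⟩
    exact hne z hz hz0

end Horizontal

/-! ### Monotonicity and length of rays -/

section Rays

variable (h : IsConicalGraph k F E e α J r w Φ)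
include h

omit h in
lemma norm_smul_of_unit {θ : Euc n} (hθ : ‖θ‖ = 1) {τ : ℝ} (hτ : 0 ≤ τ) : ‖τ • θ‖ = τ := by
  rw [norm_smul, hθ, mul_one, Real.norm_of_nonneg hτ]

lemma lt_norm_smul {θ : Euc n} (hθ : ‖θ‖ = 1) {τ : ℝ} (hτ : r < τ) : r < ‖τ • θ‖ := by
  rwa [norm_smul_of_unit hθ (h.radius_pos.trans hτ).le]

lemma hasDerivAt_ray {θ : Euc n} (hθ : ‖θ‖ = 1) {τ : ℝ} (hτ : r < τ) :
    HasDerivAt (fun τ => τ⁻¹ * w (τ • θ))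
      (-((w (τ • θ) - fderiv ℝ w (τ • θ) (τ • θ)) / τ ^ 2)) τ := by
  have hτ0 : τ ≠ 0 := (h.radius_pos.trans hτ).ne'
  have h1 : HasDerivAt (fun τ : ℝ => w (τ • θ)) (fderiv ℝ w (τ • θ) ((1 : ℝ) • θ)) τ :=
    (h.differentiableAt (h.lt_norm_smul hθ hτ)).hasFDerivAt.comp_hasDerivAt τ
      ((hasDerivAt_id τ).smul_const θ)
  refine ((hasDerivAt_inv hτ0).mul h1).congr_deriv ?_
  rw [map_smul, map_smul, smul_eq_mul, smul_eq_mul]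
  field_simp
  ring

/-- Along rays `|w| / |y|` decreases to zero. -/
lemma antitoneOn_ray {σ : ℝ} (hσ : ∀ y, r < ‖y‖ → 0 < σ * (w y - fderiv ℝ w y y))
    {θ : Euc n} (hθ : ‖θ‖ = 1) : AntitoneOn (fun τ => σ * (τ⁻¹ * w (τ • θ))) (Ioi r) := by
  have hd : ∀ τ ∈ Ioi r, HasDerivAt (fun τ => σ * (τ⁻¹ * w (τ • θ)))
      (σ * -((w (τ • θ) - fderiv ℝ w (τ • θ) (τ • θ)) / τ ^ 2)) τ :=
    fun τ hτ => (h.hasDerivAt_ray hθ hτ).const_mul σ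
  refine antitoneOn_of_deriv_nonpos (convex_Ioi r)
    (fun τ hτ => (hd τ hτ).continuousAt.continuousWithinAt)
    (fun τ hτ => ((hd τ (interior_subset hτ)).differentiableAt).differentiableWithinAt) ?_
  intro τ hτ
  rw [interior_Ioi] at hτ
  rw [(hd τ hτ).deriv]
  have := hσ _ (h.lt_norm_smul hθ hτ)
  have h2 : 0 ≤ σ * (w (τ • θ) - fderiv ℝ w (τ • θ) (τ • θ)) / τ ^ 2 := by positivity
  rw [mul_neg, ← mul_div_assoc]
  linarith

lemma nonneg_ray {σ : ℝ} (hσ : ∀ y, r < ‖y‖ → 0 < σ * (w y - fderiv ℝ w y y))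
    {θ : Euc n} (hθ : ‖θ‖ = 1) {τ : ℝ} (hτ : r < τ) : 0 ≤ σ * (τ⁻¹ * w (τ • θ)) := by
  have hθ0 : θ ≠ 0 := norm_ne_zero_iff.1 (by rw [hθ]; exact one_ne_zero)
  have h1 : Tendsto (fun τ : ℝ => σ * (τ⁻¹ * w (τ • θ))) atTop (𝓝 0) := by
    have := (tendsto_inv_atTop_zero.mul
      (h.tendsto_zero.comp (tendsto_smul_cobounded hθ0))).const_mul σ
    simpa using this
  refine le_of_tendsto h1 ?_
  filter_upwards [eventually_ge_atTop τ] with τ' hτ'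
  exact h.antitoneOn_ray hσ hθ hτ (lt_of_lt_of_le hτ hτ') hτ'

/-- The speed of a ray is bounded by the derivative of a function which is bounded if `w / |y|`
is bounded along the ray. -/
lemma norm_fderiv_ray_le {σ : ℝ} (hσ1 : σ = 1 ∨ σ = -1)
    (hσ : ∀ y, r < ‖y‖ → 0 < σ * (w y - fderiv ℝ w y y))
    {θ : Euc n} (hθ : ‖θ‖ = 1) {A τ : ℝ} (hτ : r < τ) (hτ1 : τ ≤ r + 1)
    (hA : σ * (τ⁻¹ * w (τ • θ)) ≤ A) :
    ‖fderiv ℝ (F ∘ Φ) (τ • θ) θ‖ ≤ (Real.sin α)⁻¹ + A +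
      (r + 1) * (σ * ((w (τ • θ) - fderiv ℝ w (τ • θ) (τ • θ)) / τ ^ 2)) := by
  have hτ0 : 0 < τ := h.radius_pos.trans hτ
  have hmem := h.lt_norm_smul hθ hτ
  have hs := h.sin_pos
  have h1 := h.fderiv_comp_self hmem
  have h2 : fderiv ℝ (F ∘ Φ) (τ • θ) (τ • θ) = τ • fderiv ℝ (F ∘ Φ) (τ • θ) θ := map_smul _ _ _
  have h3 : τ * ‖fderiv ℝ (F ∘ Φ) (τ • θ) θ‖ ≤
      τ * (Real.sin α)⁻¹ + |fderiv ℝ w (τ • θ) (τ • θ)| := by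
    have h4 : τ * ‖fderiv ℝ (F ∘ Φ) (τ • θ) θ‖ = ‖τ • fderiv ℝ (F ∘ Φ) (τ • θ) θ‖ := by
      rw [norm_smul, Real.norm_of_nonneg hτ0.le]
    rw [h4, ← h2, h1]
    refine (norm_add_le _ _).trans (add_le_add (le_of_eq ?_) (le_of_eq ?_))
    · rw [norm_conePatch h.norm_axis h.inner_axis h.angle_pos h.angle_le,
        norm_smul_of_unit hθ hτ0.le, div_eq_mul_inv]
    · rw [norm_smul, norm_conePatchNormal h.norm_axis h.inner_axis (h.ne_zero hmem), mul_one,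
        Real.norm_eq_abs]
  obtain ⟨D, hD⟩ : ∃ D, D = w (τ • θ) - fderiv ℝ w (τ • θ) (τ • θ) := ⟨_, rfl⟩
  obtain ⟨m, hm⟩ : ∃ m, m = τ⁻¹ * w (τ • θ) := ⟨_, rfl⟩
  have hσD := hσ _ hmem
  have hm0 := h.nonneg_ray hσ hθ hτ
  rw [← hD] at hσD ⊢
  rw [← hm] at hA hm0
  have hw : w (τ • θ) = τ * m := by rw [hm, mul_inv_cancel_left₀ hτ0.ne']
  have h4 : fderiv ℝ w (τ • θ) (τ • θ) = τ * m - D := by rw [hD, ← hw]; ring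
  have h5 : |fderiv ℝ w (τ • θ) (τ • θ)| ≤ τ * A + σ * D := by
    rw [h4]
    have hmA : |m| ≤ A := by
      rcases hσ1 with rfl | rfl
      · rw [abs_of_nonneg (by linarith)]; linarith
      · rw [abs_of_nonpos (by linarith)]; linarith
    have hDA : |D| = σ * D := by
      rcases hσ1 with rfl | rfl
      · rw [abs_of_nonneg (by linarith)]; ring
      · rw [abs_of_nonpos (by linarith)]; ring
    calc |τ * m - D| ≤ |τ * m| + |D| := abs_sub _ _
      _ ≤ τ * A + σ * D := by
        rw [abs_mul, abs_of_pos hτ0, hDA]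
        gcongr
  have h6 : σ * D ≤ τ * ((r + 1) * (σ * (D / τ ^ 2))) := by
    have h7 : τ * ((r + 1) * (σ * (D / τ ^ 2))) = (σ * D) * ((r + 1) / τ) := by field_simp
    rw [h7]
    exact le_mul_of_one_le_right hσD.le ((one_le_div hτ0).2 hτ1)
  refine le_of_mul_le_mul_left ?_ hτ0
  calc _ ≤ _ := h3
    _ ≤ τ * (Real.sin α)⁻¹ + (τ * A + τ * ((r + 1) * (σ * (D / τ ^ 2)))) := by linarith
    _ = _ := by ring

end Rays

end IsConicalGraph

/-! ### The inner boundary of a parametrization along a bounded ray -/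

namespace IsConicalGraph

variable {n : ℕ} {M : Type*} [TopologicalSpace M] [ChartedSpace (Euc n) M]
  {F ν : M → Euc (n + 1)} {k : ℕ} {E : Set M} {e : Euc (n + 1)} {α : ℝ}
  {J : Euc n →ₗᵢ[ℝ] Euc (n + 1)} {r : ℝ} {w : Euc n → ℝ} {Φ : Euc n → M}
  (h : IsConicalGraph k F E e α J r w Φ)
include h

lemma differentiableAt_comp (hF : IsOrientedHypersurface F ν) {y : Euc n} (hy : r < ‖y‖) :
    DifferentiableAt ℝ (F ∘ Φ) y :=
  (((hF.smooth (Φ y)).mdifferentiableAt (by simp)).comp y (h.mdifferentiableAt hy)).differentiableAt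

/-- The function `H` is increasing along the ray and bounds its length from above. -/
lemma intrinsicEDist_ray_le (hF : IsOrientedHypersurface F ν) {σ : ℝ} (hσ1 : σ = 1 ∨ σ = -1)
    (hσ : ∀ y, r < ‖y‖ → 0 < σ * (w y - fderiv ℝ w y y)) {θ : Euc n} (hθ : ‖θ‖ = 1) {A : ℝ}
    (hA : ∀ τ ∈ Ioc r (r + 1), σ * (τ⁻¹ * w (τ • θ)) ≤ A) {H : ℝ → ℝ}
    (hH : ∀ τ, H τ = ((Real.sin α)⁻¹ + A) * τ - (r + 1) * (σ * (τ⁻¹ * w (τ • θ))))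
    {τ₁ τ₂ : ℝ} (h₁ : τ₁ ∈ Ioc r (r + 1)) (h₂ : τ₂ ∈ Ioc r (r + 1)) :
    intrinsicEDist F (Φ (τ₁ • θ)) (Φ (τ₂ • θ)) ≤ ENNReal.ofReal |H τ₂ - H τ₁| := by
  obtain ⟨c, hc⟩ : ∃ c : ℝ → ℝ, ∀ t, c t = τ₁ + t * (τ₂ - τ₁) := ⟨_, fun _ => rfl⟩
  have hcfun : c = fun t => τ₁ + t * (τ₂ - τ₁) := funext hc
  have hcmem : ∀ t ∈ Icc (0 : ℝ) 1, c t ∈ Ioc r (r + 1) := fun t ht => by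
    rw [hc]
    exact (convex_Ioc r (r + 1)).add_smul_sub_mem h₁ h₂ ht
  have hcd : ∀ t, HasDerivAt c (τ₂ - τ₁) t := fun t => by
    rw [hcfun]
    simpa using ((hasDerivAt_id t).mul_const (τ₂ - τ₁)).const_add τ₁
  obtain ⟨H', hH'⟩ : ∃ H' : ℝ → ℝ, ∀ τ, H' τ = (Real.sin α)⁻¹ + A +
      (r + 1) * (σ * ((w (τ • θ) - fderiv ℝ w (τ • θ) (τ • θ)) / τ ^ 2)) := ⟨_, fun _ => rfl⟩
  have hHd : ∀ τ, r < τ → HasDerivAt H (H' τ) τ := fun τ hτ => by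
    rw [show H = fun τ => ((Real.sin α)⁻¹ + A) * τ - (r + 1) * (σ * (τ⁻¹ * w (τ • θ))) from
      funext hH]
    refine (((hasDerivAt_id τ).const_mul _).sub
      (((h.hasDerivAt_ray hθ hτ).const_mul σ).const_mul (r + 1))).congr_deriv ?_
    rw [hH']
    ring
  obtain ⟨ε, hε1, hε⟩ : ∃ ε : ℝ, |ε| = 1 ∧ ε * (τ₂ - τ₁) = |τ₂ - τ₁| := by
    rcases le_total 0 (τ₂ - τ₁) with h0 | h0
    · exact ⟨1, by simp, by rw [one_mul, abs_of_nonneg h0]⟩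
    · exact ⟨-1, by simp, by rw [abs_of_nonpos h0]; ring⟩
  have hγ : ContMDiffOn 𝓘(ℝ, ℝ) (𝓡 n) 1 (fun t => Φ (c t • θ)) (Icc 0 1) := by
    have h3 : ContMDiffOn 𝓘(ℝ, Euc n) (𝓡 n) 1 Φ {y | r < ‖y‖} :=
      h.contMDiffOn.of_le (by exact_mod_cast h.one_le)
    have h4 : ContDiff ℝ 1 fun t => c t • θ := by
      rw [hcfun]; fun_prop
    exact h3.comp h4.contMDiff.contMDiffOn fun t ht => h.lt_norm_smul hθ (hcmem t ht).1
  have hgd : ∀ t ∈ Icc (0 : ℝ) 1, HasDerivAt (fun t => ε * H (c t)) (|τ₂ - τ₁| * H' (c t)) t :=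
    fun t ht => by
      refine (((hHd _ (hcmem t ht).1).comp t (hcd t)).const_mul ε).congr_deriv ?_
      rw [← hε]; ring
  have hg' : ContinuousOn (fun t => |τ₂ - τ₁| * H' (c t)) (Icc 0 1) := by
    have hcc : ContinuousOn c (Icc 0 1) := by rw [hcfun]; fun_prop
    have h3 : ContinuousOn (fun y => w y - fderiv ℝ w y y) {y | r < ‖y‖} :=
      h.contDiffOn.continuousOn.sub
        ((h.contDiffOn.continuousOn_fderiv_of_isOpen (isOpen_domain r)
          (by exact_mod_cast h.one_le)).clm_apply continuousOn_id)
    have h4 : ContinuousOn (fun t => w (c t • θ) - fderiv ℝ w (c t • θ) (c t • θ)) (Icc 0 1) :=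
      h3.comp (hcc.smul continuousOn_const) fun t ht => h.lt_norm_smul hθ (hcmem t ht).1
    simp only [hH']
    refine continuousOn_const.mul (continuousOn_const.add (continuousOn_const.mul
      (continuousOn_const.mul (h4.div (hcc.pow 2) fun t ht => ?_))))
    exact pow_ne_zero _ (h.radius_pos.trans (hcmem t ht).1).ne'
  have hle : ∀ t ∈ Ioo (0 : ℝ) 1, ‖deriv (F ∘ fun t => Φ (c t • θ)) t‖ ≤ |τ₂ - τ₁| * H' (c t) :=
    fun t ht => by
      have hct := hcmem t (Ioo_subset_Icc_self ht)
      have h3 : HasDerivAt (F ∘ fun t => Φ (c t • θ))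
          (fderiv ℝ (F ∘ Φ) (c t • θ) ((τ₂ - τ₁) • θ)) t :=
        (h.differentiableAt_comp hF (h.lt_norm_smul hθ hct.1)).hasFDerivAt.comp_hasDerivAt t
          ((hcd t).smul_const θ)
      rw [h3.deriv, map_smul, norm_smul, Real.norm_eq_abs, hH']
      gcongr
      exact h.norm_fderiv_ray_le hσ1 hσ hθ hct.1 hct.2 (hA _ hct)
  have h3 := intrinsicEDist_le (F := F) hγ hgd hg' hle
  have hc0 : c 0 = τ₁ := by rw [hc]; ring
  have hc1 : c 1 = τ₂ := by rw [hc]; ring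
  simp only [hc0, hc1] at h3
  refine h3.trans (ENNReal.ofReal_le_ofReal ?_)
  rw [← mul_sub]
  refine (le_abs_self _).trans ?_
  rw [abs_mul, hε1, one_mul]

/-- If the inner part of the parametrization stays in a compact set, then the end is the outer
part up to a compact set. -/
lemma exists_isCompact_of_annulus {δ : ℝ} (hδ : 0 < δ) {K : Set M} (hK : IsCompact K)
    (hKΦ : ∀ y, r < ‖y‖ → ‖y‖ < r + δ → Φ y ∈ K) (R : ℝ) :
    ∃ K', IsCompact K' ∧ E ⊆ K' ∪ Φ '' {y | r < ‖y‖ ∧ R < ‖y‖} := by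
  have hc : IsCompact {y : Euc n | r + δ ≤ ‖y‖ ∧ ‖y‖ ≤ R} := by
    refine (isCompact_closedBall (0 : Euc n) R).of_isClosed_subset
      ((isClosed_le continuous_const continuous_norm).inter
        (isClosed_le continuous_norm continuous_const)) fun y hy => ?_
    rw [mem_closedBall_zero_iff]
    exact hy.2
  refine ⟨K ∪ Φ '' {y | r + δ ≤ ‖y‖ ∧ ‖y‖ ≤ R}, hK.union (hc.image_of_continuousOn
    (h.continuousOn.mono fun y hy => ?_)), ?_⟩
  · have := hy.1
    change r < ‖y‖
    linarith
  · rw [← h.image_eq]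
    rintro _ ⟨y, hy, rfl⟩
    by_cases h1 : ‖y‖ < r + δ
    · exact Or.inl (Or.inl (hKΦ y hy h1))
    · by_cases h2 : ‖y‖ ≤ R
      · exact Or.inl (Or.inr ⟨y, ⟨not_lt.1 h1, h2⟩, rfl⟩)
      · exact Or.inr ⟨y, ⟨hy, not_le.1 h2⟩, rfl⟩

/-- If some sequence escaping through the inner boundary of the parametrization converges, then its
limit is a frontier point of the end, and the whole inner part stays near the frontier. -/
lemma exists_annulus_of_tendsto [T2Space M] (hend : IsEnd E) (hn : 2 ≤ n) {p : M} {y : ℕ → Euc n}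
    (hy : ∀ j, r < ‖y j‖) (hyr : Tendsto (fun j => ‖y j‖) atTop (𝓝 r))
    (hp : Tendsto (fun j => Φ (y j)) atTop (𝓝 p)) :
    ∃ (δ : ℝ) (K : Set M), 0 < δ ∧ IsCompact K ∧
      ∀ y, r < ‖y‖ → ‖y‖ < r + δ → Φ y ∈ K := by
  have : LocallyCompactSpace M := ChartedSpace.locallyCompactSpace (Euc n) M
  have hmemE : ∀ y, r < ‖y‖ → Φ y ∈ E := fun y hy => by
    rw [← h.image_eq]; exact ⟨y, hy, rfl⟩
  have hpE : p ∉ E := by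
    intro hpE
    rw [← h.image_eq] at hpE
    obtain ⟨z, hz, rfl⟩ := hpE
    have hz' : r < ‖z‖ := hz
    have hopen : IsOpen (Φ '' {y | (r + ‖z‖) / 2 < ‖y‖}) :=
      h.isOpen_image _ (fun y hy => by
        have : (r + ‖z‖) / 2 < ‖y‖ := hy
        change r < ‖y‖
        linarith) (isOpen_domain _)
    have h1 := hp.eventually (hopen.mem_nhds
      ⟨z, show (r + ‖z‖) / 2 < ‖z‖ by linarith, rfl⟩)
    have h2 := hyr.eventually (gt_mem_nhds (show r < (r + ‖z‖) / 2 by linarith))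
    obtain ⟨j, ⟨x, hx, hxy⟩, hj⟩ := (h1.and h2).exists
    have hx' : (r + ‖z‖) / 2 < ‖x‖ := hx
    have : x = y j := h.injOn (show r < ‖x‖ by linarith) (hy j) hxy
    rw [this] at hx'
    linarith
  have hpcl : p ∈ closure E := mem_closure_of_tendsto hp
    (Eventually.of_forall fun j => hmemE _ (hy j))
  have hpfr : p ∈ frontier E := by
    rw [hend.isOpen.frontier_eq]; exact ⟨hpcl, hpE⟩
  obtain ⟨K, hK, hKE⟩ := exists_compact_superset hend.compact_frontier
  -- the boundary of the neighbourhood `interior K` of the frontier meets the end in a compact set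
  have hfrK : frontier (interior K) ⊆ K :=
    frontier_subset_closure.trans (closure_minimal interior_subset hK.isClosed)
  have hAc : IsCompact (frontier (interior K) ∩ closure E) :=
    (hK.of_isClosed_subset isClosed_frontier hfrK).inter_right isClosed_closure
  have hAE : frontier (interior K) ∩ closure E ⊆ E := by
    rintro x ⟨hx1, hx2⟩
    by_contra hxE
    have : x ∈ frontier E := by
      rw [hend.isOpen.frontier_eq]; exact ⟨hx2, hxE⟩
    rw [isOpen_interior.frontier_eq] at hx1
    exact hx1.2 (hKE this)
  obtain ⟨δ, hδ, hAδ⟩ : ∃ δ : ℝ, 0 < δ ∧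
      frontier (interior K) ∩ closure E ⊆ Φ '' {y | r + δ < ‖y‖} := by
    suffices hcov : ∃ j : ℕ, frontier (interior K) ∩ closure E ⊆
        Φ '' {y | r + 1 / ((j : ℝ) + 1) < ‖y‖} by
      obtain ⟨j, hj⟩ := hcov
      exact ⟨1 / ((j : ℝ) + 1), by positivity, hj⟩
    refine hAc.elim_directed_cover _ (fun j => ?_) (fun x hx => ?_) ?_
    · refine h.isOpen_image _ (fun y hy => ?_) (isOpen_domain _)
      have h1 : r + 1 / ((j : ℝ) + 1) < ‖y‖ := hy
      have h2 : (0 : ℝ) < 1 / ((j : ℝ) + 1) := by positivity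
      change r < ‖y‖
      linarith
    · have hxE := hAE hx
      rw [← h.image_eq] at hxE
      obtain ⟨z, hz, rfl⟩ := hxE
      obtain ⟨j, hj⟩ := exists_nat_one_div_lt (sub_pos.2 (show r < ‖z‖ from hz))
      exact mem_iUnion.2 ⟨j, z, show r + 1 / ((j : ℝ) + 1) < ‖z‖ by linarith, rfl⟩
    · refine Monotone.directed_le fun i j hij => image_mono fun y hy => ?_
      have h1 : r + 1 / ((i : ℝ) + 1) < ‖y‖ := hy
      have h2 : 1 / ((j : ℝ) + 1) ≤ 1 / ((i : ℝ) + 1) :=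
        one_div_le_one_div_of_le (by positivity) (by gcongr)
      change r + 1 / ((j : ℝ) + 1) < ‖y‖
      linarith
  refine ⟨δ, K, hδ, hK, fun x hx hxδ => interior_subset ?_⟩
  have hsub : Φ '' {y | ‖y‖ ∈ Ioo r (r + δ)} ⊆ interior K := by
    refine ((isPreconnected_norm_mem hn isPreconnected_Ioo (fun t ht =>
      h.radius_pos.trans ht.1)).image Φ (h.continuousOn.mono fun y hy => hy.1)
      ).subset_of_disjoint_frontier isOpen_interior (disjoint_left.2 ?_) ?_
    · rintro _ ⟨y, hy, rfl⟩ hfr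
      obtain ⟨z, hz, hzy⟩ := hAδ ⟨hfr, subset_closure (hmemE y hy.1)⟩
      have hz' : r + δ < ‖z‖ := hz
      have : z = y := h.injOn (show r < ‖z‖ by linarith) hy.1 hzy
      rw [this] at hz'
      exact absurd hy.2 (not_lt.2 hz'.le)
    · have h1 := hp.eventually (isOpen_interior.mem_nhds (hKE hpfr))
      have h2 := hyr.eventually (gt_mem_nhds (show r < r + δ by linarith))
      obtain ⟨j, hj1, hj2⟩ := (h1.and h2).exists
      exact ⟨Φ (y j), ⟨y j, ⟨hy j, hj2⟩, rfl⟩, hj1⟩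
  exact hsub ⟨x, ⟨hx, hxδ⟩, rfl⟩

/-- If `w / |y|` is bounded along one ray, then this ray has finite length, and by completeness it
ends at the frontier of the end. -/
lemma exists_annulus_of_bounded_ray [T2Space M] [IsManifold (𝓡 n) ∞ M]
    (hF : IsOrientedHypersurface F ν) (hcomplete : IsCompleteHypersurface F) (hend : IsEnd E)
    (hn : 2 ≤ n) {σ : ℝ} (hσ1 : σ = 1 ∨ σ = -1)
    (hσ : ∀ y, r < ‖y‖ → 0 < σ * (w y - fderiv ℝ w y y)) {θ : Euc n} (hθ : ‖θ‖ = 1) {A : ℝ}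
    (hA : ∀ τ ∈ Ioc r (r + 1), σ * (τ⁻¹ * w (τ • θ)) ≤ A) :
    ∃ (δ : ℝ) (K : Set M), 0 < δ ∧ IsCompact K ∧
      ∀ y, r < ‖y‖ → ‖y‖ < r + δ → Φ y ∈ K := by
  obtain ⟨H, hH⟩ : ∃ H : ℝ → ℝ, ∀ τ, H τ =
    ((Real.sin α)⁻¹ + A) * τ - (r + 1) * (σ * (τ⁻¹ * w (τ • θ))) := ⟨_, fun _ => rfl⟩
  obtain ⟨τ, hτ⟩ : ∃ τ : ℕ → ℝ, ∀ j, τ j = r + 1 / ((j : ℝ) + 1) := ⟨_, fun _ => rfl⟩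
  have hτmem : ∀ j, τ j ∈ Ioc r (r + 1) := fun j => by
    have h1 : (0 : ℝ) < 1 / ((j : ℝ) + 1) := by positivity
    have h2 : 1 / ((j : ℝ) + 1) ≤ 1 := by
      rw [div_le_one (by positivity)]
      have : (0 : ℝ) ≤ j := Nat.cast_nonneg j
      linarith
    rw [hτ]
    exact ⟨by linarith, by linarith⟩
  have hτlim : Tendsto τ atTop (𝓝 r) := by
    have := (tendsto_one_div_add_atTop_nhds_zero_nat (𝕜 := ℝ)).const_add r
    rw [add_zero] at this
    exact this.congr fun j => (hτ j).symm
  have hτanti : Antitone τ := fun i j hij => by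
    rw [hτ, hτ]
    gcongr
  have hmono : Monotone fun j => σ * ((τ j)⁻¹ * w (τ j • θ)) := fun i j hij =>
    h.antitoneOn_ray hσ hθ (hτmem j).1 (hτmem i).1 (hτanti hij)
  obtain ⟨L, hL⟩ : ∃ L, Tendsto (fun j => σ * ((τ j)⁻¹ * w (τ j • θ))) atTop (𝓝 L) :=
    ⟨_, tendsto_atTop_ciSup hmono ⟨A, by rintro _ ⟨j, rfl⟩; exact hA _ (hτmem j)⟩⟩
  have hHlim : CauchySeq fun j => H (τ j) := by
    simp only [hH]
    exact ((hτlim.const_mul _).sub (hL.const_mul _)).cauchySeq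
  obtain ⟨p, hp⟩ := hcomplete (fun j => Φ (τ j • θ)) fun ε hε => by
    obtain ⟨d, hd0, hdε⟩ := ENNReal.lt_iff_exists_nnreal_btwn.1 hε
    obtain ⟨N, hN⟩ := Metric.cauchySeq_iff.1 hHlim d (by exact_mod_cast hd0)
    refine ⟨N, fun i hi j hj => lt_of_le_of_lt (h.intrinsicEDist_ray_le hF hσ1 hσ hθ hA hH
      (hτmem i) (hτmem j)) (lt_trans ?_ hdε)⟩
    have h1 := hN j hj i hi
    rw [Real.dist_eq] at h1
    rw [← ENNReal.ofReal_coe_nnreal]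
    exact (ENNReal.ofReal_lt_ofReal_iff (by exact_mod_cast hd0)).2 h1
  refine h.exists_annulus_of_tendsto hend hn (y := fun j => τ j • θ)
    (fun j => h.lt_norm_smul hθ (hτmem j).1) ?_ (hF.tendsto_of_intrinsicEDist hp)
  refine hτlim.congr fun j => (norm_smul_of_unit hθ (h.radius_pos.trans (hτmem j).1).le).symm

end IsConicalGraph

/-! ### Blow-up of the graph function at the inner boundary -/

namespace IsConicalGraph

variable {n : ℕ} {M : Type*} [TopologicalSpace M] [ChartedSpace (Euc n) M]
  {F ν : M → Euc (n + 1)} {k : ℕ} {E : Set M} {e : Euc (n + 1)} {α : ℝ}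
  {J : Euc n →ₗᵢ[ℝ] Euc (n + 1)} {r : ℝ} {w : Euc n → ℝ} {Φ : Euc n → M}
  (h : IsConicalGraph k F E e α J r w Φ)
include h

/-- If `w / |y|` is unbounded along every ray, then it tends to infinity uniformly at the inner
boundary, by monotonicity along rays and compactness of the sphere. -/
lemma exists_forall_lt_of_unbounded {σ : ℝ}
    (hσ : ∀ y, r < ‖y‖ → 0 < σ * (w y - fderiv ℝ w y y))
    (hunb : ∀ θ : Euc n, ‖θ‖ = 1 → ∀ A, ∃ τ ∈ Ioc r (r + 1), A < σ * (τ⁻¹ * w (τ • θ))) (A : ℝ) :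
    ∃ δ, 0 < δ ∧ δ ≤ 1 ∧ ∀ y, r < ‖y‖ → ‖y‖ ≤ r + δ → A < σ * (‖y‖⁻¹ * w y) := by
  by_contra! hcon
  have hex : ∀ j : ℕ, ∃ y : Euc n, r < ‖y‖ ∧ ‖y‖ ≤ r + 1 / ((j : ℝ) + 1) ∧
      σ * (‖y‖⁻¹ * w y) ≤ A := fun j => by
    refine hcon _ (by positivity) ?_
    rw [div_le_one (by positivity)]
    have : (0 : ℝ) ≤ j := Nat.cast_nonneg j
    linarith
  choose y hy hyj hyA using hex
  have hunit : ∀ j, ‖‖y j‖⁻¹ • y j‖ = 1 := fun j => by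
    rw [norm_smul, norm_inv, norm_norm, inv_mul_cancel₀ (h.radius_pos.trans (hy j)).ne']
  obtain ⟨θ, hθ, f, hf, hlim⟩ := (isCompact_sphere (0 : Euc n) 1).tendsto_subseq
    (x := fun j => ‖y j‖⁻¹ • y j) fun j => mem_sphere_zero_iff_norm.2 (hunit j)
  have hθ1 : ‖θ‖ = 1 := mem_sphere_zero_iff_norm.1 hθ
  obtain ⟨τ, hτ, hτA⟩ := hunb θ hθ1 A
  have hcont : ContinuousAt (fun θ => σ * (τ⁻¹ * w (τ • θ))) θ := by
    have h1 : ContinuousAt w (τ • θ) :=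
      (h.differentiableAt (h.lt_norm_smul hθ1 hτ.1)).continuousAt
    have h2 : ContinuousAt (fun θ => w (τ • θ)) θ :=
      ContinuousAt.comp (f := fun θ : Euc n => τ • θ) h1 (by fun_prop)
    exact continuousAt_const.mul (continuousAt_const.mul h2)
  have h1 := (hcont.tendsto.comp hlim).eventually (lt_mem_nhds hτA)
  have h2 : ∀ᶠ j in atTop, 1 / ((f j : ℝ) + 1) < τ - r :=
    (tendsto_one_div_add_atTop_nhds_zero_nat.comp hf.tendsto_atTop).eventually
      (gt_mem_nhds (sub_pos.2 hτ.1))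
  obtain ⟨j, hj1, hj2⟩ := (h1.and h2).exists
  have hj1' : A < σ * (τ⁻¹ * w (τ • (‖y (f j)‖⁻¹ • y (f j)))) := hj1
  have h3 := h.antitoneOn_ray hσ (hunit (f j)) (hy (f j)) hτ.1 (by linarith [hyj (f j)])
  have h4 : ‖y (f j)‖ • (‖y (f j)‖⁻¹ • y (f j)) = y (f j) := by
    rw [smul_smul, mul_inv_cancel₀ (h.radius_pos.trans (hy _)).ne', one_smul]
  simp only [h4] at h3
  linarith [hyA (f j)]

/-- The support of the graph in direction of the ray through `y₀` is at most the distance of the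
foot point on the cone to the vertex. -/
lemma inner_apply_ray (hpos : ∀ y, r < ‖y‖ → 0 < 1 - Real.cos α * (‖y‖⁻¹ * w y))
    {θ : Euc n} (hθ : ‖θ‖ = 1) {y : Euc n} (hy : r < ‖y‖) :
    inner ℝ (F (Φ y)) (J (Real.sin α • θ) + Real.cos α • e) ≤ ‖y‖ / Real.sin α ∧
    (y = ‖y‖ • θ → inner ℝ (F (Φ y)) (J (Real.sin α • θ) + Real.cos α • e) = ‖y‖ / Real.sin α) := by
  have hs := h.sin_pos
  have hy0 : ‖y‖ ≠ 0 := (h.radius_pos.trans hy).ne'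
  have h1 : inner ℝ (F (Φ y)) (J (Real.sin α • θ) + Real.cos α • e) =
      ‖y‖ / Real.sin α - (1 - Real.cos α * (‖y‖⁻¹ * w y)) * Real.sin α *
        (‖y‖ - inner ℝ y θ) := by
    rw [h.apply_eq_horizontal hy, ← map_smul, inner_add_smul_axis h.norm_axis h.inner_axis,
      inner_smul_left, inner_smul_right]
    simp only [conj_trivial]
    field_simp
    linear_combination ‖y‖ ^ 2 * Real.sin_sq_add_cos_sq α
  have h2 : inner ℝ y θ ≤ ‖y‖ := by
    have := real_inner_le_norm y θ
    rwa [hθ, mul_one] at this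
  constructor
  · rw [h1]
    have := mul_nonneg (mul_nonneg (hpos y hy).le hs.le) (sub_nonneg.2 h2)
    linarith
  · intro hyθ
    have h3 : inner ℝ y θ = ‖y‖ := by
      conv_lhs => rw [hyθ]
      rw [inner_smul_left, real_inner_self_eq_norm_sq, hθ]
      simp
    rw [h1, h3, sub_self, mul_zero, sub_zero]

end IsConicalGraph

/-! ### A barrier in the squared distance to the origin -/

section Barrier

/-- The barrier function of the squared distance to the origin. -/
lemma hasDerivAt_barrier {B S ε s : ℝ} (hs : 0 < s) :
    HasDerivAt (fun s => B * (1 - S / s) - ε * Real.log (1 + s))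
      (B * S / s ^ 2 - ε / (1 + s)) s := by
  have h1 := ((hasDerivAt_inv hs.ne').const_mul S).const_sub 1
  have h2 := ((hasDerivAt_id s).const_add 1).log (by simp only [id]; linarith)
  have h3 := (h1.const_mul B).sub (h2.const_mul ε)
  refine h3.congr_deriv ?_
  simp only [id]
  field_simp

lemma deriv_deriv_barrier {B S ε s : ℝ} (hs : 0 < s) :
    deriv (deriv fun s => B * (1 - S / s) - ε * Real.log (1 + s)) s =
      -(2 * B * S / s ^ 3) + ε / (1 + s) ^ 2 := by
  have h0 : deriv (fun s => B * (1 - S / s) - ε * Real.log (1 + s)) =ᶠ[𝓝 s]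
      fun s => B * S * (s ^ 2)⁻¹ - ε * (1 + s)⁻¹ := by
    filter_upwards [lt_mem_nhds hs] with x hx
    rw [(hasDerivAt_barrier hx).deriv]
    rfl
  have h1 := ((hasDerivAt_pow 2 s).inv (by positivity)).const_mul (B * S)
  have h2 := (((hasDerivAt_id s).const_add 1).inv (by simp only [id]; positivity)).const_mul ε
  rw [h0.deriv_eq]
  refine (h1.sub h2).deriv.trans ?_
  simp only [id]
  field_simp
  ring

/-- For `s = |F|²`, `T = |F^⊤|²` and `ρ` the component of `F` in a fixed direction `a`, the right
side is the operator `Δ + ½⟨F, ∇ ·⟩` applied to `⟨F, a⟩` plus the barrier, since `|F|²` is mapped to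
`|F|² + 2 n`. -/
lemma barrier_pos {B S ε s T ρ : ℝ} {n : ℕ} (hn : 1 ≤ n) (hB : 0 ≤ B) (hS : 0 ≤ S) (hε : 0 ≤ ε)
    (hs : 8 ≤ s) (hT0 : 0 ≤ T) (hT : T ≤ s) (hρ : ε * (4 * n) < ρ) :
    0 < 1 / 2 * ρ + (B * S / s ^ 2 - ε / (1 + s)) * (s + 2 * n) +
      4 * (-(2 * B * S / s ^ 3) + ε / (1 + s) ^ 2) * T := by
  have hs0 : 0 < s := by linarith
  have hn' : (1 : ℝ) ≤ n := by exact_mod_cast hn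
  have h1 : ε / (1 + s) * (s + 2 * n) ≤ 2 * n * ε := by
    rw [div_mul_eq_mul_div, div_le_iff₀ (by positivity)]
    have h2 : s + 2 * n ≤ 2 * n * (1 + s) := by nlinarith
    calc ε * (s + 2 * n) ≤ ε * (2 * n * (1 + s)) := by gcongr
      _ = _ := by ring
  have h2 : B * S / s ^ 2 * s ≤ B * S / s ^ 2 * (s + 2 * n) := by
    gcongr
    linarith
  have h3 : 4 * (2 * B * S / s ^ 3) * T ≤ B * S / s ^ 2 * 8 := by
    calc 4 * (2 * B * S / s ^ 3) * T ≤ 4 * (2 * B * S / s ^ 3) * s := by gcongr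
      _ = _ := by field_simp; ring
  have h4 : B * S / s ^ 2 * 8 ≤ B * S / s ^ 2 * s := by gcongr
  have h5 : 0 ≤ 4 * (ε / (1 + s) ^ 2) * T := by positivity
  nlinarith

end Barrier

namespace IsConicalGraph

variable {n : ℕ} {M : Type*} [TopologicalSpace M] [ChartedSpace (Euc n) M]
  [IsManifold (𝓡 n) ∞ M]
  {F ν : M → Euc (n + 1)} {k : ℕ} {E : Set M} {e : Euc (n + 1)} {α : ℝ}
  {J : Euc n →ₗᵢ[ℝ] Euc (n + 1)} {r : ℝ} {w : Euc n → ℝ} {Φ : Euc n → M}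

/-- The graph function cannot blow up at the inner boundary of the parametrization, by the maximum
principle for the function `⟨F, a⟩ + B (1 - S / |F|²) - ε log (1 + |F|²)` at a suitable point of the
inner part, where `a` is the unit vector on the cone below this point. -/
lemma not_unbounded (h : IsConicalGraph k F E e α J r w Φ) (hF : IsOrientedHypersurface F ν)
    (hE : IsSelfExpander F ν) (hn : 2 ≤ n)
    (hpos : ∀ y, r < ‖y‖ → 0 < 1 - Real.cos α * (‖y‖⁻¹ * w y)) {σ : ℝ} (hσ1 : σ = 1 ∨ σ = -1)
    (hunb : ∀ A, ∃ δ, 0 < δ ∧ δ ≤ 1 ∧ ∀ y, r < ‖y‖ → ‖y‖ ≤ r + δ → A < σ * (‖y‖⁻¹ * w y)) :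
    False := by
  have hs := h.sin_pos
  have hr := h.radius_pos
  obtain ⟨s, hsdef⟩ : ∃ s : Euc n → ℝ, ∀ y, s y = ‖F (Φ y)‖ ^ 2 := ⟨_, fun _ => rfl⟩
  have hs_nonneg : ∀ y, 0 ≤ s y := fun y => by rw [hsdef]; positivity
  have hscont : ContinuousOn s {y | r < ‖y‖} := by
    rw [show s = fun y => ‖F (Φ y)‖ ^ 2 from funext hsdef]
    exact ((hF.smooth.continuous.comp_continuousOn h.continuousOn).norm).pow 2
  -- the squared distance to the origin is arbitrarily large near the inner boundary
  have hslarge : ∀ A, 0 < A → ∃ δ, 0 < δ ∧ δ ≤ 1 ∧ ∀ y, r < ‖y‖ → ‖y‖ ≤ r + δ → A < s y := by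
    intro A hA
    obtain ⟨δ, hδ0, hδ1, hδ⟩ := hunb ((A + 1) / r)
    refine ⟨δ, hδ0, hδ1, fun y hy hyδ => ?_⟩
    have h1 := hδ y hy hyδ
    have hy0 : 0 < ‖y‖ := hr.trans hy
    have h2 : A + 1 < σ * w y := by
      have h3 : σ * (‖y‖⁻¹ * w y) = σ * w y / ‖y‖ := by field_simp
      rw [h3, lt_div_iff₀ hy0] at h1
      refine lt_of_le_of_lt ?_ h1
      rw [div_mul_eq_mul_div, le_div_iff₀ hr]
      gcongr
    have h4 : σ ^ 2 = 1 := by rcases hσ1 with rfl | rfl <;> norm_num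
    have h5 : w y ^ 2 = (σ * w y) ^ 2 := by rw [mul_pow, h4, one_mul]
    rw [hsdef, h.norm_sq_apply hy, h5]
    nlinarith [sq_nonneg (‖y‖ / Real.sin α)]
  obtain ⟨t₁, ht₁⟩ : ∃ t₁, t₁ = (r + 1) / Real.sin α := ⟨_, rfl⟩
  have ht₁pos : 0 < t₁ := by rw [ht₁]; positivity
  obtain ⟨s₁, hs₁⟩ : ∃ s₁, ∀ y, ‖y‖ = r + 1 → s y ≤ s₁ := by
    obtain ⟨c, hc⟩ := (isCompact_sphere (0 : Euc n) (r + 1)).exists_bound_of_continuousOn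
      (hscont.mono fun y hy => by
        rw [mem_sphere_zero_iff_norm] at hy
        change r < ‖y‖
        linarith)
    exact ⟨c, fun y hy => (le_abs_self _).trans (hc y (mem_sphere_zero_iff_norm.2 hy))⟩
  obtain ⟨S, hS8, hSs₁⟩ : ∃ S : ℝ, 8 ≤ S ∧ s₁ < S :=
    ⟨max 8 (s₁ + 1), le_max_left _ _, lt_of_lt_of_le (by linarith) (le_max_right _ _)⟩
  -- `t₁` is the maximum of `⟨F, a⟩` on the outer boundary `‖y‖ = r + 1`, where `|F|² < S`; the size
  -- of `B` makes the function exceed `t₁` where `|F|² ≥ 2 S`, as long as the logarithm is small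
  obtain ⟨B, hB⟩ : ∃ B, B = 2 * t₁ + 2 := ⟨_, rfl⟩
  have hBpos : 0 < B := by rw [hB]; positivity
  obtain ⟨y₁, hy₁r, hy₁r1, hy₁s⟩ : ∃ y₁ : Euc n, r < ‖y₁‖ ∧ ‖y₁‖ ≤ r + 1 ∧ 2 * S < s y₁ := by
    obtain ⟨δ, hδ0, hδ1, hδ⟩ := hslarge (2 * S) (by linarith)
    obtain ⟨v, hv0, -⟩ := exists_ne_zero_inner_eq_zero hn (0 : Euc n)
    have hv : ‖((r + δ) * ‖v‖⁻¹) • v‖ = r + δ := by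
      rw [norm_smul, norm_mul, norm_inv, norm_norm, mul_assoc,
        inv_mul_cancel₀ (norm_ne_zero_iff.2 hv0), mul_one, Real.norm_of_nonneg (by linarith)]
    exact ⟨_, by rw [hv]; linarith, by rw [hv]; linarith,
      hδ _ (by rw [hv]; linarith) (by rw [hv])⟩
  obtain ⟨ε, hε0, hε1, hε2⟩ : ∃ ε : ℝ, 0 < ε ∧ ε * Real.log (1 + s y₁) < 1 ∧
      ε * (4 * n) < r / Real.sin α := by
    obtain ⟨ε₁, h1, h1'⟩ := exists_pos_mul_lt (zero_lt_one (α := ℝ)) (Real.log (1 + s y₁))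
    obtain ⟨ε₂, h2, h2'⟩ := exists_pos_mul_lt (show 0 < r / Real.sin α by positivity) (4 * (n : ℝ))
    have hlog : 0 ≤ Real.log (1 + s y₁) := Real.log_nonneg (by linarith [hs_nonneg y₁])
    refine ⟨min ε₁ ε₂, lt_min h1 h2, lt_of_le_of_lt ?_ h1', lt_of_le_of_lt ?_ h2'⟩
    · rw [mul_comm]; gcongr; exact min_le_left _ _
    · rw [mul_comm]; gcongr; exact min_le_right _ _
  obtain ⟨κ, hκ⟩ : ∃ κ : ℝ → ℝ, κ = fun s => B * (1 - S / s) - ε * Real.log (1 + s) := ⟨_, rfl⟩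
  have hκle : ∀ s, 0 < s → κ s ≤ B - ε * Real.log (1 + s) := fun s hs => by
    have : 0 ≤ B * (S / s) := by positivity
    rw [hκ]; change B * (1 - S / s) - _ ≤ _; linarith
  -- maximizing `g` means maximizing over the direction `a` as well
  obtain ⟨g, hg⟩ : ∃ g : Euc n → ℝ, ∀ y, g y = ‖y‖ / Real.sin α + κ (s y) := ⟨_, fun _ => rfl⟩
  obtain ⟨δ, hδ0, hδ1, hδ⟩ : ∃ δ, 0 < δ ∧ δ ≤ 1 ∧ ∀ y, r < ‖y‖ → ‖y‖ ≤ r + δ → g y < 0 := by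
    obtain ⟨δ, hδ0, hδ1, hδ⟩ := hslarge (Real.exp ((t₁ + B) / ε)) (Real.exp_pos _)
    refine ⟨δ, hδ0, hδ1, fun y hy hyδ => ?_⟩
    have h1 := hδ y hy hyδ
    have hsy : 0 < s y := (Real.exp_pos _).trans h1
    have h2 : (t₁ + B) / ε < Real.log (1 + s y) :=
      (Real.lt_log_iff_exp_lt (by linarith)).2 (by linarith)
    rw [div_lt_iff₀' hε0] at h2
    have h3 : ‖y‖ / Real.sin α ≤ t₁ := by rw [ht₁]; gcongr; linarith
    rw [hg]
    linarith [hκle _ hsy]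
  have hg₁ : t₁ < g y₁ := by
    have h1 : 1 / 2 ≤ 1 - S / s y₁ := by
      have : S / s y₁ ≤ 1 / 2 := by
        rw [div_le_iff₀ (by linarith)]; linarith
      linarith
    have h2 : B * (1 / 2) ≤ B * (1 - S / s y₁) := by gcongr
    have h3 : 0 ≤ ‖y₁‖ / Real.sin α := by positivity
    rw [hg, hκ]
    change t₁ < ‖y₁‖ / Real.sin α + (B * (1 - S / s y₁) - ε * Real.log (1 + s y₁))
    linarith
  obtain ⟨K, hK⟩ : ∃ K : Set (Euc n), K = {y | (r + δ ≤ ‖y‖ ∧ ‖y‖ ≤ r + 1) ∧ S ≤ s y} := ⟨_, rfl⟩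
  have hKr : ∀ y ∈ K, r < ‖y‖ := fun y hy => by
    rw [hK] at hy
    linarith [hy.1.1]
  have hKc : IsCompact K := by
    have h1 : IsCompact {y : Euc n | r + δ ≤ ‖y‖ ∧ ‖y‖ ≤ r + 1} := by
      refine (isCompact_closedBall (0 : Euc n) (r + 1)).of_isClosed_subset
        ((isClosed_le continuous_const continuous_norm).inter
          (isClosed_le continuous_norm continuous_const)) fun y hy => ?_
      rw [mem_closedBall_zero_iff]
      exact hy.2
    rw [hK]
    refine h1.of_isClosed_subset ?_ fun y hy => hy.1
    exact (hscont.mono fun y hy => by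
      change r < ‖y‖
      linarith [hy.1]).preimage_isClosed_of_isClosed h1.isClosed isClosed_Ici
  have hgc : ContinuousOn g K := by
    rw [show g = fun y => ‖y‖ / Real.sin α + κ (s y) from funext hg]
    refine (continuous_norm.div_const _).continuousOn.add ?_
    intro y hy
    have hsy : 0 < s y := by
      rw [hK] at hy
      linarith [hy.2]
    have h1 : ContinuousAt κ (s y) := by
      rw [hκ]; exact (hasDerivAt_barrier hsy).continuousAt
    exact ContinuousAt.comp_continuousWithinAt h1 ((hscont.mono hKr) y hy)
  have hy₁K : y₁ ∈ K := by
    rw [hK]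
    refine ⟨⟨?_, hy₁r1⟩, by linarith⟩
    by_contra! hlt
    linarith [hδ y₁ hy₁r hlt.le]
  obtain ⟨y₂, hy₂, hmax⟩ := hKc.exists_isMaxOn ⟨y₁, hy₁K⟩ hgc
  have hy₂r := hKr y₂ hy₂
  have hg₂ : t₁ < g y₂ := hg₁.trans_le (hmax hy₁K)
  have hy₂' := hy₂
  rw [hK] at hy₂'
  obtain ⟨⟨h21, h22⟩, h23⟩ := hy₂'
  -- the maximum lies in the interior
  have h22' : ‖y₂‖ < r + 1 := by
    refine lt_of_le_of_ne h22 fun heq => ?_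
    linarith [hs₁ y₂ heq]
  have h21' : r + δ < ‖y₂‖ := by
    refine lt_of_le_of_ne h21 fun heq => ?_
    linarith [hδ y₂ hy₂r heq.symm.le]
  have h23' : S < s y₂ := by
    refine lt_of_le_of_ne h23 fun heq => ?_
    have h1 : ‖y₂‖ / Real.sin α ≤ t₁ := by rw [ht₁]; gcongr
    have h2 : κ (s y₂) ≤ 0 := by
      rw [hκ, ← heq]
      change B * (1 - S / S) - ε * Real.log (1 + S) ≤ 0
      rw [div_self (by linarith), sub_self, mul_zero, zero_sub, neg_nonpos]
      exact mul_nonneg hε0.le (Real.log_nonneg (by linarith))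
    rw [hg] at hg₂
    linarith
  have hs₂ : 0 < s y₂ := by linarith
  have hy₂0 : 0 < ‖y₂‖ := hr.trans hy₂r
  obtain ⟨θ, hθ⟩ : ∃ θ, θ = ‖y₂‖⁻¹ • y₂ := ⟨_, rfl⟩
  have hθ1 : ‖θ‖ = 1 := by
    rw [hθ, norm_smul, norm_inv, norm_norm, inv_mul_cancel₀ hy₂0.ne']
  have hy₂θ : y₂ = ‖y₂‖ • θ := by rw [hθ, smul_smul, mul_inv_cancel₀ hy₂0.ne', one_smul]
  have hinner₂ := (h.inner_apply_ray hpos hθ1 hy₂r).2 hy₂θ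
  have hlocmax : IsLocalMax (fun p => inner ℝ (F p) (J (Real.sin α • θ) + Real.cos α • e) +
      κ (‖F p‖ ^ 2)) (Φ y₂) := by
    obtain ⟨U, hU⟩ : ∃ U : Set (Euc n), U =
        {y | r < ‖y‖} ∩ s ⁻¹' Ioi S ∩ {y | r + δ < ‖y‖ ∧ ‖y‖ < r + 1} := ⟨_, rfl⟩
    have hUo : IsOpen U := by
      rw [hU]
      exact (hscont.isOpen_inter_preimage (isOpen_domain r) isOpen_Ioi).inter
        ((isOpen_lt continuous_const continuous_norm).inter
          (isOpen_lt continuous_norm continuous_const))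
    have hU2 : y₂ ∈ U := by rw [hU]; exact ⟨⟨hy₂r, h23'⟩, h21', h22'⟩
    have hUr : U ⊆ {y | r < ‖y‖} := by rw [hU]; exact fun y hy => hy.1.1
    filter_upwards [(h.isOpen_image U hUr hUo).mem_nhds ⟨y₂, hU2, rfl⟩]
    rintro _ ⟨y, hy, rfl⟩
    have hyK : y ∈ K := by
      rw [hU] at hy
      rw [hK]
      exact ⟨⟨hy.2.1.le, hy.2.2.le⟩, le_of_lt hy.1.2⟩
    have h1 := (h.inner_apply_ray hpos hθ1 (hUr hy)).1
    have h2 : g y ≤ g y₂ := hmax hyK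
    rw [hg, hg, hsdef, hsdef] at h2
    rw [hinner₂]
    linarith
  have hκ2 : ContDiffAt ℝ 2 κ (‖F (Φ y₂)‖ ^ 2) := by
    rw [← hsdef, hκ]
    have h1 : ContDiffAt ℝ 2 (fun s : ℝ => S / s) (s y₂) :=
      contDiffAt_const.div contDiffAt_id hs₂.ne'
    have h2 : ContDiffAt ℝ 2 (fun s : ℝ => Real.log (1 + s)) (s y₂) :=
      (contDiffAt_const.add contDiffAt_id).log (by simp only [id]; linarith)
    exact (contDiffAt_const.mul (contDiffAt_const.sub h1)).sub (contDiffAt_const.mul h2)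
  obtain ⟨T, hT0, hT, hTle⟩ := hF.le_of_isLocalMax_position hE _ (Φ y₂) hκ2 hlocmax
  rw [hinner₂, ← hsdef, hκ, (hasDerivAt_barrier hs₂).deriv, deriv_deriv_barrier hs₂] at hTle
  rw [← hsdef] at hT
  have := barrier_pos (n := n) (by lia) hBpos.le (by linarith : 0 ≤ S) hε0.le
    (by linarith : 8 ≤ s y₂) hT0 hT
    (ρ := ‖y₂‖ / Real.sin α) (hε2.trans (by gcongr))
  linarith

/-- Up to a compact set, an end of a complete mean-convex self-expander is the outer part of its
conical parametrization. -/
theorem exists_isCompact [T2Space M] (h : IsConicalGraph k F E e α J r w Φ)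
    (hF : IsOrientedHypersurface F ν) (hcomplete : IsCompleteHypersurface F)
    (hE : IsSelfExpander F ν) (hH : IsMeanConvex F ν) (hend : IsEnd E) (hn : 2 ≤ n) (R : ℝ) :
    ∃ K, IsCompact K ∧ E ⊆ K ∪ Φ '' {y | r < ‖y‖ ∧ R < ‖y‖} := by
  obtain ⟨σ, hσ1, hσ⟩ := h.exists_sign hF hE hH hn
  by_cases hb : ∃ θ : Euc n, ‖θ‖ = 1 ∧ ∃ A, ∀ τ ∈ Ioc r (r + 1), σ * (τ⁻¹ * w (τ • θ)) ≤ A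
  · obtain ⟨θ, hθ, A, hA⟩ := hb
    obtain ⟨δ, K, hδ, hK, hKΦ⟩ :=
      h.exists_annulus_of_bounded_ray hF hcomplete hend hn hσ1 hσ hθ hA
    exact h.exists_isCompact_of_annulus hδ hK hKΦ R
  · push Not at hb
    exact (h.not_unbounded hF hE hn (fun y hy => h.factor_pos hF hE hH hn hy) hσ1
      (h.exists_forall_lt_of_unbounded hσ hb)).elim

end IsConicalGraph

/-! ### Behaviour outside of compact sets -/

section Ends

variable {n : ℕ} {M : Type*} [TopologicalSpace M] [ChartedSpace (Euc n) M]
  {F ν : M → Euc (n + 1)} {k : ℕ} {E : Set M} {e : Euc (n + 1)} {α : ℝ}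
  {J : Euc n →ₗᵢ[ℝ] Euc (n + 1)} {r : ℝ} {w : Euc n → ℝ} {Φ : Euc n → M}

/-- For `n ≤ 1` the round cone without its vertex is empty or has two components. -/
lemma IsConicalGraph.two_le (h : IsConicalGraph k F E e α J r w Φ) (hE : IsConnected E) :
    2 ≤ n := by
  by_contra! hn
  have hmem : ∀ y, r < ‖y‖ → Φ y ∈ E := fun y hy => by
    rw [← h.image_eq]; exact ⟨y, hy, rfl⟩
  have hn1 : n = 1 := by
    by_contra hne
    have hn0 : n = 0 := by lia
    subst hn0
    obtain ⟨q, hq⟩ := hE.nonempty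
    rw [← h.image_eq] at hq
    obtain ⟨y, hy, -⟩ := hq
    exact h.ne_zero hy (Subsingleton.elim _ _)
  subst hn1
  have hcoord : Continuous fun y : Euc 1 => y 0 := by fun_prop
  have hne : ∀ c : ℝ, c = 1 ∨ c = -1 →
      r < ‖((r + 1) * c) • EuclideanSpace.single (0 : Fin 1) (1 : ℝ)‖ := by
    intro c hc
    have hc1 : |c| = 1 := by rcases hc with rfl | rfl <;> simp
    rw [norm_smul, PiLp.norm_single, norm_one, mul_one, norm_mul, Real.norm_eq_abs c, hc1, mul_one,
      Real.norm_of_nonneg (by linarith [h.radius_pos])]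
    linarith
  obtain ⟨q, hq, ⟨y, hy, hyq⟩, ⟨z, hz, hzq⟩⟩ := hE.isPreconnected
    (Φ '' ({y | r < ‖y‖} ∩ {y | 0 < y 0})) (Φ '' ({y | r < ‖y‖} ∩ {y | y 0 < 0}))
    (h.isOpen_image _ inter_subset_left ((IsConicalGraph.isOpen_domain r).inter
      (isOpen_lt continuous_const hcoord)))
    (h.isOpen_image _ inter_subset_left ((IsConicalGraph.isOpen_domain r).inter
      (isOpen_lt hcoord continuous_const)))
    (by
      rw [← h.image_eq]
      rintro _ ⟨y, hy, rfl⟩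
      rcases lt_trichotomy (y 0) 0 with h0 | h0 | h0
      · exact Or.inr ⟨y, ⟨hy, h0⟩, rfl⟩
      · refine absurd ?_ (h.ne_zero hy)
        ext i
        rw [Subsingleton.elim i 0]
        exact h0
      · exact Or.inl ⟨y, ⟨hy, h0⟩, rfl⟩)
    ⟨_, hmem _ (hne 1 (Or.inl rfl)), _, ⟨hne 1 (Or.inl rfl), by
      have := h.radius_pos
      simp only [mem_ofPred_eq, PiLp.smul_apply, PiLp.single_apply]
      simp
      linarith⟩, rfl⟩
    ⟨_, hmem _ (hne (-1) (Or.inr rfl)), _, ⟨hne (-1) (Or.inr rfl), by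
      have := h.radius_pos
      simp only [mem_ofPred_eq, PiLp.smul_apply, PiLp.single_apply]
      simp
      linarith⟩, rfl⟩
  have hyz : y = z := h.injOn hy.1 hz.1 (hyq.trans hzq.symm)
  have h1 : 0 < y 0 := hy.2
  have h2 : z 0 < 0 := hz.2
  rw [hyz] at h1
  linarith

variable [IsManifold (𝓡 n) ∞ M] [T2Space M]

lemma IsConicalGraph.eventually_cocompact (h : IsConicalGraph k F E e α J r w Φ)
    (hF : IsOrientedHypersurface F ν) (hcomplete : IsCompleteHypersurface F)
    (hE : IsSelfExpander F ν) (hH : IsMeanConvex F ν) (hend : IsEnd E) {P : M → Prop}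
    (hP : ∀ᶠ y in Bornology.cobounded (Euc n), P (Φ y)) :
    ∀ᶠ q in cocompact M, q ∈ E → P q := by
  obtain ⟨R, -, hR⟩ := (hasBasis_cobounded_norm (E := Euc n)).eventually_iff.1 hP
  obtain ⟨K, hK, hEK⟩ := h.exists_isCompact hF hcomplete hE hH hend (h.two_le hend.isConnected) R
  filter_upwards [hK.compl_mem_cocompact] with q hq hqE
  obtain ⟨y, hy, rfl⟩ := (hEK hqE).resolve_left hq
  exact hR hy.2.le

/-- A property which holds far out on all conical ends holds outside of a compact set. -/
lemma eventually_cocompact_of_conicalEnds (hF : IsOrientedHypersurface F ν)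
    (hcomplete : IsCompleteHypersurface F) (hE : IsSelfExpander F ν) (hH : IsMeanConvex F ν)
    (he : ‖e‖ = 1) (hk : 1 ≤ k) (hends : HasOneConicalEnd k F e ∨ HasTwoConicalEnds k F e) :
    2 ≤ n ∧ ∀ P : M → Prop,
      (∀ E e' α J r w Φ, IsConicalGraph k F E e' α J r w Φ → (e' = e ∨ e' = -e) →
        ∀ᶠ y in Bornology.cobounded (Euc n), P (Φ y)) → ∀ᶠ q in cocompact M, P q := by
  rcases hends with ⟨E, α, hα0, hα, hend, hEc, hcone⟩ |
    ⟨E₁, E₂, e₁, e₂, α, β, hα0, hα, hβ0, hβ, he₁, he₂, hend₁, hend₂, -, hEc, hcone₁, hcone₂⟩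
  · obtain ⟨J, r, w, Φ, h⟩ := hcone.exists_isConicalGraph hk he hα0 hα
    refine ⟨h.two_le hend.isConnected, fun P hP => ?_⟩
    filter_upwards [hEc.compl_mem_cocompact, h.eventually_cocompact hF hcomplete hE hH hend
      (hP _ _ _ _ _ _ _ h (Or.inl rfl))] with q hq hqP
    exact hqP (not_not.1 hq)
  · have hnorm : ∀ e', e' = e ∨ e' = -e → ‖e'‖ = 1 := by
      rintro e' (rfl | rfl)
      · exact he
      · rwa [norm_neg]
    obtain ⟨J₁, r₁, w₁, Φ₁, h₁⟩ := hcone₁.exists_isConicalGraph hk (hnorm _ he₁) hα0 hα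
    obtain ⟨J₂, r₂, w₂, Φ₂, h₂⟩ := hcone₂.exists_isConicalGraph hk (hnorm _ he₂) hβ0 hβ
    refine ⟨h₁.two_le hend₁.isConnected, fun P hP => ?_⟩
    filter_upwards [hEc.compl_mem_cocompact,
      h₁.eventually_cocompact hF hcomplete hE hH hend₁ (hP _ _ _ _ _ _ _ h₁ he₁),
      h₂.eventually_cocompact hF hcomplete hE hH hend₂ (hP _ _ _ _ _ _ _ h₂ he₂)]
      with q hq hq₁ hq₂
    exact (not_not.1 hq).elim hq₁ hq₂

/-- Symmetry of a self-expander with conical ends whose second fundamental form is small at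
infinity. -/
lemma isRotationallySymmetric_of_conicalEnds (hF : IsOrientedHypersurface F ν)
    (hcomplete : IsCompleteHypersurface F) (hE : IsSelfExpander F ν) (hH : IsMeanConvex F ν)
    (he : ‖e‖ = 1) (hk : 1 ≤ k) (hends : HasOneConicalEnd k F e ∨ HasTwoConicalEnds k F e)
    (hA : ∀ E e' α J r w Φ, IsConicalGraph k F E e' α J r w Φ →
      ∀ᶠ y in Bornology.cobounded (Euc n), ∀ κ, IsPrincipalCurvatures F ν (Φ y) κ →
        ∑ i, κ i ^ 2 ≤ 1 / 2) : IsRotationallySymmetric F e := by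
  obtain ⟨hn, hev⟩ := eventually_cocompact_of_conicalEnds hF hcomplete hE hH he hk hends
  refine hF.isRotationallySymmetric hn hE hH
    (hev _ fun E e' α J r w Φ h _ => hA E e' α J r w Φ h) (fun c => ?_) fun p s hp hs => ?_
  · have h1 : ∀ᶠ q in cocompact M, c < ‖F q‖ := by
      refine hev _ fun E e' α J r w Φ h _ => ?_
      filter_upwards [IsConicalGraph.eventually_cobounded r,
        IsConicalGraph.eventually_cobounded c] with y hy hyc
      have hs := h.sin_pos
      have h2 := h.norm_sq_apply hy
      have h3 : ‖y‖ ≤ ‖y‖ / Real.sin α :=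
        le_div_self (norm_nonneg _) hs (Real.sin_le_one α)
      refine hyc.trans_le (h3.trans ?_)
      rw [← sq_le_sq₀ (by positivity) (norm_nonneg _), h2]
      linarith [sq_nonneg (w y)]
    obtain ⟨K, hK, hKsub⟩ := mem_cocompact.1 h1
    refine hK.of_isClosed_subset
      (isClosed_eq hF.smooth.continuous.norm continuous_const) fun q hq => ?_
    by_contra hqK
    have h2 : c < ‖F q‖ := hKsub hqK
    exact h2.ne' hq
  · rw [Metric.tendsto_nhds]
    intro ε hε
    refine hev _ fun E e' α J r w Φ h he' => ?_
    have horth : ∀ x : Euc (n + 1), inner ℝ x e = (0 : ℝ) → inner ℝ x e' = (0 : ℝ) := by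
      intro x hx
      rcases he' with rfl | rfl
      · exact hx
      · rw [inner_neg_right, hx, neg_zero]
    exact Metric.tendsto_nhds.1
      (h.tendsto_inner_rotation_normal hF (horth p hp) (horth s hs)) ε hε

end Ends

theorem theorem1p1 {n : ℕ} {M : Type*} [TopologicalSpace M] [T2Space M]
    [ChartedSpace (Euc n) M] [IsManifold (𝓡 n) ∞ M]
    (F ν : M → Euc (n + 1)) (hF : IsOrientedHypersurface F ν)
    (hcomplete : IsCompleteHypersurface F)
    (hexpander : IsSelfExpander F ν) (hmean : IsMeanConvex F ν)
    (e : Euc (n + 1)) (he : ‖e‖ = 1) :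
    (HasOneConicalEnd 2 F e ∨ HasTwoConicalEnds 2 F e → IsRotationallySymmetric F e) ∧
    (IsConvexHypersurface F ν → HasOneConicalEnd 1 F e ∨ HasTwoConicalEnds 1 F e →
      IsRotationallySymmetric F e) := by
  constructor
  · intro hends
    refine isRotationallySymmetric_of_conicalEnds hF hcomplete hexpander hmean he one_le_two hends
      fun E e' α J r w Φ h => ?_
    rcases Nat.eq_zero_or_pos n with rfl | hn
    · exact Eventually.of_forall fun y κ _ => by simp
    have hn' : (1 : ℝ) ≤ n := by exact_mod_cast hn
    filter_upwards [h.eventually_norm_dmap_normal_le hF le_rfl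
      (show (0 : ℝ) < 1 / (2 * n) by positivity)] with y hy κ hκ
    refine (hκ.sum_sq_le hy).trans ?_
    have h1 : (n : ℝ) * (1 / (2 * n)) ^ 2 = 1 / (4 * n) := by
      field_simp
      norm_num
    rw [h1]
    exact one_div_le_one_div_of_le (by norm_num) (by linarith)
  · intro hconvex hends
    refine isRotationallySymmetric_of_conicalEnds hF hcomplete hexpander hmean he le_rfl hends
      fun E e' α J r w Φ h => ?_
    have h1 := (h.tendsto_inner_apply_normal hF).eventually
      (gt_mem_nhds (zero_lt_one (α := ℝ)))
    filter_upwards [h1] with y hy κ hκ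
    -- by convexity `|A|² ≤ H²`
    have hκ0 : ∀ i, 0 ≤ κ i := fun i => by
      obtain ⟨v, hv1, hv2⟩ := hκ.1 i
      have h2 := hF.neg_inner_dmap_nonneg hconvex (Φ y) v
      rwa [hv2, inner_neg_left, neg_neg, inner_smul_left, real_inner_self_eq_norm_sq, hv1,
        one_pow, mul_one] at h2
    have hH : ∑ i, κ i ≤ 1 / 2 := by
      rw [hκ.2, hexpander]
      linarith
    have h2 : ∑ i, κ i ^ 2 ≤ (∑ i, κ i) ^ 2 :=
      Finset.sum_sq_le_sq_sum_of_nonneg fun i _ => hκ0 i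
    have h3 : 0 ≤ ∑ i, κ i := Finset.sum_nonneg fun i _ => hκ0 i
    nlinarith
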